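/- Let $m,\alpha>0$ and let $s_t:\mathbb R^n\times\mathbb R^n\to\mathbb C$, $t>0$, be a family of kernels, Borel measurable in $(t,x,y)$, satisfying with a constant $K$ the size condition $$|s_t(x,y)|\le K\,\frac{t^{\alpha}}{(t+|x-y|)^{m+\alpha}}$$ and the $y$-Hölder condition $$|s_t(x,y)-s_t(x,z)|\le K\,\frac{|y-z|^{\alpha}}{(t+|x-y|)^{m+\alpha}}\qquad\text{whenever } |y-z|<t/2 .$$ For a complex Borel measure $\nu$ on $\mathbb R^n$ and a cube $Q\subset\mathbb R^n$ (with sides parallel to the axes) of side length $\ell(Q)$ put $$\theta_t\nu(x)=\int s_t(x,y)\,d\nu(y),\qquad V_Q\nu(x)=\Big(\int_0^{\ell(Q)}|\theta_t\nu(x)|^2\,\frac{dt}{t}\Big)^{1/2},$$ and for a positive Borel measure $\mu$ and a function $f$ put $$V_\mu f(x)=\Big(\int_0^\infty\Big|\int s_t(x,y)f(y)\,d\mu(y)\Big|^2\,\frac{dt}{t}\Big)^{1/2}.$$ Write $|\nu|$ for the variation measure of $\nu$ and $\|\nu\|=|\nu|(\mathbb R^n)$. Let $\mu$ be a positive Borel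 measure on $\mathbb R^n$ of order $m$, that is, $\mu(B(x,r))\le C_\mu r^m$ for all $x\in\mathbb R^n$, $r>0$. Let $B_1,B_2<\infty$, $\epsilon_0\in(0,1)$ and $s>0$ be given constants, let $Q\subset\mathbb R^n$ be a cube, and let $\nu$ be a complex Borel measure such that 1. $\operatorname{spt}\nu\subset Q$; 2. $\nu(Q)=\mu(Q)$; 3. $\|\nu\|\le B_1\mu(Q)$; 4. $|\nu|(A)\le \dfrac{\|\nu\|}{32B_1}$ for every Borel set $A\subset Q$ with $\mu(A)\le\epsilon_0\mu(Q)$. Suppose further that $U_Q\subset\mathbb R^n$ is a Borel set with $|\nu|(U_Q)\le\dfrac{\|\nu\|}{16B_1}$ and $$\sup_{\lambda>0}\lambda^s\,\mu\big(\{x\in Q\setminus U_Q:\ V_Q\nu(x)>\lambda\}\big)\le B_2\|\nu\| .$$ Then there is a Borel set $G_Q\subset Q\setminus U_Q$ such that $\mu(G_Q)\ge c\,\mu(Q)$ and $$\|1_{G_Q}V_\mu f\|_{L^2(\mu)}\le C\,\|f\|_{L^2(\mu)}$$ for every $f\in L^2(\mu)$ that vanishes ($\mu$-a.e.) outside $G_Q$.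 Here $c>0$ and $C<\infty$ depend only on $n,m,\alpha,K,C_\mu,B_1,B_2,\epsilon_0,s$. -/

import Mathlib

open MeasureTheory Set
open scoped ENNReal NNReal

noncomputable section

namespace VerticalSquareFunction

/-- A closed cube in `ℝⁿ` with sides parallel to the axes, given by centre and side length. -/
structure Cube (n : ℕ) where
  center : EuclideanSpace ℝ (Fin n)
  side : ℝ
  side_pos : 0 < side

/-- The set of points of a cube. -/
def Cube.toSet {n : ℕ} (Q : Cube n) : Set (EuclideanSpace ℝ (Fin n)) :=
  {x | ∀ i, |x i - Q.center i| ≤ Q.side / 2}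

/-- `μ` is of order `m` with constant `C`: `μ(B(x,r)) ≤ C r ^ m` for all `x` and all `r > 0`. -/
def IsOfOrder {n : ℕ} (μ : Measure (EuclideanSpace ℝ (Fin n))) (m : ℝ) (C : ℝ≥0) : Prop :=
  ∀ (x : EuclideanSpace ℝ (Fin n)) (r : ℝ), 0 < r →
    μ (Metric.ball x r) ≤ ENNReal.ofReal (C * r ^ m)

/-- A measurable family of kernels `k t : ℝⁿ × ℝⁿ → ℂ`, `t > 0` (the values at `t ≤ 0` play no
role), with the size condition and the Hölder condition in the second variable, both with
constant `K`. -/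
structure IsSquareKernel {n : ℕ}
    (k : ℝ → EuclideanSpace ℝ (Fin n) → EuclideanSpace ℝ (Fin n) → ℂ)
    (m α : ℝ) (K : ℝ≥0) : Prop where
  measurable : Measurable
    (fun p : Ioi (0 : ℝ) × EuclideanSpace ℝ (Fin n) × EuclideanSpace ℝ (Fin n) =>
      k p.1 p.2.1 p.2.2)
  size : ∀ t : ℝ, 0 < t → ∀ x y,
    ‖k t x y‖ ≤ K * (t ^ α / (t + ‖x - y‖) ^ (m + α))
  holder : ∀ t : ℝ, 0 < t → ∀ x y z, ‖y - z‖ < t / 2 →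
    ‖k t x y - k t x z‖ ≤ K * (‖y - z‖ ^ α / (t + ‖x - y‖) ^ (m + α))

/-- `θ_t ν(x) = ∫ k_t(x,y) dν(y)` for a complex measure `ν`. -/
def thetaMeasure {n : ℕ} (k : ℝ → EuclideanSpace ℝ (Fin n) → EuclideanSpace ℝ (Fin n) → ℂ)
    (ν : ComplexMeasure (EuclideanSpace ℝ (Fin n))) (t : ℝ) (x : EuclideanSpace ℝ (Fin n)) : ℂ :=
  ν.integral (fun y => k t x y) (ContinuousLinearMap.mul ℝ ℂ)

/-- `θ_t^μ f(x) = ∫ k_t(x,y) f(y) dμ(y)`. -/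
def thetaFun {n : ℕ} (k : ℝ → EuclideanSpace ℝ (Fin n) → EuclideanSpace ℝ (Fin n) → ℂ)
    (μ : Measure (EuclideanSpace ℝ (Fin n))) (f : EuclideanSpace ℝ (Fin n) → ℂ)
    (t : ℝ) (x : EuclideanSpace ℝ (Fin n)) : ℂ :=
  ∫ y, k t x y * f y ∂μ

/-- The truncated vertical square function of a complex measure,
`V_Q ν(x) = (∫_0^{ℓ(Q)} |θ_t ν(x)|² dt/t)^{1/2} ∈ [0,∞]`. -/
def squareTrunc {n : ℕ} (k : ℝ → EuclideanSpace ℝ (Fin n) → EuclideanSpace ℝ (Fin n) → ℂ)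
    (Q : Cube n) (ν : ComplexMeasure (EuclideanSpace ℝ (Fin n)))
    (x : EuclideanSpace ℝ (Fin n)) : ℝ≥0∞ :=
  (∫⁻ t in Ioo 0 Q.side, ‖thetaMeasure k ν t x‖ₑ ^ 2 / ENNReal.ofReal t) ^ (1 / 2 : ℝ)

/-- The vertical square function with respect to `μ`,
`V_μ f(x) = (∫_0^∞ |θ_t^μ f(x)|² dt/t)^{1/2} ∈ [0,∞]`. -/
def squareFun {n : ℕ} (k : ℝ → EuclideanSpace ℝ (Fin n) → EuclideanSpace ℝ (Fin n) → ℂ)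
    (μ : Measure (EuclideanSpace ℝ (Fin n))) (f : EuclideanSpace ℝ (Fin n) → ℂ)
    (x : EuclideanSpace ℝ (Fin n)) : ℝ≥0∞ :=
  (∫⁻ t in Ioi (0 : ℝ), ‖thetaFun k μ f t x‖ₑ ^ 2 / ENNReal.ofReal t) ^ (1 / 2 : ℝ)

end VerticalSquareFunction

end

open VerticalSquareFunction

set_option linter.unusedSectionVars false

noncomputable section

/-! ### Nested countable partitions and functions constant on their cells. -/

namespace VerticalSquareFunction

/-! The restriction of `μ` to `Q` and the measure `ν` are written as densities `g` and `h` of one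
finite measure `ρ` and compared along the cells of a dyadic grid with a random shift `w`. For `t` of
size `ℓ(Q) 2^(-j)` the central object is the defect of a density `φ` at `x`: the difference between
`θ_t(φρ)(x)` and `⟨φ⟩ θ_t μ(x)`, where `⟨φ⟩` is the quotient of the `φρ`-mass and the `gρ`-mass of
the level `j` cell of `x`.

If `φ` has mean zero on the cells of level at most `l` and is a multiple of `g` on the level `l + 1`
cell of `x`, its defect decays like `2^(-(α/2)|j-l|)` (`enorm_defect_le`). For `l ≥ j` this is
cancellation against the Hölder condition. For `l < j` only points outside the level `l + 1` cell of
`x` contribute, and they are far away provided `x` is good at scale `j`, that is, not close to the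
boundaries of the cells of level at most `j`.

The measure `ν` is stopped at the first cells `R` with `|ν|(R) > A μ(R)` and expanded in martingale
increments. On live cells these have square energy at most a multiple of `A ‖ν‖`
(`sum_integral_norm_diff_sq_le_mass`). The jumps at stopped cells are compensated to regain mean
zero, and their total mass is at most a multiple of `‖ν‖`. By Chebyshev, off a set of small
`μ`-measure the square function of the defect of `ν` over the good scales is bounded
(`measure_majorant_gt_le`).

Where moreover `V_Q ν` is bounded and all averages of `ν` exceed `1/4` in modulus, the identity `θ_t
ν = defect + ⟨ν⟩ θ_t μ` bounds the square function of `θ_t μ` pointwise. Such points are called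
controlled. In every grid they fill a proportion `ε₀` of `Q` (`le_measure_controlled`): the cells
with small average carry `ν`-mass at most `μ(Q)/4` in modulus, and if the controlled set were
smaller, absolute continuity would leave total variation at most `μ(Q)/8` for everything else,
against `ν(Q) = μ(Q)`.

For a bounded `f` the same expansion applies to `fμ` and has no stopped cells. In `θ_t(fμ) = defect
+ ⟨f⟩ θ_t μ` the first term is handled by orthogonality. In the second the averages are handled by
Doob's maximal inequality and `θ_t μ` is already under pointwise control, so no Carleson embedding
is needed (`tsum_shellSq_le`).

The set `G` consists of the points controlled for a set of shifts of probability at least `ε₀/2`.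
Every point is bad at a given scale with probability at most `ε₀/4`, so at each scale a point of `G`
is controlled and good at once with probability at least `ε₀/4`. Averaging over `w` therefore
recovers all scales `t ≤ ℓ(Q)`, and the scales `t > ℓ(Q)` follow from the size condition. -/

/-- A nested sequence of countable measurable partitions, given by the index of the cell that
contains a point; the partition of level `0` is trivial. -/
structure CellTree (X ι : Type*) [MeasurableSpace X] [MeasurableSpace ι] where
  idx : ℕ → X → ι
  measurable_idx : ∀ l, Measurable (idx l)
  nested : ∀ l x y, idx (l + 1) x = idx (l + 1) y → idx l x = idx l y
  root : ∀ x y, idx 0 x = idx 0 y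

namespace CellTree

variable {X ι : Type*} [MeasurableSpace X] [MeasurableSpace ι] (𝒟 : CellTree X ι)

/-- The cell of level `l` that contains `x`. -/
def cell (l : ℕ) (x : X) : Set X := {y | 𝒟.idx l y = 𝒟.idx l x}

/-- A function that is constant on the cells of level `l`. -/
def Adapted {β : Type*} (l : ℕ) (ψ : X → β) : Prop :=
  ∀ x y, 𝒟.idx l x = 𝒟.idx l y → ψ x = ψ y

variable {𝒟}

lemma mem_cell {l : ℕ} {x y : X} : y ∈ 𝒟.cell l x ↔ 𝒟.idx l y = 𝒟.idx l x := Iff.rfl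

lemma cell_eq {l : ℕ} {x y : X} (h : 𝒟.idx l x = 𝒟.idx l y) : 𝒟.cell l x = 𝒟.cell l y := by
  simp [cell, h]

lemma measurableSet_cell [MeasurableSingletonClass ι] (l : ℕ) (x : X) : MeasurableSet (𝒟.cell l x) :=
  𝒟.measurable_idx l (measurableSet_singleton _)

lemma idx_eq_of_le {i l : ℕ} (hil : i ≤ l) {x y : X} (h : 𝒟.idx l x = 𝒟.idx l y) :
    𝒟.idx i x = 𝒟.idx i y := by
  induction l, hil using Nat.le_induction with
  | base => exact h
  | succ l _ ih => exact ih (𝒟.nested l x y h)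

lemma cell_subset {i l : ℕ} (hil : i ≤ l) (x : X) : 𝒟.cell l x ⊆ 𝒟.cell i x :=
  fun _ hy => idx_eq_of_le hil hy

lemma cell_zero (x : X) : 𝒟.cell 0 x = univ := by
  ext y; simp [cell, 𝒟.root y x]

lemma Adapted.of_le {β : Type*} {i l : ℕ} (hil : i ≤ l) {ψ : X → β} (h : 𝒟.Adapted i ψ) :
    𝒟.Adapted l ψ := fun x y hxy => h x y (idx_eq_of_le hil hxy)

lemma Adapted.comp {β δ : Type*} {l : ℕ} {ψ : X → β} (h : 𝒟.Adapted l ψ) (u : β → δ) :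
    𝒟.Adapted l (fun x => u (ψ x)) := fun x y hxy => by simp only [h x y hxy]

lemma Adapted.comp₂ {β β' δ : Type*} {l : ℕ} {ψ : X → β} {ψ' : X → β'} (h : 𝒟.Adapted l ψ)
    (h' : 𝒟.Adapted l ψ') (u : β → β' → δ) :
    𝒟.Adapted l (fun x => u (ψ x) (ψ' x)) := fun x y hxy => by simp only [h x y hxy, h' x y hxy]

lemma adapted_const {β : Type*} (l : ℕ) (b : β) : 𝒟.Adapted l (fun _ => b) := fun _ _ _ => rfl

lemma adapted_mem_cell {i l : ℕ} (hil : i ≤ l) (x : X) : 𝒟.Adapted l (fun y => y ∈ 𝒟.cell i x) :=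
  fun y z h => by simp only [mem_cell, idx_eq_of_le hil h]

open Classical in
lemma Adapted.ite {β : Type*} {l : ℕ} {p : X → Prop} {ψ ψ' : X → β} (hp : 𝒟.Adapted l p)
    (h : 𝒟.Adapted l ψ) (h' : 𝒟.Adapted l ψ') :
    𝒟.Adapted l (fun x => if p x then ψ x else ψ' x) :=
  fun x y hxy => by simp only [hp x y hxy, h x y hxy, h' x y hxy]

lemma adapted_cellIntegral {F : Type*} [NormedAddCommGroup F] [NormedSpace ℝ F] (ρ : Measure X)
    (φ : X → F) (l : ℕ) : 𝒟.Adapted l (fun x => ∫ y in 𝒟.cell l x, φ y ∂ρ) :=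
  fun x y hxy => by simp only [cell_eq hxy]

variable [Countable ι] [MeasurableSingletonClass ι]

lemma Adapted.measurable {β : Type*} [MeasurableSpace β] {l : ℕ} {ψ : X → β}
    (h : 𝒟.Adapted l ψ) : Measurable ψ := by
  rcases isEmpty_or_nonempty X with hX | ⟨⟨x₀⟩⟩
  · exact measurable_of_empty _
  have : Nonempty β := ⟨ψ x₀⟩
  obtain ⟨u, hu⟩ := (Function.factorsThrough_iff (g := ψ) (f := 𝒟.idx l)).1 (fun x y hxy => h x y hxy)
  rw [hu]
  exact (measurable_of_countable u).comp (𝒟.measurable_idx l)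

lemma Adapted.measurableSet {l : ℕ} {p : X → Prop} (h : 𝒟.Adapted l p) :
    MeasurableSet {x | p x} := measurableSet_setOfPred.2 h.measurable

lemma hasSum_fiber_integral {F : Type*} [NormedAddCommGroup F] [NormedSpace ℝ F]
    {ρ : Measure X} (l : ℕ) {φ : X → F} (hφ : Integrable φ ρ) :
    HasSum (fun i : ι => ∫ y in 𝒟.idx l ⁻¹' {i}, φ y ∂ρ) (∫ y, φ y ∂ρ) := by
  have := hasSum_integral_iUnion (μ := ρ) (f := φ) (s := fun i : ι => 𝒟.idx l ⁻¹' {i})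
    (fun i => 𝒟.measurable_idx l (measurableSet_singleton i))
    (fun i j hij => by
      refine Set.disjoint_left.2 fun x hx hx' => hij ?_
      simp only [mem_preimage, mem_singleton_iff] at hx hx'
      rw [← hx, ← hx'])
    (by exact hφ.integrableOn)
  have hU : (⋃ i : ι, 𝒟.idx l ⁻¹' {i}) = univ := by
    ext x; simp
  rwa [hU, Measure.restrict_univ] at this

/-- The adapted factor is constant on each cell and comes out of the integral there. This is the
orthogonality of martingale increments, used in place of conditional expectations. -/
lemma integral_adapted_mul_eq_zero {𝕜 : Type*} [RCLike 𝕜] {ρ : Measure X} {l : ℕ}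
    {ψ φ : X → 𝕜} (hψ : 𝒟.Adapted l ψ)
    (hψφ : Integrable (fun x => ψ x * φ x) ρ)
    (h0 : ∀ x, ψ x ≠ 0 → ∫ y in 𝒟.cell l x, φ y ∂ρ = 0) :
    ∫ x, ψ x * φ x ∂ρ = 0 := by
  have hs := hasSum_fiber_integral (𝒟 := 𝒟) l hψφ
  have hz : (fun i : ι => ∫ y in 𝒟.idx l ⁻¹' {i}, ψ y * φ y ∂ρ) = fun _ => 0 := by
    funext i
    by_cases hi : ∃ x, 𝒟.idx l x = i
    · obtain ⟨x, rfl⟩ := hi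
      have hc : 𝒟.idx l ⁻¹' {𝒟.idx l x} = 𝒟.cell l x := rfl
      rw [hc, setIntegral_congr_fun (measurableSet_cell l x)
        (g := fun y => ψ x * φ y) (fun y hy => by simp only [hψ y x hy]), integral_const_mul]
      by_cases hx : ψ x = 0
      · simp [hx]
      · simp [h0 x hx]
    · have : 𝒟.idx l ⁻¹' {i} = ∅ := by
        ext x; simp only [mem_preimage, mem_singleton_iff, mem_empty_iff_false, iff_false]
        exact fun h => hi ⟨x, h⟩
      simp [this]
  rw [hz] at hs
  exact hs.unique hasSum_zero

/-- Transfers an inequality between cell integrals to the whole space: `ψ` is later taken to be `1`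
or the indicator of a union of cells. -/
lemma integral_adapted_mul_nonneg {ρ : Measure X} {l : ℕ} {ψ φ : X → ℝ} (hψ : 𝒟.Adapted l ψ)
    (hψφ : Integrable (fun x => ψ x * φ x) ρ) (hψ0 : ∀ x, 0 ≤ ψ x)
    (h0 : ∀ x, ψ x ≠ 0 → 0 ≤ ∫ y in 𝒟.cell l x, φ y ∂ρ) :
    0 ≤ ∫ x, ψ x * φ x ∂ρ := by
  have hs := hasSum_fiber_integral (𝒟 := 𝒟) l hψφ
  refine hs.nonneg fun i => ?_
  by_cases hi : ∃ x, 𝒟.idx l x = i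
  · obtain ⟨x, rfl⟩ := hi
    have hc : 𝒟.idx l ⁻¹' {𝒟.idx l x} = 𝒟.cell l x := rfl
    rw [hc, setIntegral_congr_fun (measurableSet_cell l x)
      (g := fun y => ψ x * φ y) (fun y hy => by simp only [hψ y x hy]), integral_const_mul]
    by_cases hx : ψ x = 0
    · simp [hx]
    · exact mul_nonneg (hψ0 x) (h0 x hx)
  · have : 𝒟.idx l ⁻¹' {i} = ∅ := by
      ext x; simp only [mem_preimage, mem_singleton_iff, mem_empty_iff_false, iff_false]
      exact fun h => hi ⟨x, h⟩
    simp [this]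

open Classical in
/-- A function with vanishing integrals over the cells of level `l` has vanishing integrals over
the cells of every coarser level. -/
lemma cellIntegral_eq_zero_of_le {𝕜 : Type*} [RCLike 𝕜] {ρ : Measure X} {i l : ℕ} (hil : i ≤ l)
    {φ : X → 𝕜}
    (hφ : Integrable φ ρ) (h0 : ∀ x, ∫ y in 𝒟.cell l x, φ y ∂ρ = 0) (x : X) :
    ∫ y in 𝒟.cell i x, φ y ∂ρ = 0 := by
  have he : (fun y => (if y ∈ 𝒟.cell i x then (1 : 𝕜) else 0) * φ y)
      = (𝒟.cell i x).indicator φ := by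
    funext y; by_cases hy : y ∈ 𝒟.cell i x <;> simp [hy]
  have hint : Integrable (fun y => (if y ∈ 𝒟.cell i x then (1 : 𝕜) else 0) * φ y) ρ := by
    rw [he]; exact hφ.indicator (measurableSet_cell i x)
  have := integral_adapted_mul_eq_zero (𝒟 := 𝒟) (l := l)
    (Adapted.ite (adapted_mem_cell hil x) (adapted_const l (1 : 𝕜)) (adapted_const l 0)) hint
    (fun y _ => h0 y)
  rwa [he, integral_indicator (measurableSet_cell i x)] at this

end CellTree

/-! ### The stopped martingale of densities, its jumps and their compensators. -/

/-- A cell tree together with a finite measure `ρ`, a positive measure `g ρ` and a complex measure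
`h ρ`, and the level `A` at which the averages of `|h| ρ` with respect to `g ρ` are stopped. -/
structure StoppedPair (X ι : Type*) [MeasurableSpace X] [MeasurableSpace ι]
    extends CellTree X ι where
  ρ : Measure X
  finite_ρ : IsFiniteMeasure ρ
  g : X → ℝ
  h : X → ℂ
  A : ℝ
  measurable_g : Measurable g
  integrable_g : Integrable g ρ
  g_nonneg : ∀ x, 0 ≤ g x
  measurable_h : Measurable h
  integrable_h : Integrable h ρ
  A_nonneg : 0 ≤ A

namespace StoppedPair

open CellTree Classical

variable {X ι : Type*} [MeasurableSpace X] [MeasurableSpace ι] (S : StoppedPair X ι)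

instance : IsFiniteMeasure S.ρ := S.finite_ρ

/-- The `g ρ`-measure of a cell. -/
def gc (l : ℕ) (x : X) : ℝ := ∫ y in S.cell l x, S.g y ∂S.ρ

/-- The `h ρ`-measure of a cell. -/
def hc (l : ℕ) (x : X) : ℂ := ∫ y in S.cell l x, S.h y ∂S.ρ

/-- The `|h| ρ`-measure of a cell. -/
def tc (l : ℕ) (x : X) : ℝ := ∫ y in S.cell l x, ‖S.h y‖ ∂S.ρ

/-- The average of `h ρ` over a cell with respect to `g ρ`. -/
def avg (l : ℕ) (x : X) : ℂ := S.hc l x / S.gc l x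

/-- No cell of level at most `l` containing `x` is stopped. -/
def Live (l : ℕ) (x : X) : Prop := ∀ i ≤ l, S.tc i x ≤ S.A * S.gc i x

/-- The stopped martingale of densities: `avg * g` on live cells, `h` elsewhere. -/
def stopped (l : ℕ) (x : X) : ℂ := if S.Live l x then S.avg l x * S.g x else S.h x

/-- The points whose cell is stopped at level `l + 1`. -/
def stopSet (l : ℕ) : Set X := {x | S.Live l x ∧ ¬ S.Live (l + 1) x}

/-- The increment of the stopped martingale on the cells that are stopped at level `l + 1`. -/
def jump (l : ℕ) (x : X) : ℂ :=
  if x ∈ S.stopSet l then S.h x - S.avg l x * S.g x else 0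

/-- The average of the jump, which compensates it. -/
def comp (l : ℕ) (x : X) : ℂ :=
  if S.Live l x then (∫ y in S.cell l x, S.jump l y ∂S.ρ) / S.gc l x else 0

/-- The compensated jump. -/
def bad (l : ℕ) (x : X) : ℂ := S.jump l x - S.comp l x * S.g x

/-- The increment of the averages on live cells, with the compensator. -/
def diff (l : ℕ) (x : X) : ℂ :=
  (if S.Live (l + 1) x then S.avg (l + 1) x - S.avg l x else 0) + S.comp l x

/-- The compensator enters `diff` and `bad` with opposite signs. A cell stopped at level `l + 1`
contributes its jump, and a cell stopped earlier contributes nothing. -/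
lemma stopped_succ_sub (l : ℕ) (x : X) :
    S.stopped (l + 1) x - S.stopped l x = S.diff l x * S.g x + S.bad l x := by
  have hmono : S.Live (l + 1) x → S.Live l x := fun h i hi => h i (by omega)
  by_cases h1 : S.Live (l + 1) x
  · simp [stopped, diff, bad, jump, stopSet, h1, hmono h1]; ring
  · by_cases h0 : S.Live l x
    · simp [stopped, diff, bad, jump, stopSet, h1, h0]
    · simp [stopped, diff, bad, jump, stopSet, h1, h0, comp]

lemma gc_nonneg (l : ℕ) (x : X) : 0 ≤ S.gc l x :=
  integral_nonneg fun y => S.g_nonneg y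

lemma norm_hc_le (l : ℕ) (x : X) : ‖S.hc l x‖ ≤ S.tc l x := norm_integral_le_integral_norm _

variable {S}

lemma Live.of_le {i l : ℕ} (hil : i ≤ l) {x : X} (h : S.Live l x) : S.Live i x :=
  fun k hk => h k (hk.trans hil)

lemma Live.tc_le {l : ℕ} {x : X} (h : S.Live l x) : S.tc l x ≤ S.A * S.gc l x := h l le_rfl

lemma Live.norm_avg_le {l : ℕ} {x : X} (h : S.Live l x) : ‖S.avg l x‖ ≤ S.A := by
  rw [avg, norm_div, Complex.norm_real, Real.norm_of_nonneg (S.gc_nonneg l x)]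
  exact div_le_of_le_mul₀ (S.gc_nonneg l x) S.A_nonneg ((S.norm_hc_le l x).trans h.tc_le)

/-- On a live cell of zero `g`-mass the stopping rule forces zero `h`-mass, so the default value of
the quotient does no harm. -/
lemma Live.avg_mul_gc {l : ℕ} {x : X} (h : S.Live l x) : S.avg l x * S.gc l x = S.hc l x := by
  by_cases h0 : S.gc l x = 0
  · have : ‖S.hc l x‖ ≤ 0 := by
      refine (S.norm_hc_le l x).trans (h.tc_le.trans ?_); simp [h0]
    rw [norm_le_zero_iff.1 this, h0]; simp
  · rw [avg, div_mul_cancel₀]; exact_mod_cast h0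

variable (S)

lemma adapted_gc (l : ℕ) : S.Adapted l (S.gc l) := adapted_cellIntegral _ _ _
lemma adapted_hc (l : ℕ) : S.Adapted l (S.hc l) := adapted_cellIntegral _ _ _
lemma adapted_tc (l : ℕ) : S.Adapted l (S.tc l) := adapted_cellIntegral _ _ _

lemma adapted_avg (l : ℕ) : S.Adapted l (S.avg l) :=
  (S.adapted_hc l).comp₂ (S.adapted_gc l) (fun a b => a / (b : ℂ))

lemma adapted_live (l : ℕ) : S.Adapted l (S.Live l) := by
  intro x y hxy
  simp only [Live]
  refine propext (forall₂_congr fun i hi => ?_)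
  rw [S.adapted_tc i x y (idx_eq_of_le hi hxy), S.adapted_gc i x y (idx_eq_of_le hi hxy)]

lemma adapted_mem_stopSet (l : ℕ) : S.Adapted (l + 1) (fun x => x ∈ S.stopSet l) :=
  ((S.adapted_live l).of_le l.le_succ).comp₂ (S.adapted_live (l + 1)) (fun p q => p ∧ ¬ q)

lemma adapted_comp (l : ℕ) : S.Adapted l (S.comp l) :=
  (S.adapted_live l).ite
    ((adapted_cellIntegral S.ρ (S.jump l) l).comp₂ (S.adapted_gc l) (fun a b => a / (b : ℂ)))
    (adapted_const l 0)

lemma adapted_diff (l : ℕ) : S.Adapted (l + 1) (S.diff l) :=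
  ((S.adapted_live (l + 1)).ite
    ((S.adapted_avg (l + 1)).comp₂ ((S.adapted_avg l).of_le l.le_succ) (fun a b => a - b))
    (adapted_const (l + 1) 0)).comp₂ ((S.adapted_comp l).of_le l.le_succ) (fun a b => a + b)

variable [Countable ι] [MeasurableSingletonClass ι]

lemma measurableSet_live (l : ℕ) : MeasurableSet {x | S.Live l x} := (S.adapted_live l).measurableSet

lemma measurableSet_stopSet (l : ℕ) : MeasurableSet (S.stopSet l) :=
  (S.adapted_mem_stopSet l).measurableSet

lemma measurable_stopped (l : ℕ) : Measurable (S.stopped l) :=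
  Measurable.ite (S.measurableSet_live l)
    ((S.adapted_avg l).measurable.mul (Complex.measurable_ofReal.comp S.measurable_g))
    S.measurable_h

lemma measurable_jump (l : ℕ) : Measurable (S.jump l) :=
  Measurable.ite (S.measurableSet_stopSet l)
    (S.measurable_h.sub
      ((S.adapted_avg l).measurable.mul (Complex.measurable_ofReal.comp S.measurable_g)))
    measurable_const

lemma measurable_bad (l : ℕ) : Measurable (S.bad l) :=
  (S.measurable_jump l).sub
    ((S.adapted_comp l).measurable.mul (Complex.measurable_ofReal.comp S.measurable_g))

lemma norm_stopped_le (l : ℕ) (x : X) : ‖S.stopped l x‖ ≤ ‖S.h x‖ + S.A * S.g x := by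
  have := S.g_nonneg x
  have hA := S.A_nonneg
  by_cases h : S.Live l x
  · simp only [stopped, h, if_true, norm_mul, Complex.norm_real, Real.norm_of_nonneg this]
    have := mul_le_mul_of_nonneg_right h.norm_avg_le this
    linarith [norm_nonneg (S.h x)]
  · simp only [stopped, h, if_false]
    linarith [mul_nonneg hA this]

lemma integrable_h_add_g : Integrable (fun x => ‖S.h x‖ + S.A * S.g x) S.ρ :=
  S.integrable_h.norm.add (S.integrable_g.const_mul _)

lemma integrable_stopped (l : ℕ) : Integrable (S.stopped l) S.ρ :=
  S.integrable_h_add_g.mono' (S.measurable_stopped l).aestronglyMeasurable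
    (Filter.Eventually.of_forall (S.norm_stopped_le l))

lemma norm_jump_le (l : ℕ) (x : X) :
    ‖S.jump l x‖ ≤ (S.stopSet l).indicator (fun x => ‖S.h x‖ + S.A * S.g x) x := by
  by_cases hx : x ∈ S.stopSet l
  · simp only [jump, hx, if_true, indicator_of_mem]
    refine (norm_sub_le _ _).trans ?_
    rw [norm_mul, Complex.norm_real, Real.norm_of_nonneg (S.g_nonneg x)]
    gcongr
    · exact S.g_nonneg x
    · exact hx.1.norm_avg_le
  · simp [jump, hx]

lemma integrable_jump (l : ℕ) : Integrable (S.jump l) S.ρ :=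
  (S.integrable_h_add_g.indicator (S.measurableSet_stopSet l)).mono'
    (S.measurable_jump l).aestronglyMeasurable (Filter.Eventually.of_forall (S.norm_jump_le l))

lemma norm_cellIntegral_jump_le {l : ℕ} {x : X} (hx : S.Live l x) :
    ‖∫ y in S.cell l x, S.jump l y ∂S.ρ‖ ≤ 2 * S.A * S.gc l x := by
  calc ‖∫ y in S.cell l x, S.jump l y ∂S.ρ‖
      ≤ ∫ y in S.cell l x, (‖S.h y‖ + S.A * S.g y) ∂S.ρ := by
        refine norm_integral_le_of_norm_le S.integrable_h_add_g.integrableOn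
          (Filter.Eventually.of_forall fun y => (S.norm_jump_le l y).trans ?_)
        refine indicator_le_self' (fun y _ => ?_) y
        have := mul_nonneg S.A_nonneg (S.g_nonneg y); positivity
    _ = S.tc l x + S.A * S.gc l x := by
        rw [integral_add S.integrable_h.norm.integrableOn (S.integrable_g.const_mul _).integrableOn,
          integral_const_mul]; rfl
    _ ≤ _ := by linarith [hx.tc_le]

lemma norm_comp_le (l : ℕ) (x : X) : ‖S.comp l x‖ ≤ 2 * S.A := by
  have hA := S.A_nonneg
  by_cases hx : S.Live l x
  · simp only [comp, hx, if_true, norm_div, Complex.norm_real,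
      Real.norm_of_nonneg (S.gc_nonneg l x)]
    exact div_le_of_le_mul₀ (S.gc_nonneg l x) (by positivity) (S.norm_cellIntegral_jump_le hx)
  · simp only [comp, hx, if_false, norm_zero]; positivity

lemma norm_diff_le (l : ℕ) (x : X) : ‖S.diff l x‖ ≤ 4 * S.A := by
  have hA := S.A_nonneg
  refine (norm_add_le _ _).trans ?_
  have h1 : ‖(if S.Live (l + 1) x then S.avg (l + 1) x - S.avg l x else 0)‖ ≤ 2 * S.A := by
    by_cases hx : S.Live (l + 1) x
    · simp only [hx, if_true]
      refine (norm_sub_le _ _).trans ?_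
      linarith [hx.norm_avg_le, (hx.of_le l.le_succ).norm_avg_le]
    · simp only [hx, if_false, norm_zero]; positivity
  linarith [S.norm_comp_le l x]

lemma integrable_adapted_mul {𝕜 : Type*} [RCLike 𝕜] {l : ℕ} {ψ φ : X → 𝕜} {C : ℝ}
    (hψ : S.Adapted l ψ) (hC : ∀ x, ‖ψ x‖ ≤ C) (hφ : Integrable φ S.ρ) :
    Integrable (fun x => ψ x * φ x) S.ρ :=
  hφ.bdd_mul hψ.measurable.aestronglyMeasurable (Filter.Eventually.of_forall hC)

lemma integrable_comp_mul (l : ℕ) : Integrable (fun x => S.comp l x * S.g x) S.ρ :=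
  S.integrable_adapted_mul (S.adapted_comp l) (S.norm_comp_le l) S.integrable_g.ofReal

lemma integrable_diff_mul (l : ℕ) : Integrable (fun x => S.diff l x * S.g x) S.ρ :=
  S.integrable_adapted_mul (S.adapted_diff l) (S.norm_diff_le l) S.integrable_g.ofReal

lemma integrable_bad (l : ℕ) : Integrable (S.bad l) S.ρ :=
  (S.integrable_jump l).sub (S.integrable_comp_mul l)

lemma cellIntegral_adapted_mul_g {l : ℕ} {ψ : X → ℂ} (hψ : S.Adapted l ψ) (x : X) :
    ∫ y in S.cell l x, ψ y * S.g y ∂S.ρ = ψ x * S.gc l x := by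
  rw [setIntegral_congr_fun (measurableSet_cell l x) (g := fun y => ψ x * (S.g y : ℂ))
    (fun y hy => by simp only [hψ y x hy]), integral_const_mul, integral_complex_ofReal]
  rfl

/-- Spreading `h` over a live cell proportionally to `g` preserves its mass; on the other cells
nothing is changed. -/
lemma cellIntegral_stopped_sub_self (l : ℕ) (x : X) :
    ∫ y in S.cell l x, (S.stopped l y - S.h y) ∂S.ρ = 0 := by
  rw [integral_sub (S.integrable_stopped l).integrableOn S.integrable_h.integrableOn, sub_eq_zero]
  by_cases hx : S.Live l x
  · rw [setIntegral_congr_fun (measurableSet_cell l x) (g := fun y => S.avg l y * (S.g y : ℂ))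
      (fun y hy => ?_), S.cellIntegral_adapted_mul_g (S.adapted_avg l), hx.avg_mul_gc]
    · rfl
    · have : S.Live l y := by rwa [S.adapted_live l y x hy]
      simp only [stopped, this, if_true]
  · refine setIntegral_congr_fun (measurableSet_cell l x) fun y hy => ?_
    have : ¬ S.Live l y := by rwa [S.adapted_live l y x hy]
    simp only [stopped, this, if_false]

lemma cellIntegral_stopped_sub {i l : ℕ} (hil : i ≤ l) (x : X) :
    ∫ y in S.cell i x, (S.stopped l y - S.h y) ∂S.ρ = 0 :=
  cellIntegral_eq_zero_of_le hil ((S.integrable_stopped l).sub S.integrable_h)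
    (S.cellIntegral_stopped_sub_self l) x

/-- The compensator is designed for this: it removes the mean of the jump on each live cell of level
`l`. The cells already stopped at level `l` carry neither jump nor compensator. -/
lemma cellIntegral_bad {i l : ℕ} (hil : i ≤ l) (x : X) : ∫ y in S.cell i x, S.bad l y ∂S.ρ = 0 := by
  refine cellIntegral_eq_zero_of_le hil (S.integrable_bad l) (fun x => ?_) x
  simp only [bad]
  rw [integral_sub (S.integrable_jump l).integrableOn (S.integrable_comp_mul l).integrableOn,
    S.cellIntegral_adapted_mul_g (S.adapted_comp l), sub_eq_zero]
  by_cases hx : S.Live l x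
  · simp only [comp, hx, if_true]
    by_cases h0 : S.gc l x = 0
    · have := S.norm_cellIntegral_jump_le hx
      rw [h0, mul_zero, norm_le_zero_iff] at this
      simp [this]
    · rw [div_mul_cancel₀]; exact_mod_cast h0
  · simp only [comp, hx, if_false, zero_mul]
    refine (setIntegral_congr_fun (measurableSet_cell l x) (g := fun _ => (0 : ℂ))
      fun y hy => ?_).trans (by simp)
    have : ¬ S.Live l y := by rwa [S.adapted_live l y x hy]
    simp [jump, stopSet, this]

lemma cellIntegral_diff {i l : ℕ} (hil : i ≤ l) (x : X) :
    ∫ y in S.cell i x, S.diff l y * S.g y ∂S.ρ = 0 := by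
  have h : ∀ y, S.diff l y * S.g y
      = (S.stopped (l + 1) y - S.h y) - (S.stopped l y - S.h y) - S.bad l y := by
    intro y
    linear_combination -(S.stopped_succ_sub l y)
  simp_rw [h]
  have i1 : IntegrableOn (fun y => S.stopped (l + 1) y - S.h y) (S.cell i x) S.ρ :=
    ((S.integrable_stopped (l + 1)).sub S.integrable_h).integrableOn
  have i2 : IntegrableOn (fun y => S.stopped l y - S.h y) (S.cell i x) S.ρ :=
    ((S.integrable_stopped l).sub S.integrable_h).integrableOn
  have i3 := (S.integrable_bad l).integrableOn (s := S.cell i x)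
  rw [integral_sub (by exact i1.sub i2) i3, integral_sub i1 i2, S.cellIntegral_stopped_sub hil,
    S.cellIntegral_stopped_sub (hil.trans l.le_succ), S.cellIntegral_bad hil]
  simp

/-- The `|h| ρ`-measure of the set stopped at level `l + 1`. -/
def stopMass (l : ℕ) : ℝ := ∫ y in S.stopSet l, ‖S.h y‖ ∂S.ρ

lemma stopMass_nonneg (l : ℕ) : 0 ≤ S.stopMass l := integral_nonneg fun _ => norm_nonneg _

/-- A cell stopped exactly at level `l + 1` passes the test at all coarser levels, so it is its own
test that fails and `A * gc < tc` on it. Hence a jump costs no more than the `|h|`-mass of the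
stopped cells. -/
lemma mul_setIntegral_g_stopSet_le (l : ℕ) :
    S.A * ∫ y in S.stopSet l, S.g y ∂S.ρ ≤ S.stopMass l := by
  have hm := S.measurableSet_stopSet l
  have hint : Integrable (fun y => ‖S.h y‖ - S.A * S.g y) S.ρ :=
    S.integrable_h.norm.sub (S.integrable_g.const_mul _)
  have he : (fun y => (if y ∈ S.stopSet l then (1 : ℝ) else 0) * (‖S.h y‖ - S.A * S.g y))
      = (S.stopSet l).indicator (fun y => ‖S.h y‖ - S.A * S.g y) := by
    funext y; by_cases hy : y ∈ S.stopSet l <;> simp [hy]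
  have h := integral_adapted_mul_nonneg (𝒟 := S.toCellTree) (ρ := S.ρ) (l := l + 1)
    (ψ := fun y => if y ∈ S.stopSet l then (1 : ℝ) else 0)
    (φ := fun y => ‖S.h y‖ - S.A * S.g y)
    ((S.adapted_mem_stopSet l).ite (adapted_const _ _) (adapted_const _ _))
    (by rw [he]; exact hint.indicator hm) (fun y => by split_ifs <;> simp)
    (fun x hx => by
      have hx' : x ∈ S.stopSet l := by by_contra h; simp [h] at hx
      have : S.A * S.gc (l + 1) x < S.tc (l + 1) x := by
        by_contra hcon
        refine hx'.2 fun i hi => ?_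
        rcases hi.lt_or_eq with hi | rfl
        · exact hx'.1 i (by omega)
        · exact not_lt.1 hcon
      rw [integral_sub S.integrable_h.norm.integrableOn (S.integrable_g.const_mul _).integrableOn,
        integral_const_mul]
      exact sub_nonneg.2 this.le)
  rw [he, integral_indicator hm, integral_sub S.integrable_h.norm.integrableOn
    (S.integrable_g.const_mul _).integrableOn, integral_const_mul] at h
  exact sub_nonneg.1 h

lemma integral_norm_jump_le (l : ℕ) : ∫ y, ‖S.jump l y‖ ∂S.ρ ≤ 2 * S.stopMass l := by
  have hm := S.measurableSet_stopSet l
  calc ∫ y, ‖S.jump l y‖ ∂S.ρ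
      ≤ ∫ y, (S.stopSet l).indicator (fun x => ‖S.h x‖ + S.A * S.g x) y ∂S.ρ :=
        integral_mono (S.integrable_jump l).norm (S.integrable_h_add_g.indicator hm)
          (S.norm_jump_le l)
    _ = S.stopMass l + S.A * ∫ y in S.stopSet l, S.g y ∂S.ρ := by
        rw [integral_indicator hm, integral_add S.integrable_h.norm.integrableOn
          (S.integrable_g.const_mul _).integrableOn, integral_const_mul]; rfl
    _ ≤ _ := by linarith [S.mul_setIntegral_g_stopSet_le l]

/-- Averaging is an `L¹` contraction: on a live cell `‖comp‖ * gc` is at most the modulus of the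
integral of the jump. -/
lemma integral_norm_comp_le (l : ℕ) : ∫ y, ‖S.comp l y‖ * S.g y ∂S.ρ ≤ 2 * S.stopMass l := by
  refine le_trans ?_ (S.integral_norm_jump_le l)
  have hi : Integrable (fun y => ‖S.comp l y‖ * S.g y) S.ρ :=
    S.integrable_adapted_mul (l := l) ((S.adapted_comp l).comp norm)
      (fun x => by rw [norm_norm]; exact S.norm_comp_le l x) S.integrable_g
  have hi1 := (S.integrable_jump l).norm.sub hi
  have hi2 : Integrable (fun y => 1 * (‖S.jump l y‖ - ‖S.comp l y‖ * S.g y)) S.ρ := by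
    simpa using! hi1
  have h := integral_adapted_mul_nonneg (𝒟 := S.toCellTree) (ρ := S.ρ) (l := l) (ψ := fun _ => 1)
    (adapted_const _ _) hi2 (fun _ => zero_le_one) (fun x _ => by
      rw [integral_sub (S.integrable_jump l).norm.integrableOn hi.integrableOn, sub_nonneg,
        setIntegral_congr_fun (measurableSet_cell l x) (g := fun y => ‖S.comp l x‖ * S.g y)
        (fun y hy => by simp only [S.adapted_comp l y x hy]), integral_const_mul]
      by_cases hx : S.Live l x
      · refine le_trans ?_ (norm_integral_le_integral_norm _)
        simp only [comp, hx, if_true, norm_div, Complex.norm_real,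
          Real.norm_of_nonneg (S.gc_nonneg l x)]
        change _ / S.gc l x * S.gc l x ≤ _
        by_cases h0 : S.gc l x = 0
        · simp [h0]
        · rw [div_mul_cancel₀ _ h0]
      · simp only [comp, hx, if_false, norm_zero, zero_mul]
        exact integral_nonneg fun _ => norm_nonneg _)
  simp only [one_mul] at h
  rw [integral_sub (S.integrable_jump l).norm hi] at h
  exact sub_nonneg.1 h

lemma integral_norm_bad_le (l : ℕ) : ∫ y, ‖S.bad l y‖ ∂S.ρ ≤ 4 * S.stopMass l := by
  have hi : Integrable (fun y => ‖S.comp l y‖ * S.g y) S.ρ :=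
    S.integrable_adapted_mul (l := l) ((S.adapted_comp l).comp norm)
      (fun x => by rw [norm_norm]; exact S.norm_comp_le l x) S.integrable_g
  calc ∫ y, ‖S.bad l y‖ ∂S.ρ ≤ ∫ y, (‖S.jump l y‖ + ‖S.comp l y‖ * S.g y) ∂S.ρ := by
        refine integral_mono (S.integrable_bad l).norm ((S.integrable_jump l).norm.add hi)
          fun y => ?_
        refine (norm_sub_le _ _).trans ?_
        rw [norm_mul, Complex.norm_real, Real.norm_of_nonneg (S.g_nonneg y)]
    _ = _ := integral_add (S.integrable_jump l).norm hi
    _ ≤ _ := by linarith [S.integral_norm_jump_le l, S.integral_norm_comp_le l]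

end StoppedPair

/-! ### Energy of the martingale increments. -/

namespace StoppedPair

open CellTree Classical ComplexConjugate

variable {X ι : Type*} [MeasurableSpace X] [MeasurableSpace ι] (S : StoppedPair X ι)

/-- The squared average, restricted to live cells. -/
def liveSq (l : ℕ) (x : X) : ℝ := if S.Live l x then ‖S.avg l x‖ ^ 2 else 0

/-- The conjugate of the average of level `l`, restricted to the live cells of level `k`. -/
def liveConj (k l : ℕ) (x : X) : ℂ := if S.Live k x then conj (S.avg l x) else 0

/-- The squared increment of the averages, restricted to live cells. -/
def liveDiffSq (l : ℕ) (x : X) : ℝ :=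
  if S.Live (l + 1) x then ‖S.avg (l + 1) x - S.avg l x‖ ^ 2 else 0

lemma adapted_liveSq (l : ℕ) : S.Adapted l (S.liveSq l) :=
  (S.adapted_live l).ite ((S.adapted_avg l).comp (fun a => ‖a‖ ^ 2)) (adapted_const l 0)

lemma adapted_liveConj {k l : ℕ} (h : l ≤ k) : S.Adapted k (S.liveConj k l) :=
  (S.adapted_live k).ite (((S.adapted_avg l).of_le h).comp (fun a => conj a)) (adapted_const k 0)

lemma adapted_liveDiffSq (l : ℕ) : S.Adapted (l + 1) (S.liveDiffSq l) :=
  (S.adapted_live (l + 1)).ite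
    ((S.adapted_avg (l + 1)).comp₂ ((S.adapted_avg l).of_le l.le_succ) (fun a b => ‖a - b‖ ^ 2))
    (adapted_const (l + 1) 0)

lemma liveSq_nonneg (l : ℕ) (x : X) : 0 ≤ S.liveSq l x := by
  unfold liveSq; split_ifs <;> positivity

lemma liveDiffSq_nonneg (l : ℕ) (x : X) : 0 ≤ S.liveDiffSq l x := by
  unfold liveDiffSq; split_ifs <;> positivity

lemma liveSq_le (l : ℕ) (x : X) : S.liveSq l x ≤ S.A ^ 2 := by
  have hA := S.A_nonneg
  unfold liveSq
  split_ifs with h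
  · have := h.norm_avg_le; gcongr
  · positivity

lemma norm_liveConj_le {k l : ℕ} (h : l ≤ k) (x : X) : ‖S.liveConj k l x‖ ≤ S.A := by
  unfold liveConj
  split_ifs with hx
  · simpa using (hx.of_le h).norm_avg_le
  · simpa using S.A_nonneg

lemma liveDiffSq_le (l : ℕ) (x : X) : S.liveDiffSq l x ≤ (2 * S.A) ^ 2 := by
  have hA := S.A_nonneg
  unfold liveDiffSq
  split_ifs with h
  · have : ‖S.avg (l + 1) x - S.avg l x‖ ≤ 2 * S.A :=
      (norm_sub_le _ _).trans (by linarith [h.norm_avg_le, (h.of_le l.le_succ).norm_avg_le])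
    gcongr
  · positivity

/-- The pointwise form of Pythagoras, `|a' - a|² = |a'|² - |a|² - 2 Re(conj a (a' - a))`. The cross
term is split at `h` into two terms, each an adapted factor times `stopped - h`, so that each
integrates to zero. On live cells this is an identity; on newly stopped cells the loss is paid by
`2A|h|`. -/
lemma liveDiffSq_mul_g_le (l : ℕ) (x : X) :
    S.liveDiffSq l x * S.g x ≤ S.liveSq (l + 1) x * S.g x - S.liveSq l x * S.g x
      + 2 * S.A * (S.stopSet l).indicator (fun x => ‖S.h x‖) x
      - 2 * (S.liveConj (l + 1) l x * (S.stopped (l + 1) x - S.h x)).re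
      + 2 * (S.liveConj l l x * (S.stopped l x - S.h x)).re := by
  have hg := S.g_nonneg x
  have hmono : S.Live (l + 1) x → S.Live l x := fun h => h.of_le l.le_succ
  have hsq : ∀ z : ℂ, ‖z‖ ^ 2 = z.re ^ 2 + z.im ^ 2 := fun z => by
    rw [← Complex.normSq_eq_norm_sq, Complex.normSq_apply]; ring
  by_cases h1 : S.Live (l + 1) x
  · have hx : x ∉ S.stopSet l := fun h => h.2 h1
    simp only [liveDiffSq, liveSq, liveConj, stopped, h1, hmono h1, if_true,
      indicator_of_notMem hx, hsq]
    simp only [Complex.mul_re, Complex.conj_re, Complex.conj_im, Complex.sub_re, Complex.sub_im,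
      Complex.ofReal_re, Complex.ofReal_im, Complex.mul_im]
    apply le_of_eq; ring
  · by_cases h0 : S.Live l x
    · have hx : x ∈ S.stopSet l := ⟨h0, h1⟩
      simp only [liveDiffSq, liveSq, liveConj, stopped, h1, h0, if_true, if_false,
        indicator_of_mem hx, hsq]
      have key : |(conj (S.avg l x) * S.h x).re| ≤ S.A * ‖S.h x‖ := by
        refine (Complex.abs_re_le_norm _).trans ?_
        rw [norm_mul, RCLike.norm_conj]
        gcongr
        exact h0.norm_avg_le
      have key' := neg_le_of_abs_le key
      have key2 := le_of_abs_le key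
      simp only [Complex.mul_re, Complex.conj_re, Complex.conj_im] at key' key2
      simp only [Complex.mul_re, Complex.conj_re, Complex.conj_im, Complex.sub_re, Complex.sub_im,
        Complex.ofReal_re, Complex.ofReal_im, Complex.mul_im, Complex.zero_re, Complex.zero_im]
      have := mul_nonneg (add_nonneg (sq_nonneg (S.avg l x).re) (sq_nonneg (S.avg l x).im)) hg
      nlinarith
    · have hx : x ∉ S.stopSet l := fun h => h0 h.1
      simp [liveDiffSq, liveSq, liveConj, stopped, h1, h0, hx]

variable [Countable ι] [MeasurableSingletonClass ι]

lemma integrable_liveSq_mul (l : ℕ) : Integrable (fun x => S.liveSq l x * S.g x) S.ρ :=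
  S.integrable_adapted_mul (S.adapted_liveSq l)
    (fun x => by rw [Real.norm_of_nonneg (S.liveSq_nonneg l x)]; exact S.liveSq_le l x)
    S.integrable_g

lemma integrable_liveDiffSq_mul (l : ℕ) : Integrable (fun x => S.liveDiffSq l x * S.g x) S.ρ :=
  S.integrable_adapted_mul (S.adapted_liveDiffSq l)
    (fun x => by rw [Real.norm_of_nonneg (S.liveDiffSq_nonneg l x)]; exact S.liveDiffSq_le l x)
    S.integrable_g

lemma integral_liveDiffSq_le (l : ℕ) :
    ∫ x, S.liveDiffSq l x * S.g x ∂S.ρ ≤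
      ∫ x, S.liveSq (l + 1) x * S.g x ∂S.ρ - ∫ x, S.liveSq l x * S.g x ∂S.ρ
        + 2 * S.A * S.stopMass l := by
  have hm := S.measurableSet_stopSet l
  have i1 := S.integrable_liveSq_mul (l + 1)
  have i2 := S.integrable_liveSq_mul l
  have i3 : Integrable (fun x => 2 * S.A * (S.stopSet l).indicator (fun x => ‖S.h x‖) x) S.ρ :=
    (S.integrable_h.norm.indicator hm).const_mul _
  have j4 : Integrable (fun x => S.liveConj (l + 1) l x * (S.stopped (l + 1) x - S.h x)) S.ρ :=
    S.integrable_adapted_mul (S.adapted_liveConj l.le_succ) (S.norm_liveConj_le l.le_succ)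
      ((S.integrable_stopped (l + 1)).sub S.integrable_h)
  have j5 : Integrable (fun x => S.liveConj l l x * (S.stopped l x - S.h x)) S.ρ :=
    S.integrable_adapted_mul (S.adapted_liveConj le_rfl) (S.norm_liveConj_le le_rfl)
      ((S.integrable_stopped l).sub S.integrable_h)
  have z4 := integral_adapted_mul_eq_zero (S.adapted_liveConj l.le_succ) j4
    (fun x _ => S.cellIntegral_stopped_sub le_rfl x)
  have z5 := integral_adapted_mul_eq_zero (S.adapted_liveConj le_rfl) j5
    (fun x _ => S.cellIntegral_stopped_sub le_rfl x)
  have i4 : Integrable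
      (fun x => 2 * (S.liveConj (l + 1) l x * (S.stopped (l + 1) x - S.h x)).re) S.ρ :=
    j4.re.const_mul 2
  have i5 : Integrable (fun x => 2 * (S.liveConj l l x * (S.stopped l x - S.h x)).re) S.ρ :=
    j5.re.const_mul 2
  have w4 : ∫ x, 2 * (S.liveConj (l + 1) l x * (S.stopped (l + 1) x - S.h x)).re ∂S.ρ = 0 := by
    have := integral_re (𝕜 := ℂ) j4
    simp only [RCLike.re_eq_complex_re] at this
    rw [integral_const_mul, this, z4]; simp
  have w5 : ∫ x, 2 * (S.liveConj l l x * (S.stopped l x - S.h x)).re ∂S.ρ = 0 := by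
    have := integral_re (𝕜 := ℂ) j5
    simp only [RCLike.re_eq_complex_re] at this
    rw [integral_const_mul, this, z5]; simp
  have a1 := i1.sub i2
  have a2 := a1.add i3
  have a3 := a2.sub i4
  have a4 := a3.add i5
  refine (integral_mono (S.integrable_liveDiffSq_mul l) a4 (S.liveDiffSq_mul_g_le l)).trans
    (le_of_eq ?_)
  rw [integral_add' a3 i5, integral_sub' a2 i4, integral_add' a1 i3, integral_sub' i1 i2, w4, w5,
    integral_const_mul, integral_indicator hm]
  simp [stopMass]

/-- The square of `diff` is at most twice the squared increment plus `2‖comp‖²`, and `‖comp‖ ≤ 2A`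
makes the last term linear. The constant is `12 = 2 * 2 + 4 * 2`, from the stopping loss in
`integral_liveDiffSq_le` and from the `L¹` bound for `comp`. -/
lemma integral_norm_diff_sq_le (l : ℕ) :
    ∫ x, ‖S.diff l x‖ ^ 2 * S.g x ∂S.ρ ≤
      2 * (∫ x, S.liveSq (l + 1) x * S.g x ∂S.ρ - ∫ x, S.liveSq l x * S.g x ∂S.ρ)
        + 12 * S.A * S.stopMass l := by
  have hA := S.A_nonneg
  have i0 : Integrable (fun y => ‖S.comp l y‖ * S.g y) S.ρ :=
    S.integrable_adapted_mul (l := l) ((S.adapted_comp l).comp norm)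
      (fun x => by rw [norm_norm]; exact S.norm_comp_le l x) S.integrable_g
  have i1 := (S.integrable_liveDiffSq_mul l).const_mul 2
  have i2 := i0.const_mul (4 * S.A)
  have i3 : Integrable (fun x => ‖S.diff l x‖ ^ 2 * S.g x) S.ρ :=
    S.integrable_adapted_mul (C := (4 * S.A) ^ 2) ((S.adapted_diff l).comp (fun a => ‖a‖ ^ 2))
      (fun x => by
        rw [norm_pow, norm_norm]
        exact pow_le_pow_left₀ (norm_nonneg _) (S.norm_diff_le l x) 2) S.integrable_g
  have hpt : ∀ x, ‖S.diff l x‖ ^ 2 * S.g x ≤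
      2 * (S.liveDiffSq l x * S.g x) + 4 * S.A * (‖S.comp l x‖ * S.g x) := by
    intro x
    have hg := S.g_nonneg x
    have hle : ‖S.diff l x‖ ^ 2 ≤ 2 * S.liveDiffSq l x + 4 * S.A * ‖S.comp l x‖ := by
      set a : ℂ := if S.Live (l + 1) x then S.avg (l + 1) x - S.avg l x else 0 with ha
      have e : S.liveDiffSq l x = ‖a‖ ^ 2 := by
        unfold liveDiffSq; rw [ha]; split_ifs <;> simp
      have e' : ‖S.diff l x‖ ≤ ‖a‖ + ‖S.comp l x‖ := norm_add_le _ _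
      rw [e]
      have c := S.norm_comp_le l x
      nlinarith [norm_nonneg (S.diff l x), norm_nonneg a, norm_nonneg (S.comp l x),
        sq_nonneg (‖a‖ - ‖S.comp l x‖)]
    nlinarith
  have := integral_mono i3 (i1.add i2) hpt
  rw [integral_add' i1 i2, integral_const_mul, integral_const_mul] at this
  nlinarith [S.integral_liveDiffSq_le l, S.integral_norm_comp_le l]

lemma sum_integral_norm_diff_sq_le (N : ℕ) :
    ∑ l ∈ Finset.range N, ∫ x, ‖S.diff l x‖ ^ 2 * S.g x ∂S.ρ ≤
      2 * ∫ x, S.liveSq N x * S.g x ∂S.ρ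
        + 12 * S.A * ∑ l ∈ Finset.range N, S.stopMass l := by
  have h0 : 0 ≤ ∫ x, S.liveSq 0 x * S.g x ∂S.ρ :=
    integral_nonneg fun x => mul_nonneg (S.liveSq_nonneg 0 x) (S.g_nonneg x)
  suffices h : ∑ l ∈ Finset.range N, ∫ x, ‖S.diff l x‖ ^ 2 * S.g x ∂S.ρ ≤
      2 * (∫ x, S.liveSq N x * S.g x ∂S.ρ - ∫ x, S.liveSq 0 x * S.g x ∂S.ρ)
        + 12 * S.A * ∑ l ∈ Finset.range N, S.stopMass l by linarith
  induction N with
  | zero => simp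
  | succ N ih =>
    rw [Finset.sum_range_succ, Finset.sum_range_succ]
    linarith [S.integral_norm_diff_sq_le N]

lemma sum_stopMass_le (N : ℕ) : ∑ l ∈ Finset.range N, S.stopMass l ≤ ∫ x, ‖S.h x‖ ∂S.ρ := by
  have hd : ∀ i j, i < j → Disjoint (S.stopSet i) (S.stopSet j) := fun i j hij =>
    Set.disjoint_left.2 fun x hx hx' => hx.2 (hx'.1.of_le hij)
  unfold stopMass
  rw [← integral_biUnion_finset _ (fun i _ => S.measurableSet_stopSet i)
    (fun i _ j _ hij => by
      rcases hij.lt_or_gt with h | h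
      · exact hd i j h
      · exact (hd j i h).symm) (fun i _ => S.integrable_h.norm.integrableOn)]
  exact setIntegral_le_integral S.integrable_h.norm
    (Filter.Eventually.of_forall fun _ => norm_nonneg _)

/-- One factor of the squared average is at most `A`; the other, multiplied by the `g`-mass of the
cell, is at most its `|h|`-mass. -/
lemma integral_liveSq_le (l : ℕ) :
    ∫ x, S.liveSq l x * S.g x ∂S.ρ ≤ S.A * ∫ x, ‖S.h x‖ ∂S.ρ := by
  have i1 := S.integrable_liveSq_mul l
  have i2 : Integrable (fun x => S.A * ‖S.h x‖) S.ρ := S.integrable_h.norm.const_mul _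
  have i3 : Integrable (fun x => 1 * (S.A * ‖S.h x‖ - S.liveSq l x * S.g x)) S.ρ := by
    simpa using! i2.sub i1
  have h := integral_adapted_mul_nonneg (𝒟 := S.toCellTree) (ρ := S.ρ) (l := l) (ψ := fun _ => 1)
    (adapted_const _ _) i3 (fun _ => zero_le_one) (fun x _ => by
      rw [integral_sub i2.integrableOn i1.integrableOn, sub_nonneg,
        setIntegral_congr_fun (measurableSet_cell l x) (g := fun y => S.liveSq l x * S.g y)
        (fun y hy => by simp only [S.adapted_liveSq l y x hy]), integral_const_mul,
        integral_const_mul]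
      change S.liveSq l x * S.gc l x ≤ S.A * S.tc l x
      unfold liveSq
      split_ifs with hx
      · have h1 : ‖S.avg l x‖ * S.gc l x ≤ S.tc l x := by
          have := congrArg norm hx.avg_mul_gc
          rw [norm_mul, Complex.norm_real, Real.norm_of_nonneg (S.gc_nonneg l x)] at this
          rw [this]; exact S.norm_hc_le l x
        have h2 := hx.norm_avg_le
        have h3 : 0 ≤ S.tc l x := integral_nonneg fun _ => norm_nonneg _
        rw [sq, mul_assoc]
        exact mul_le_mul h2 h1 (mul_nonneg (norm_nonneg _) (S.gc_nonneg l x)) S.A_nonneg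
      · rw [zero_mul]
        exact mul_nonneg S.A_nonneg (integral_nonneg fun _ => norm_nonneg _))
  simp only [one_mul] at h
  rw [integral_sub i2 i1, integral_const_mul] at h
  exact sub_nonneg.1 h

/-- The total energy of the increments is controlled by the total variation. -/
lemma sum_integral_norm_diff_sq_le_mass (N : ℕ) :
    ∑ l ∈ Finset.range N, ∫ x, ‖S.diff l x‖ ^ 2 * S.g x ∂S.ρ ≤
      14 * S.A * ∫ x, ‖S.h x‖ ∂S.ρ := by
  have hA := S.A_nonneg
  have h1 := S.sum_integral_norm_diff_sq_le N
  have h2 := mul_le_mul_of_nonneg_left (S.sum_stopMass_le N) (by positivity : 0 ≤ 12 * S.A)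
  have h3 := S.integral_liveSq_le N
  linarith

end StoppedPair

/-! ### Bounded densities: no stopping, and Doob's maximal inequality. -/

open CellTree

variable {X ι : Type*} [MeasurableSpace X] [MeasurableSpace ι]

/-- The pair `(ρ, f ρ)` for a bounded function `f`. -/
def StoppedPair.ofBounded (𝒟 : CellTree X ι) (ρ : Measure X) [hρ : IsFiniteMeasure ρ] (f : X → ℂ)
    (A : ℝ) (hA : 0 ≤ A) (hf : Measurable f) (hfA : ∀ x, ‖f x‖ ≤ A) : StoppedPair X ι where
  toCellTree := 𝒟
  ρ := ρ
  finite_ρ := hρ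
  g := fun _ => 1
  h := f
  A := A
  measurable_g := measurable_const
  integrable_g := integrable_const 1
  g_nonneg := fun _ => zero_le_one
  measurable_h := hf
  integrable_h := Integrable.of_bound hf.aestronglyMeasurable A (Filter.Eventually.of_forall hfA)
  A_nonneg := hA

namespace StoppedPair

/-- The average of `|h| ρ` over a cell with respect to `g ρ`. -/
def absAvg (S : StoppedPair X ι) (l : ℕ) (x : X) : ℝ := S.tc l x / S.gc l x

lemma absAvg_nonneg (S : StoppedPair X ι) (l : ℕ) (x : X) : 0 ≤ S.absAvg l x :=
  div_nonneg (integral_nonneg fun _ => norm_nonneg _) (S.gc_nonneg l x)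

lemma norm_avg_le_absAvg (S : StoppedPair X ι) (l : ℕ) (x : X) : ‖S.avg l x‖ ≤ S.absAvg l x := by
  rw [avg, absAvg, norm_div, Complex.norm_real, Real.norm_of_nonneg (S.gc_nonneg l x)]
  exact div_le_div_of_nonneg_right (S.norm_hc_le l x) (S.gc_nonneg l x)

/-- The running maximum of the averages of `|h| ρ`. -/
def runMax (S : StoppedPair X ι) : ℕ → X → ℝ
  | 0, x => S.absAvg 0 x
  | l + 1, x => max (S.runMax l x) (S.absAvg (l + 1) x)

lemma absAvg_le_runMax (S : StoppedPair X ι) (l : ℕ) (x : X) : S.absAvg l x ≤ S.runMax l x := by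
  cases l with
  | zero => exact le_rfl
  | succ l => exact le_max_right _ _

lemma runMax_nonneg (S : StoppedPair X ι) (l : ℕ) (x : X) : 0 ≤ S.runMax l x :=
  (S.absAvg_nonneg l x).trans (S.absAvg_le_runMax l x)

lemma runMax_mono (S : StoppedPair X ι) (x : X) : Monotone (fun l => S.runMax l x) :=
  monotone_nat_of_le_succ fun _ => le_max_left _ _

lemma adapted_absAvg (S : StoppedPair X ι) (l : ℕ) : S.Adapted l (S.absAvg l) :=
  (S.adapted_tc l).comp₂ (S.adapted_gc l) (fun a b => a / b)

lemma adapted_runMax (S : StoppedPair X ι) (l : ℕ) : S.Adapted l (S.runMax l) := by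
  induction l with
  | zero => exact S.adapted_absAvg 0
  | succ l ih => exact (ih.of_le l.le_succ).comp₂ (S.adapted_absAvg (l + 1)) max

/-- Doob's inequality holds path by path: summation by parts bounds half the squared maximum by
`runMax * absAvg` minus a martingale transform, because the maximum grows only when it equals the
current average. The product is then absorbed by completing a square. -/
lemma runMax_sq_le (S : StoppedPair X ι) (N : ℕ) (x : X) :
    S.runMax N x ^ 2 ≤ 4 * S.absAvg N x ^ 2
      - 4 * ∑ l ∈ Finset.range N, S.runMax l x * (S.absAvg (l + 1) x - S.absAvg l x) := by
  suffices h : S.runMax N x ^ 2 / 2 ≤ S.runMax N x * S.absAvg N x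
      - ∑ l ∈ Finset.range N, S.runMax l x * (S.absAvg (l + 1) x - S.absAvg l x) by
    nlinarith [sq_nonneg (S.runMax N x - 2 * S.absAvg N x)]
  induction N with
  | zero => simp [runMax]; nlinarith [sq_nonneg (S.absAvg 0 x)]
  | succ N ih =>
    rw [Finset.sum_range_succ]
    simp only [runMax]
    rcases le_total (S.runMax N x) (S.absAvg (N + 1) x) with h | h
    · rw [max_eq_right h]
      nlinarith [sq_nonneg (S.absAvg (N + 1) x - S.runMax N x)]
    · rw [max_eq_left h]
      nlinarith

section Bounded

variable {S : StoppedPair X ι} (hg : ∀ x, S.g x = 1) (hh : ∀ x, ‖S.h x‖ ≤ S.A)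

include hg

lemma gc_eq_measureReal (l : ℕ) (x : X) : S.gc l x = S.ρ.real (S.cell l x) := by
  simp [gc, hg]

include hh

lemma live_of_bounded (l : ℕ) (x : X) : S.Live l x := by
  intro i _
  have hi : Integrable (fun y => S.A * S.g y) S.ρ := S.integrable_g.const_mul _
  refine (integral_mono S.integrable_h.norm.integrableOn hi.integrableOn
    (fun y => ?_)).trans (le_of_eq (integral_const_mul _ _))
  simp [hg, hh y]

lemma stopSet_of_bounded (l : ℕ) : S.stopSet l = ∅ := by
  ext x; simp [stopSet, live_of_bounded hg hh]

lemma jump_of_bounded (l : ℕ) (x : X) : S.jump l x = 0 := by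
  simp [jump, stopSet_of_bounded hg hh]

lemma comp_of_bounded (l : ℕ) (x : X) : S.comp l x = 0 := by
  simp [comp, jump_of_bounded hg hh]

lemma bad_of_bounded (l : ℕ) (x : X) : S.bad l x = 0 := by
  simp [bad, comp_of_bounded hg hh, jump_of_bounded hg hh]

lemma absAvg_le_of_bounded (l : ℕ) (x : X) : S.absAvg l x ≤ S.A :=
  div_le_of_le_mul₀ (S.gc_nonneg l x) S.A_nonneg (live_of_bounded hg hh l x).tc_le

lemma runMax_le_of_bounded (l : ℕ) (x : X) : S.runMax l x ≤ S.A := by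
  induction l with
  | zero => exact absAvg_le_of_bounded hg hh 0 x
  | succ l ih => exact max_le ih (absAvg_le_of_bounded hg hh (l + 1) x)

lemma absAvg_mul_gc (l : ℕ) (x : X) : S.absAvg l x * S.gc l x = S.tc l x := by
  by_cases h0 : S.gc l x = 0
  · have h1 := (live_of_bounded hg hh l x).tc_le
    have h2 : 0 ≤ S.tc l x := integral_nonneg fun _ => norm_nonneg _
    rw [h0, mul_zero] at h1
    rw [h0, mul_zero]; exact le_antisymm h2 h1
  · rw [absAvg, div_mul_cancel₀ _ h0]

variable [Countable ι] [MeasurableSingletonClass ι]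

lemma integrable_absAvg (l : ℕ) : Integrable (S.absAvg l) S.ρ :=
  Integrable.of_bound (S.adapted_absAvg l).measurable.aestronglyMeasurable S.A
    (Filter.Eventually.of_forall fun x => by
      rw [Real.norm_of_nonneg (S.absAvg_nonneg l x)]; exact absAvg_le_of_bounded hg hh l x)

lemma integrable_norm_sq : Integrable (fun x => ‖S.h x‖ ^ 2) S.ρ :=
  Integrable.of_bound (S.measurable_h.norm.pow_const 2).aestronglyMeasurable (S.A ^ 2)
    (Filter.Eventually.of_forall fun x => by
      rw [norm_pow, norm_norm]; exact pow_le_pow_left₀ (norm_nonneg _) (hh x) 2)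

lemma integrable_absAvg_sq (l : ℕ) : Integrable (fun x => S.absAvg l x ^ 2) S.ρ :=
  Integrable.of_bound ((S.adapted_absAvg l).measurable.pow_const 2).aestronglyMeasurable (S.A ^ 2)
    (Filter.Eventually.of_forall fun x => by
      rw [norm_pow, Real.norm_of_nonneg (S.absAvg_nonneg l x)]
      exact pow_le_pow_left₀ (S.absAvg_nonneg l x) (absAvg_le_of_bounded hg hh l x) 2)

lemma cellIntegral_absAvg_sub {i l : ℕ} (hil : i ≤ l) (x : X) :
    ∫ y in S.cell i x, (S.absAvg l y - ‖S.h y‖) ∂S.ρ = 0 := by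
  refine cellIntegral_eq_zero_of_le hil ((integrable_absAvg hg hh l).sub S.integrable_h.norm)
    (fun x => ?_) x
  simp only [Pi.sub_apply]
  rw [integral_sub (integrable_absAvg hg hh l).integrableOn S.integrable_h.norm.integrableOn,
    setIntegral_congr_fun (measurableSet_cell l x) (g := fun y => S.absAvg l x * S.g y)
      (fun y hy => by simp only [S.adapted_absAvg l y x hy, hg, mul_one]), integral_const_mul]
  exact sub_eq_zero.2 (absAvg_mul_gc hg hh l x)

lemma integral_absAvg_sq_le (l : ℕ) :
    ∫ x, S.absAvg l x ^ 2 ∂S.ρ ≤ ∫ x, ‖S.h x‖ ^ 2 ∂S.ρ := by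
  have i1 := integrable_absAvg_sq hg hh l
  have i2 := integrable_norm_sq hg hh
  have hC : ∀ x, ‖S.absAvg l x‖ ≤ S.A := fun x => by
    rw [Real.norm_of_nonneg (S.absAvg_nonneg l x)]; exact absAvg_le_of_bounded hg hh l x
  have i3 : Integrable (fun x => S.absAvg l x * (S.absAvg l x - ‖S.h x‖)) S.ρ :=
    S.integrable_adapted_mul (S.adapted_absAvg l) hC
      ((integrable_absAvg hg hh l).sub S.integrable_h.norm)
  have z := integral_adapted_mul_eq_zero (S.adapted_absAvg l) i3
    (fun x _ => cellIntegral_absAvg_sub hg hh le_rfl x)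
  have := integral_mono i1 (i2.add (i3.const_mul 2)) (fun x => by
    simp only [Pi.add_apply]
    nlinarith [sq_nonneg (S.absAvg l x - ‖S.h x‖)])
  rw [integral_add' i2 (i3.const_mul 2), integral_const_mul, z] at this
  simpa using this

/-- The martingale transform in `runMax_sq_le` has integral zero, since `runMax l` is constant on
the cells on which the increment has mean zero. -/
lemma integral_runMax_sq_le (N : ℕ) :
    ∫ x, S.runMax N x ^ 2 ∂S.ρ ≤ 4 * ∫ x, ‖S.h x‖ ^ 2 ∂S.ρ := by
  have hC : ∀ l x, ‖S.runMax l x‖ ≤ S.A := fun l x => by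
    rw [Real.norm_of_nonneg (S.runMax_nonneg l x)]; exact runMax_le_of_bounded hg hh l x
  have i0 : Integrable (fun x => S.runMax N x ^ 2) S.ρ :=
    Integrable.of_bound ((S.adapted_runMax N).measurable.pow_const 2).aestronglyMeasurable
      (S.A ^ 2) (Filter.Eventually.of_forall fun x => by
        rw [norm_pow]; exact pow_le_pow_left₀ (norm_nonneg _) (hC N x) 2)
  have j : ∀ l, Integrable (fun x => S.absAvg (l + 1) x - S.absAvg l x) S.ρ := fun l =>
    (integrable_absAvg hg hh (l + 1)).sub (integrable_absAvg hg hh l)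
  have i1 : ∀ l, Integrable (fun x => S.runMax l x * (S.absAvg (l + 1) x - S.absAvg l x)) S.ρ :=
    fun l => S.integrable_adapted_mul (S.adapted_runMax l) (hC l) (j l)
  have z : ∀ l, ∫ x, S.runMax l x * (S.absAvg (l + 1) x - S.absAvg l x) ∂S.ρ = 0 := fun l =>
    integral_adapted_mul_eq_zero (S.adapted_runMax l) (i1 l) (fun x _ => by
      have e : ∀ y, S.absAvg (l + 1) y - S.absAvg l y
          = (S.absAvg (l + 1) y - ‖S.h y‖) - (S.absAvg l y - ‖S.h y‖) := fun y => by ring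
      simp_rw [e]
      rw [integral_sub
        (by exact ((integrable_absAvg hg hh (l + 1)).sub S.integrable_h.norm).integrableOn)
        (by exact ((integrable_absAvg hg hh l).sub S.integrable_h.norm).integrableOn),
        cellIntegral_absAvg_sub hg hh l.le_succ, cellIntegral_absAvg_sub hg hh le_rfl, sub_zero])
  have i2 : Integrable (fun x => ∑ l ∈ Finset.range N,
      S.runMax l x * (S.absAvg (l + 1) x - S.absAvg l x)) S.ρ :=
    integrable_finsetSum _ fun l _ => i1 l
  have i3 := (integrable_absAvg_sq hg hh N).const_mul 4
  have := integral_mono i0 (i3.sub (i2.const_mul 4)) (S.runMax_sq_le N)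
  rw [integral_sub' i3 (i2.const_mul 4), integral_const_mul, integral_const_mul,
    integral_finsetSum _ (fun l _ => i1 l), Finset.sum_congr rfl (fun l _ => z l)] at this
  simp only [Finset.sum_const_zero, mul_zero, sub_zero] at this
  linarith [integral_absAvg_sq_le hg hh N]

/-- Doob's maximal inequality in `L²` for the averages over the cells of a tree. -/
lemma lintegral_iSup_absAvg_sq_le :
    ∫⁻ x, ⨆ l, ENNReal.ofReal (S.absAvg l x ^ 2) ∂S.ρ ≤ 4 * ∫⁻ x, ‖S.h x‖ₑ ^ 2 ∂S.ρ := by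
  have hh2 : ∫⁻ x, ‖S.h x‖ₑ ^ 2 ∂S.ρ = ENNReal.ofReal (∫ x, ‖S.h x‖ ^ 2 ∂S.ρ) := by
    rw [ofReal_integral_eq_lintegral_ofReal (integrable_norm_sq hg hh)
      (Filter.Eventually.of_forall fun x => by positivity)]
    refine lintegral_congr fun x => ?_
    rw [ENNReal.ofReal_pow (norm_nonneg _), ofReal_norm]
  calc ∫⁻ x, ⨆ l, ENNReal.ofReal (S.absAvg l x ^ 2) ∂S.ρ
      ≤ ∫⁻ x, ⨆ l, ENNReal.ofReal (S.runMax l x ^ 2) ∂S.ρ := by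
        refine lintegral_mono fun x => iSup_mono fun l => ENNReal.ofReal_le_ofReal ?_
        exact pow_le_pow_left₀ (S.absAvg_nonneg l x) (S.absAvg_le_runMax l x) 2
    _ = ⨆ l, ∫⁻ x, ENNReal.ofReal (S.runMax l x ^ 2) ∂S.ρ := by
        refine lintegral_iSup (fun l =>
          ((S.adapted_runMax l).measurable.pow_const 2).ennreal_ofReal) ?_
        intro i j hij x
        exact ENNReal.ofReal_le_ofReal
          (pow_le_pow_left₀ (S.runMax_nonneg i x) (S.runMax_mono x hij) 2)
    _ ≤ _ := by
        refine iSup_le fun l => ?_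
        have hC : ∀ x, ‖S.runMax l x‖ ≤ S.A := fun x => by
          rw [Real.norm_of_nonneg (S.runMax_nonneg l x)]; exact runMax_le_of_bounded hg hh l x
        have i0 : Integrable (fun x => S.runMax l x ^ 2) S.ρ :=
          Integrable.of_bound ((S.adapted_runMax l).measurable.pow_const 2).aestronglyMeasurable
            (S.A ^ 2) (Filter.Eventually.of_forall fun x => by
              rw [norm_pow]; exact pow_le_pow_left₀ (norm_nonneg _) (hC x) 2)
        rw [← ofReal_integral_eq_lintegral_ofReal i0
          (Filter.Eventually.of_forall fun x => by positivity), hh2,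
          ← ENNReal.ofReal_ofNat 4, ← ENNReal.ofReal_mul (by norm_num)]
        exact ENNReal.ofReal_le_ofReal (integral_runMax_sq_le hg hh l)

lemma sum_integral_norm_diff_sq_le_of_bounded (N : ℕ) :
    ∑ l ∈ Finset.range N, ∫ x, ‖S.diff l x‖ ^ 2 * S.g x ∂S.ρ ≤ 2 * ∫ x, ‖S.h x‖ ^ 2 ∂S.ρ := by
  have h1 := S.sum_integral_norm_diff_sq_le N
  have h2 : ∀ l, S.stopMass l = 0 := fun l => by simp [stopMass, stopSet_of_bounded hg hh]
  have h3 : ∫ x, S.liveSq N x * S.g x ∂S.ρ ≤ ∫ x, S.absAvg N x ^ 2 ∂S.ρ :=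
    integral_mono (S.integrable_liveSq_mul N) (integrable_absAvg_sq hg hh N) fun x => by
      simp only [hg, mul_one, liveSq, live_of_bounded hg hh, if_true]
      exact pow_le_pow_left₀ (norm_nonneg _) (S.norm_avg_le_absAvg N x) 2
  simp only [h2, Finset.sum_const_zero, mul_zero, add_zero] at h1
  linarith [integral_absAvg_sq_le hg hh N]

end Bounded

end StoppedPair

/-! ### Poisson-like averages and geometric weights. -/

variable {n : ℕ}

/-- The Poisson-like profile `s ^ α / (s + d) ^ (m + α)`. -/
def pk (m α s d : ℝ) : ℝ := s ^ α / (s + d) ^ (m + α)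

lemma pk_nonneg {m α s d : ℝ} (hs : 0 ≤ s) (hd : 0 ≤ d) : 0 ≤ pk m α s d := by
  unfold pk; positivity

lemma measurable_pk_norm (m α s : ℝ) :
    Measurable (fun p : EuclideanSpace ℝ (Fin n) × EuclideanSpace ℝ (Fin n) =>
      ENNReal.ofReal (pk m α s ‖p.1 - p.2‖)) := by
  unfold pk; fun_prop

lemma measurable_pk_norm_right (m α s : ℝ) (x : EuclideanSpace ℝ (Fin n)) :
    Measurable (fun y => ENNReal.ofReal (pk m α s ‖x - y‖)) := by
  unfold pk; fun_prop

/-- The constant in the bound for the mass of the Poisson-like profiles. -/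
def pkC (m α : ℝ) (C : ℝ≥0) : ℝ := C * 2 ^ (m + α) * (1 - 2 ^ (-α))⁻¹

lemma pkC_nonneg {m α : ℝ} (hα : 0 < α) (C : ℝ≥0) : 0 ≤ pkC m α C := by
  have : (2 : ℝ) ^ (-α) < 1 := Real.rpow_lt_one_of_one_lt_of_neg one_lt_two (by linarith)
  have h1 : 0 ≤ (1 - (2 : ℝ) ^ (-α))⁻¹ := inv_nonneg.2 (by linarith)
  unfold pkC; positivity

/-- On the dyadic annulus of radius `2^i s` the profile is about `(2^i)^(-(m+α)) s^(-m)` and the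
measure is at most `C (2^i s)^m`, leaving the geometric series in `2^(-α)`. -/
lemma lintegral_pk_le {m α : ℝ} (hm : 0 < m) (hα : 0 < α) {C : ℝ≥0}
    {μ : Measure (EuclideanSpace ℝ (Fin n))} (hμ : IsOfOrder μ m C) {s : ℝ} (hs : 0 < s)
    (x : EuclideanSpace ℝ (Fin n)) :
    ∫⁻ y, ENNReal.ofReal (pk m α s ‖x - y‖) ∂μ ≤ ENNReal.ofReal (pkC m α C) := by
  set c : ℕ → ℝ := fun i => 2 ^ (m + α) * ((2 : ℝ) ^ i) ^ (-(m + α)) * s ^ (-m) with hc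
  have hc0 : ∀ i, 0 ≤ c i := fun i => by positivity
  have hpt : ∀ y, ENNReal.ofReal (pk m α s ‖x - y‖) ≤
      ∑' i : ℕ, (Metric.ball x (2 ^ i * s)).indicator (fun _ => ENNReal.ofReal (c i)) y := by
    intro y
    have hex : ∃ i : ℕ, ‖x - y‖ < 2 ^ i * s := by
      obtain ⟨i, hi⟩ := pow_unbounded_of_one_lt (‖x - y‖ / s) (one_lt_two (α := ℝ))
      exact ⟨i, (div_lt_iff₀ hs).1 hi⟩
    classical
    set i := Nat.find hex with hi
    have h1 : ‖x - y‖ < 2 ^ i * s := Nat.find_spec hex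
    refine le_trans ?_ (ENNReal.le_tsum i)
    have hmem : y ∈ Metric.ball x (2 ^ i * s) := by
      rw [Metric.mem_ball, dist_comm, dist_eq_norm]; exact h1
    rw [indicator_of_mem hmem]
    refine ENNReal.ofReal_le_ofReal ?_
    -- Minimality of `i` puts `y` outside the previous ball; for `i = 0` the summand `s` alone
    -- suffices.
    have h2 : 2 ^ i * s / 2 ≤ s + ‖x - y‖ := by
      rcases Nat.eq_zero_or_pos i with h0 | h0
      · rw [h0]; have := norm_nonneg (x - y); simp; linarith
      · have h3 : ¬ ‖x - y‖ < 2 ^ (i - 1) * s := Nat.find_min hex (by omega)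
        have h4 : (2 : ℝ) ^ i = 2 * 2 ^ (i - 1) := by
          rw [← pow_succ']; congr 1; omega
        rw [h4]; push Not at h3; linarith
    have e : c i = s ^ α / (2 ^ i * s / 2) ^ (m + α) := by
      rw [hc]; simp only
      rw [Real.div_rpow (by positivity) (by positivity), Real.mul_rpow (by positivity) hs.le,
        Real.rpow_neg (by positivity), Real.rpow_neg hs.le, Real.rpow_add hs]
      have h5 : ((2 : ℝ) ^ i) ^ (m + α) ≠ 0 := by positivity
      have h6 : (2 : ℝ) ^ (m + α) ≠ 0 := by positivity
      have h7 : s ^ m ≠ 0 := by positivity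
      have h8 : s ^ α ≠ 0 := by positivity
      field_simp
    rw [e]; unfold pk
    gcongr
  calc ∫⁻ y, ENNReal.ofReal (pk m α s ‖x - y‖) ∂μ
      ≤ ∫⁻ y, ∑' i : ℕ,
          (Metric.ball x (2 ^ i * s)).indicator (fun _ => ENNReal.ofReal (c i)) y ∂μ :=
        lintegral_mono hpt
    _ = ∑' i : ℕ, ENNReal.ofReal (c i) * μ (Metric.ball x (2 ^ i * s)) := by
        rw [lintegral_tsum fun i =>
          (measurable_const.indicator measurableSet_ball).aemeasurable]
        congr 1; funext i
        rw [lintegral_indicator_const measurableSet_ball]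
    _ ≤ ∑' i : ℕ, ENNReal.ofReal (C * 2 ^ (m + α) * ((2 : ℝ) ^ (-α)) ^ i) := by
        refine ENNReal.tsum_le_tsum fun i => ?_
        refine (mul_le_mul_right (hμ x (2 ^ i * s) (by positivity)) _).trans ?_
        rw [← ENNReal.ofReal_mul (hc0 i)]
        refine ENNReal.ofReal_le_ofReal (le_of_eq ?_)
        rw [hc]; simp only
        rw [Real.mul_rpow (by positivity) hs.le, neg_add, Real.rpow_add (by positivity : (0:ℝ) < 2 ^ i),
          Real.rpow_neg hs.le, Real.rpow_neg (by positivity : (0:ℝ) ≤ 2 ^ i)]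
        have h7 : s ^ m ≠ 0 := by positivity
        have h8 : ((2 : ℝ) ^ i) ^ m ≠ 0 := by positivity
        have e : ((2 : ℝ) ^ i) ^ (-α) = ((2 : ℝ) ^ (-α)) ^ i := by
          rw [← Real.rpow_natCast, ← Real.rpow_mul (by norm_num), mul_comm,
            Real.rpow_mul (by norm_num), Real.rpow_natCast]
        rw [e]
        field_simp
    _ = ENNReal.ofReal (pkC m α C) := by
        have hq : (2 : ℝ) ^ (-α) < 1 := Real.rpow_lt_one_of_one_lt_of_neg one_lt_two (by linarith)
        have hq0 : (0 : ℝ) ≤ 2 ^ (-α) := by positivity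
        have hsum := (hasSum_geometric_of_lt_one hq0 hq).mul_left ((C : ℝ) * 2 ^ (m + α))
        rw [← ENNReal.ofReal_tsum_of_nonneg (fun i => by positivity) hsum.summable, hsum.tsum_eq]
        rfl

/-- The Poisson-like average of `|φ| ρ` at scale `s`. -/
def poisson (m α : ℝ) (ρ : Measure (EuclideanSpace ℝ (Fin n))) (s : ℝ)
    (φ : EuclideanSpace ℝ (Fin n) → ℂ) (x : EuclideanSpace ℝ (Fin n)) : ℝ≥0∞ :=
  ∫⁻ y, ENNReal.ofReal (pk m α s ‖x - y‖) * ‖φ y‖ₑ ∂ρ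

lemma measurable_poisson (m α : ℝ) (ρ : Measure (EuclideanSpace ℝ (Fin n))) [SFinite ρ] (s : ℝ)
    {φ : EuclideanSpace ℝ (Fin n) → ℂ} (hφ : Measurable φ) : Measurable (poisson m α ρ s φ) :=
  Measurable.lintegral_prod_right'
    (f := fun p : EuclideanSpace ℝ (Fin n) × EuclideanSpace ℝ (Fin n) =>
      ENNReal.ofReal (pk m α s ‖p.1 - p.2‖) * ‖φ p.2‖ₑ)
    ((measurable_pk_norm m α s).mul (hφ.comp measurable_snd).enorm)

lemma lintegral_poisson_le {m α : ℝ} (hm : 0 < m) (hα : 0 < α) {C : ℝ≥0}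
    {μ ρ : Measure (EuclideanSpace ℝ (Fin n))} [SFinite μ] [SFinite ρ] (hμ : IsOfOrder μ m C)
    {s : ℝ} (hs : 0 < s) {φ : EuclideanSpace ℝ (Fin n) → ℂ} (hφ : Measurable φ) :
    ∫⁻ x, poisson m α ρ s φ x ∂μ ≤ ENNReal.ofReal (pkC m α C) * ∫⁻ y, ‖φ y‖ₑ ∂ρ := by
  unfold poisson
  rw [lintegral_lintegral_swap
    ((measurable_pk_norm m α s).mul (hφ.comp measurable_snd).enorm).aemeasurable,
    ← lintegral_const_mul _ hφ.enorm]
  refine lintegral_mono fun y => ?_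
  simp_rw [norm_sub_rev _ y]
  rw [lintegral_mul_const _ (measurable_pk_norm_right m α s y)]
  gcongr
  exact lintegral_pk_le hm hα hμ hs y

/-- Cauchy–Schwarz with `p` split as `p^(1/2) p^(1/2)`; combined with a bound for the mass of `p` it
gives the Schur-type estimates below. -/
lemma sq_lintegral_mul_le {X : Type*} [MeasurableSpace X] (μ : Measure X) {p φ : X → ℝ≥0∞}
    (hp : Measurable p) (hφ : Measurable φ) :
    (∫⁻ x, p x * φ x ∂μ) ^ 2 ≤ (∫⁻ x, p x ∂μ) * ∫⁻ x, p x * φ x ^ 2 ∂μ := by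
  have h := ENNReal.lintegral_mul_le_Lp_mul_Lq μ (p := 2) (q := 2)
    (by constructor <;> norm_num) (f := fun x => p x ^ (1 / 2 : ℝ))
    (g := fun x => p x ^ (1 / 2 : ℝ) * φ x) (hp.pow_const _).aemeasurable
    ((hp.pow_const _).mul hφ).aemeasurable
  have e0 : ∀ a : ℝ≥0∞, a ^ (1 / 2 : ℝ) * a ^ (1 / 2 : ℝ) = a := fun a => by
    rw [← ENNReal.rpow_add_of_nonneg _ _ (by norm_num) (by norm_num)]; norm_num
  have e1 : ∀ x, ((fun x => p x ^ (1 / 2 : ℝ)) * fun x => p x ^ (1 / 2 : ℝ) * φ x) x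
      = p x * φ x := fun x => by
    simp only [Pi.mul_apply]; rw [← mul_assoc, e0]
  have e2 : ∀ x, (p x ^ (1 / 2 : ℝ)) ^ (2 : ℝ) = p x := fun x => by
    rw [← ENNReal.rpow_mul]; norm_num
  have e3 : ∀ x, (p x ^ (1 / 2 : ℝ) * φ x) ^ (2 : ℝ) = p x * φ x ^ 2 := fun x => by
    rw [ENNReal.mul_rpow_of_nonneg _ _ (by norm_num), e2]; norm_num
  simp_rw [e1, e2, e3] at h
  calc (∫⁻ x, p x * φ x ∂μ) ^ 2
      ≤ ((∫⁻ x, p x ∂μ) ^ (1 / 2 : ℝ) * (∫⁻ x, p x * φ x ^ 2 ∂μ) ^ (1 / 2 : ℝ)) ^ 2 := by gcongr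
    _ = _ := by rw [mul_pow, sq, sq, e0, e0]

lemma sq_tsum_mul_le (p φ : ℕ → ℝ≥0∞) :
    (∑' i, p i * φ i) ^ 2 ≤ (∑' i, p i) * ∑' i, p i * φ i ^ 2 := by
  have := sq_lintegral_mul_le Measure.count (p := p) (φ := φ) measurable_from_top
    measurable_from_top
  simpa [lintegral_count] using this

/-- The geometric weight `2 ^ (-(α/2)|j - l|)`. -/
def wt (α : ℝ) (j l : ℕ) : ℝ≥0∞ := ENNReal.ofReal ((2 : ℝ) ^ (-(α / 2))) ^ (Nat.dist j l)

/-- A bound for the sum of the geometric weights. -/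
def wtC (α : ℝ) : ℝ≥0∞ := 2 * (1 - ENNReal.ofReal ((2 : ℝ) ^ (-(α / 2))))⁻¹

lemma wt_comm (α : ℝ) (j l : ℕ) : wt α j l = wt α l j := by rw [wt, wt, Nat.dist_comm]

lemma wtC_ne_top {α : ℝ} (hα : 0 < α) : wtC α ≠ ∞ := by
  have hq : (2 : ℝ) ^ (-(α / 2)) < 1 :=
    Real.rpow_lt_one_of_one_lt_of_neg one_lt_two (by linarith)
  have : (1 : ℝ≥0∞) - ENNReal.ofReal ((2 : ℝ) ^ (-(α / 2))) ≠ 0 := by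
    rw [Ne, tsub_eq_zero_iff_le, not_le]
    exact ENNReal.ofReal_lt_one.2 hq
  exact ENNReal.mul_ne_top (by norm_num) (ENNReal.inv_ne_top.2 this)

lemma tsum_wt_le (α : ℝ) (j : ℕ) : ∑' l, wt α j l ≤ wtC α := by
  set q := ENNReal.ofReal ((2 : ℝ) ^ (-(α / 2))) with hq
  have h1 : ∑' l, wt α j l = ∑ l ∈ Finset.range j, wt α j l + ∑' l, wt α j (l + j) :=
    (ENNReal.summable.sum_add_tsum_nat_add' ).symm
  have h2 : ∀ l, wt α j (l + j) = q ^ l := fun l => by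
    rw [wt, Nat.dist_eq_sub_of_le (by omega)]; congr 1; omega
  have h3 : ∑ l ∈ Finset.range j, wt α j l ≤ ∑' l, q ^ l := by
    rw [← Finset.sum_range_reflect]
    calc ∑ l ∈ Finset.range j, wt α j (j - 1 - l) = ∑ l ∈ Finset.range j, q ^ (l + 1) := by
          refine Finset.sum_congr rfl fun l hl => ?_
          have := Finset.mem_range.1 hl
          rw [wt, Nat.dist_eq_sub_of_le_right (by omega)]; congr 1; omega
      _ ≤ ∑' l, q ^ (l + 1) := ENNReal.sum_le_tsum _
      _ ≤ ∑' l, q ^ l := ENNReal.tsum_comp_le_tsum_of_injective (add_left_injective 1) _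
  rw [h1]; simp_rw [h2]
  rw [wtC, two_mul, ← ENNReal.tsum_geometric]
  gcongr

/-! ### Decay from cancellation at fine levels and from separation at coarse levels. -/

variable {n : ℕ} {ι : Type*} [MeasurableSpace ι]
  {k : ℝ → EuclideanSpace ℝ (Fin n) → EuclideanSpace ℝ (Fin n) → ℂ} {m α : ℝ} {K : ℝ≥0}

namespace IsSquareKernel

lemma measurable_right (hk : IsSquareKernel k m α K) {t : ℝ} (ht : 0 < t)
    (x : EuclideanSpace ℝ (Fin n)) : Measurable (k t x) := by
  have : Measurable (fun y : EuclideanSpace ℝ (Fin n) =>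
      ((⟨t, ht⟩, x, y) : Ioi (0 : ℝ) × EuclideanSpace ℝ (Fin n) × EuclideanSpace ℝ (Fin n))) := by
    fun_prop
  exact hk.measurable.comp this

lemma norm_le (hk : IsSquareKernel k m α K) (hm : 0 < m) (hα : 0 < α) {t : ℝ} (ht : 0 < t)
    (x y : EuclideanSpace ℝ (Fin n)) : ‖k t x y‖ ≤ K * t ^ (-m) := by
  refine (hk.size t ht x y).trans ?_
  have e : t ^ (-m) = t ^ α / t ^ (m + α) := by
    rw [← Real.rpow_sub ht]; congr 1; ring
  rw [e]
  have := norm_nonneg (x - y)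
  gcongr
  linarith

lemma integrable_mul (hk : IsSquareKernel k m α K) (hm : 0 < m) (hα : 0 < α) {t : ℝ} (ht : 0 < t)
    (x : EuclideanSpace ℝ (Fin n)) {ρ : Measure (EuclideanSpace ℝ (Fin n))}
    {φ : EuclideanSpace ℝ (Fin n) → ℂ} (hφ : Integrable φ ρ) :
    Integrable (fun y => k t x y * φ y) ρ :=
  hφ.bdd_mul (hk.measurable_right ht x).aestronglyMeasurable
    (Filter.Eventually.of_forall fun y => hk.norm_le hm hα ht x y)

end IsSquareKernel

/-- The distance from `x` to the other cells of level `i ≤ j` is at least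
`c₀ 2 ^ (-γ (j - i))` times the side length of these cells. -/
def GoodAt (𝒟 : CellTree (EuclideanSpace ℝ (Fin n)) ι) (ℓ γ c₀ : ℝ) (j : ℕ)
    (x : EuclideanSpace ℝ (Fin n)) : Prop :=
  ∀ i, 1 ≤ i → i ≤ j → ∀ y, 𝒟.idx i y ≠ 𝒟.idx i x →
    c₀ * (2 : ℝ) ^ (-(γ * ((j : ℝ) - i))) * (ℓ / 2 ^ i) ≤ ‖x - y‖

/-- The cells of level `i ≥ 1` have diameter at most `D ℓ / 2 ^ i`. -/
def DiamLE (𝒟 : CellTree (EuclideanSpace ℝ (Fin n)) ι) (ℓ D : ℝ) : Prop :=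
  ∀ i, 1 ≤ i → ∀ y z, 𝒟.idx i y = 𝒟.idx i z → ‖y - z‖ ≤ D * (ℓ / 2 ^ i)

/-- Selects a reference point in every cell, at which the kernel is frozen in order to use the mean
zero condition. -/
lemma CellTree.exists_adapted_section {X : Type*} [MeasurableSpace X] (𝒟 : CellTree X ι) (l : ℕ) :
    ∃ r : X → X, 𝒟.Adapted l r ∧ ∀ y, 𝒟.idx l (r y) = 𝒟.idx l y := by
  classical
  let s : ∀ i : ι, (∃ z, 𝒟.idx l z = i) → X := fun i h => h.choose
  refine ⟨fun y => s (𝒟.idx l y) ⟨y, rfl⟩, fun x y hxy => ?_,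
    fun y => (⟨y, rfl⟩ : ∃ z, 𝒟.idx l z = 𝒟.idx l y).choose_spec⟩
  simp only [s]
  congr 1
  simp only [hxy]

variable [Countable ι] [MeasurableSingletonClass ι]

/-- The kernel frozen at the reference points integrates to zero against `φ`, and the Hölder
condition bounds the remaining difference. When the cells are not small compared with `t` there is
nothing to gain and the size condition is enough. -/
lemma enorm_integral_kernel_mul_le (hk : IsSquareKernel k m α K) (hm : 0 < m) (hα : 0 < α)
    {𝒟 : CellTree (EuclideanSpace ℝ (Fin n)) ι} {ℓ D : ℝ} (hℓ : 0 < ℓ) (hD : 1 ≤ D)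
    (hdiam : DiamLE 𝒟 ℓ D) {ρ : Measure (EuclideanSpace ℝ (Fin n))} [IsFiniteMeasure ρ]
    {φ : EuclideanSpace ℝ (Fin n) → ℂ} (hφ : Integrable φ ρ) {l : ℕ}
    (h0 : ∀ x, ∫ y in 𝒟.cell l x, φ y ∂ρ = 0) {t : ℝ} (ht : 0 < t) (htℓ : t ≤ ℓ)
    (x : EuclideanSpace ℝ (Fin n)) :
    ‖∫ y, k t x y * φ y ∂ρ‖ₑ ≤
      ENNReal.ofReal (K * (2 * D * (ℓ / 2 ^ l) / t) ^ α) * poisson m α ρ t φ x := by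
  have hpk : ∀ y, 0 ≤ pk m α t ‖x - y‖ := fun y => pk_nonneg ht.le (norm_nonneg _)
  have key : ∀ ψ : EuclideanSpace ℝ (Fin n) → ℂ,
      (∫ y, k t x y * φ y ∂ρ = ∫ y, ψ y * φ y ∂ρ) →
      (∀ y, ‖ψ y‖ ≤ K * (2 * D * (ℓ / 2 ^ l) / t) ^ α * pk m α t ‖x - y‖) →
      ‖∫ y, k t x y * φ y ∂ρ‖ₑ ≤
        ENNReal.ofReal (K * (2 * D * (ℓ / 2 ^ l) / t) ^ α) * poisson m α ρ t φ x := by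
    intro ψ h1 h2
    rw [h1]
    refine (enorm_integral_le_lintegral_enorm _).trans ?_
    rw [poisson, ← lintegral_const_mul' _ _ ENNReal.ofReal_ne_top]
    refine lintegral_mono fun y => ?_
    rw [enorm_mul, ← mul_assoc, ← ENNReal.ofReal_mul (by positivity)]
    gcongr
    rw [← ofReal_norm]
    exact ENNReal.ofReal_le_ofReal (h2 y)
  by_cases hc : 1 ≤ l ∧ D * (ℓ / 2 ^ l) < t / 2
  · obtain ⟨r, hr, hr'⟩ := 𝒟.exists_adapted_section l
    have hra : 𝒟.Adapted l (fun y => k t x (r y)) := hr.comp (k t x)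
    have hint : Integrable (fun y => k t x (r y) * φ y) ρ :=
      hφ.bdd_mul hra.measurable.aestronglyMeasurable
        (Filter.Eventually.of_forall fun y => hk.norm_le hm hα ht x (r y))
    have hz := CellTree.integral_adapted_mul_eq_zero hra hint (fun y _ => h0 y)
    refine key (fun y => k t x y - k t x (r y)) ?_ fun y => ?_
    · simp_rw [sub_mul]
      rw [integral_sub (hk.integrable_mul hm hα ht x hφ) hint, hz, sub_zero]
    · have hd : ‖y - r y‖ ≤ D * (ℓ / 2 ^ l) := hdiam l hc.1 y (r y) (hr' y).symm
      refine (hk.holder t ht x y (r y) (hd.trans_lt hc.2)).trans ?_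
      rw [mul_assoc]
      refine mul_le_mul_of_nonneg_left ?_ K.2
      rw [pk, ← mul_div_assoc]
      have := norm_nonneg (x - y)
      refine div_le_div_of_nonneg_right ?_ (by positivity)
      rw [← Real.mul_rpow (by positivity) ht.le, div_mul_cancel₀ _ ht.ne']
      refine Real.rpow_le_rpow (norm_nonneg _) (hd.trans ?_) hα.le
      have : 0 ≤ D * (ℓ / 2 ^ l) := by positivity
      linarith
  -- Here the factor `(2D (ℓ/2^l) / t)^α` is at least `1`. At level `0` the cell is the whole space,
  -- with no bound on its diameter, and it is `t ≤ ℓ` that gives this.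
  · refine key (fun y => k t x y) rfl fun y => ?_
    have h1 : 1 ≤ 2 * D * (ℓ / 2 ^ l) / t := by
      rw [one_le_div ht]
      by_cases hl : 1 ≤ l
      · have : ¬ D * (ℓ / 2 ^ l) < t / 2 := fun h => hc ⟨hl, h⟩
        push Not at this; linarith
      · have : l = 0 := by omega
        subst this
        simp only [pow_zero, div_one]
        nlinarith
    refine (hk.size t ht x y).trans ?_
    have h2 : (1 : ℝ) ≤ (2 * D * (ℓ / 2 ^ l) / t) ^ α := Real.one_le_rpow h1 hα.le
    have h3 := mul_nonneg K.2 (hpk y)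
    change K * pk m α t ‖x - y‖ ≤ _
    calc K * pk m α t ‖x - y‖ ≤ (K * pk m α t ‖x - y‖) * (2 * D * (ℓ / 2 ^ l) / t) ^ α :=
          le_mul_of_one_le_right h3 h2
      _ = _ := by ring

lemma pk_le_of_mem_Ioc (hm : 0 < m) (hα : 0 < α) {s t d : ℝ} (hs : 0 < s) (ht : s / 2 < t)
    (hts : t ≤ s) (hd : 0 ≤ d) : pk m α t d ≤ 2 ^ (m + α) * pk m α s d := by
  have ht0 : 0 < t := by linarith
  unfold pk
  rw [← mul_div_assoc, div_le_div_iff₀ (by positivity) (by positivity)]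
  have h1 : t ^ α ≤ s ^ α := Real.rpow_le_rpow ht0.le hts hα.le
  have h2 : (s + d) ^ (m + α) ≤ 2 ^ (m + α) * (t + d) ^ (m + α) := by
    rw [← Real.mul_rpow (by norm_num) (by positivity)]
    exact Real.rpow_le_rpow (by positivity) (by linarith) (by positivity)
  calc t ^ α * (s + d) ^ (m + α) ≤ s ^ α * (2 ^ (m + α) * (t + d) ^ (m + α)) := by gcongr
    _ = _ := by ring

lemma poisson_le_of_mem_Ioc (hm : 0 < m) (hα : 0 < α) {ρ : Measure (EuclideanSpace ℝ (Fin n))}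
    {s t : ℝ} (hs : 0 < s) (ht : s / 2 < t) (hts : t ≤ s)
    (φ : EuclideanSpace ℝ (Fin n) → ℂ) (x : EuclideanSpace ℝ (Fin n)) :
    poisson m α ρ t φ x ≤ ENNReal.ofReal (2 ^ (m + α)) * poisson m α ρ s φ x := by
  unfold poisson
  rw [← lintegral_const_mul' _ _ ENNReal.ofReal_ne_top]
  refine lintegral_mono fun y => ?_
  rw [← mul_assoc, ← ENNReal.ofReal_mul (by positivity)]
  gcongr
  exact pk_le_of_mem_Ioc hm hα hs ht hts (norm_nonneg _)

lemma wt_eq_ofReal (α : ℝ) {i j : ℕ} (hij : i ≤ j) :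
    wt α i j = ENNReal.ofReal ((2 : ℝ) ^ (-(α / 2) * ((j : ℝ) - i))) := by
  rw [wt, Nat.dist_eq_sub_of_le hij, ← ENNReal.ofReal_pow (by positivity), ← Real.rpow_natCast,
    ← Real.rpow_mul (by norm_num), Nat.cast_sub hij]

/-- The gain is really `2^(-α(l-j))`; half of the exponent is given away to match the weight that is
available for coarse levels. -/
lemma scale_ratio_le (hα : 0 < α) {ℓ t D : ℝ} (hℓ : 0 < ℓ) (hD : 0 ≤ D) {j l : ℕ} (hjl : j ≤ l)
    (ht : ℓ / 2 ^ (j + 1) < t) :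
    (2 * D * (ℓ / 2 ^ l) / t) ^ α ≤ (4 * D) ^ α * 2 ^ (-(α / 2) * ((l : ℝ) - j)) := by
  have ht0 : 0 < t := lt_trans (by positivity) ht
  have h1 : 2 * D * (ℓ / 2 ^ l) / t ≤ 4 * D * 2 ^ (-((l : ℝ) - j)) := by
    rw [div_le_iff₀ ht0]
    have e : (2 : ℝ) ^ (-((l : ℝ) - j)) = 2 ^ j / 2 ^ l := by
      rw [neg_sub, Real.rpow_sub (by norm_num), Real.rpow_natCast, Real.rpow_natCast]
    have h2 : 2 * D * (ℓ / 2 ^ l) = 4 * D * (2 ^ j / 2 ^ l) * (ℓ / 2 ^ (j + 1)) := by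
      field_simp; ring
    rw [e, h2]
    gcongr
  have hjl' : (0 : ℝ) ≤ (l : ℝ) - j := sub_nonneg.2 (by exact_mod_cast hjl)
  calc (2 * D * (ℓ / 2 ^ l) / t) ^ α ≤ (4 * D * 2 ^ (-((l : ℝ) - j))) ^ α :=
        Real.rpow_le_rpow (by positivity) h1 hα.le
    _ = (4 * D) ^ α * 2 ^ (-((l : ℝ) - j) * α) := by
        rw [Real.mul_rpow (by positivity) (by positivity), ← Real.rpow_mul (by norm_num)]
    _ ≤ _ := by
        refine mul_le_mul_of_nonneg_left
          (Real.rpow_le_rpow_of_exponent_le one_le_two ?_) (by positivity)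
        nlinarith

/-- Passing from scale `t` to the coarser scale `ℓ/2^l` gains `2^(-α(j-l))` from the numerator.
Goodness makes `d` comparable to `ℓ/2^l` up to `2^(γ(j-l))`, so the denominator loses
`2^(γ(m+α)(j-l))`. The choice `γ = α/(2(m+α))` makes this loss exactly half of the gain. -/
lemma pk_le_of_good (hm : 0 < m) (hα : 0 < α) {ℓ t c₀ d : ℝ} (hℓ : 0 < ℓ) (hc : 0 < c₀)
    (hc1 : c₀ ≤ 1) {j l : ℕ} (hjl : l + 1 ≤ j) (ht0 : 0 < t) (ht : t ≤ ℓ / 2 ^ j)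
    (hd : c₀ * (2 : ℝ) ^ (-(α / (2 * (m + α)) * ((j : ℝ) - (l + 1 : ℕ)))) * (ℓ / 2 ^ (l + 1)) ≤ d) :
    pk m α t d ≤ (3 / c₀) ^ (m + α) * 2 ^ (-(α / 2) * ((j : ℝ) - l)) *
      pk m α (ℓ / 2 ^ l) d := by
  set γ := α / (2 * (m + α)) with hγ
  have hγ0 : 0 < γ := by positivity
  have hγe : γ * (m + α) = α / 2 := by rw [hγ]; field_simp
  set r : ℝ := (j : ℝ) - l with hr
  have hr1 : 1 ≤ r := by
    have : ((l + 1 : ℕ) : ℝ) ≤ j := by exact_mod_cast hjl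
    push_cast at this; rw [hr]; linarith
  have hd0 : 0 < d := lt_of_lt_of_le (by positivity) hd
  set L := ℓ / 2 ^ l with hL
  have hL0 : 0 < L := by positivity
  have h1 : L ≤ 2 / c₀ * 2 ^ (γ * r) * d := by
    have e : ℓ / 2 ^ (l + 1) = L / 2 := by rw [hL]; field_simp; ring
    have e' : -(γ * ((j : ℝ) - (l + 1 : ℕ))) = γ - γ * r := by push_cast; rw [hr]; ring
    rw [e, e'] at hd
    have h2 : c₀ * 2 ^ (-(γ * r)) * (L / 2) ≤ d := by
      refine le_trans ?_ hd
      gcongr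
      · norm_num
      · linarith
    rw [Real.rpow_neg (by norm_num)] at h2
    have h3 : (0 : ℝ) < 2 ^ (γ * r) := by positivity
    calc L = 2 / c₀ * 2 ^ (γ * r) * (c₀ * (2 ^ (γ * r))⁻¹ * (L / 2)) := by field_simp
      _ ≤ _ := by gcongr
  have h2 : L + d ≤ 3 / c₀ * 2 ^ (γ * r) * (t + d) := by
    have h3 : 1 ≤ 1 / c₀ * (2 : ℝ) ^ (γ * r) := by
      have a1 : 1 ≤ 1 / c₀ := by rw [le_div_iff₀ hc]; linarith
      have a2 : (1 : ℝ) ≤ 2 ^ (γ * r) := Real.one_le_rpow (by norm_num) (by positivity)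
      nlinarith
    have h4 : d ≤ 1 / c₀ * 2 ^ (γ * r) * d := le_mul_of_one_le_left hd0.le h3
    calc L + d ≤ 2 / c₀ * 2 ^ (γ * r) * d + 1 / c₀ * 2 ^ (γ * r) * d := add_le_add h1 h4
      _ = 3 / c₀ * 2 ^ (γ * r) * d := by ring
      _ ≤ _ := by gcongr; linarith
  have h3 : (L + d) ^ (m + α) ≤ (3 / c₀) ^ (m + α) * 2 ^ (α / 2 * r) * (t + d) ^ (m + α) := by
    calc (L + d) ^ (m + α) ≤ (3 / c₀ * 2 ^ (γ * r) * (t + d)) ^ (m + α) :=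
          Real.rpow_le_rpow (by positivity) h2 (by positivity)
      _ = _ := by
          rw [Real.mul_rpow (by positivity) (by positivity),
            Real.mul_rpow (by positivity) (by positivity), ← Real.rpow_mul (by norm_num)]
          congr 3; rw [← hγe]; ring
  have h4 : t ^ α ≤ L ^ α * 2 ^ (-(α * r)) := by
    have e : ℓ / 2 ^ j = L * 2 ^ (-r) := by
      rw [hL, hr, neg_sub, Real.rpow_sub (by norm_num), Real.rpow_natCast, Real.rpow_natCast]
      field_simp
    rw [e] at ht
    calc t ^ α ≤ (L * 2 ^ (-r)) ^ α := Real.rpow_le_rpow ht0.le ht hα.le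
      _ = _ := by
          rw [Real.mul_rpow hL0.le (by positivity), ← Real.rpow_mul (by norm_num)]
          congr 2; ring
  unfold pk
  rw [← mul_div_assoc, div_le_div_iff₀ (by positivity) (by positivity)]
  calc t ^ α * (L + d) ^ (m + α)
      ≤ (L ^ α * 2 ^ (-(α * r))) *
        ((3 / c₀) ^ (m + α) * 2 ^ (α / 2 * r) * (t + d) ^ (m + α)) := by gcongr
    _ = (3 / c₀) ^ (m + α) * (2 ^ (-(α * r)) * 2 ^ (α / 2 * r)) * L ^ α * (t + d) ^ (m + α) := by
        ring
    _ = _ := by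
        rw [← Real.rpow_add (by norm_num)]
        congr 4; ring

/-! ### The defect and its pointwise bound. -/

variable {n : ℕ} {ι : Type*} [MeasurableSpace ι]

namespace StoppedPair

/-- The positive measure `g ρ`. -/
def μ {X : Type*} [MeasurableSpace X] (S : StoppedPair X ι) : Measure X :=
  S.ρ.withDensity (fun x => ENNReal.ofReal (S.g x))

lemma lintegral_μ {X : Type*} [MeasurableSpace X] (S : StoppedPair X ι) (f : X → ℝ≥0∞) :
    ∫⁻ x, f x ∂S.μ = ∫⁻ x, ENNReal.ofReal (S.g x) * f x ∂S.ρ :=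
  lintegral_withDensity_eq_lintegral_mul_non_measurable _ S.measurable_g.ennreal_ofReal
    (Filter.Eventually.of_forall fun _ => ENNReal.ofReal_lt_top) f

instance {X : Type*} [MeasurableSpace X] (S : StoppedPair X ι) : IsFiniteMeasure S.μ :=
  isFiniteMeasure_withDensity_ofReal S.integrable_g.2

/-- The difference between `θ_t (φ ρ)` and the multiple of `θ_t (g ρ)` with the same mass on the
cell of level `j`. -/
def defect (S : StoppedPair (EuclideanSpace ℝ (Fin n)) ι)
    (k : ℝ → EuclideanSpace ℝ (Fin n) → EuclideanSpace ℝ (Fin n) → ℂ) (j : ℕ) (t : ℝ)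
    (x : EuclideanSpace ℝ (Fin n)) (φ : EuclideanSpace ℝ (Fin n) → ℂ) : ℂ :=
  ∫ y, k t x y * φ y ∂S.ρ
    - (∫ y in S.cell j x, φ y ∂S.ρ) / S.gc j x * ∫ y, k t x y * S.g y ∂S.ρ

/-- The standing assumptions on the kernel, the cells and the measure `g ρ`. -/
structure Admissible (S : StoppedPair (EuclideanSpace ℝ (Fin n)) ι)
    (k : ℝ → EuclideanSpace ℝ (Fin n) → EuclideanSpace ℝ (Fin n) → ℂ) (m α : ℝ) (K Cμ : ℝ≥0)
    (ℓ D c₀ : ℝ) : Prop where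
  kernel : IsSquareKernel k m α K
  m_pos : 0 < m
  α_pos : 0 < α
  ℓ_pos : 0 < ℓ
  one_le_D : 1 ≤ D
  diam : DiamLE S.toCellTree ℓ D
  order : IsOfOrder S.μ m Cμ
  c₀_pos : 0 < c₀
  c₀_le_one : c₀ ≤ 1

/-- The constant in the pointwise bound for the defect. -/
def coreC (m α : ℝ) (K Cμ : ℝ≥0) (D c₀ : ℝ) : ℝ :=
  K * (4 * D) ^ α * 2 ^ (m + α) + K * (3 / c₀) ^ (m + α) * (1 + pkC m α Cμ)

variable {S : StoppedPair (EuclideanSpace ℝ (Fin n)) ι}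
  {k : ℝ → EuclideanSpace ℝ (Fin n) → EuclideanSpace ℝ (Fin n) → ℂ} {m α : ℝ} {K Cμ : ℝ≥0}
  {ℓ D c₀ : ℝ}

lemma Admissible.integrable (H : S.Admissible k m α K Cμ ℓ D c₀) {t : ℝ} (ht : 0 < t)
    (x : EuclideanSpace ℝ (Fin n)) {φ : EuclideanSpace ℝ (Fin n) → ℂ} (hφ : Integrable φ S.ρ) :
    Integrable (fun y => k t x y * φ y) S.ρ :=
  H.kernel.integrable_mul H.m_pos H.α_pos ht x hφ

lemma Admissible.defect_add (H : S.Admissible k m α K Cμ ℓ D c₀) {t : ℝ} (ht : 0 < t) (j : ℕ)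
    (x : EuclideanSpace ℝ (Fin n)) {φ ψ : EuclideanSpace ℝ (Fin n) → ℂ} (hφ : Integrable φ S.ρ)
    (hψ : Integrable ψ S.ρ) :
    S.defect k j t x (fun y => φ y + ψ y) = S.defect k j t x φ + S.defect k j t x ψ := by
  unfold defect
  simp_rw [mul_add]
  rw [integral_add (H.integrable ht x hφ) (H.integrable ht x hψ),
    integral_add hφ.integrableOn hψ.integrableOn]
  ring

lemma defect_const_mul_g (j : ℕ) (t : ℝ) (x : EuclideanSpace ℝ (Fin n)) (c : ℂ)
    (hx : S.gc j x ≠ 0) : S.defect k j t x (fun y => c * S.g y) = 0 := by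
  unfold defect
  have e : ∀ y, k t x y * (c * S.g y) = c * (k t x y * S.g y) := fun y => by ring
  simp_rw [e]
  rw [integral_const_mul, integral_const_mul, integral_complex_ofReal]
  change c * _ - c * (S.gc j x : ℂ) / S.gc j x * _ = 0
  rw [mul_div_assoc, div_self (by exact_mod_cast hx), mul_one, sub_self]

variable [Countable ι] [MeasurableSingletonClass ι]

/-- For `j ≤ l` the mean of `φ` on the level `j` cell vanishes, so the defect is the plain integral
and cancellation at level `l` gives the decay. -/
lemma Admissible.enorm_defect_near (H : S.Admissible k m α K Cμ ℓ D c₀) {j l : ℕ} (hjl : j ≤ l)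
    {t : ℝ} (ht : t ∈ Ioc (ℓ / 2 ^ (j + 1)) (ℓ / 2 ^ j)) (x : EuclideanSpace ℝ (Fin n))
    {φ : EuclideanSpace ℝ (Fin n) → ℂ} (hφ : Integrable φ S.ρ)
    (h0 : ∀ i ≤ l, ∀ x, ∫ y in S.cell i x, φ y ∂S.ρ = 0) :
    ‖S.defect k j t x φ‖ₑ ≤ ENNReal.ofReal (coreC m α K Cμ D c₀) *
      (wt α j l * poisson m α S.ρ (ℓ / 2 ^ j) φ x) := by
  have hℓ := H.ℓ_pos
  have hα := H.α_pos
  have hm := H.m_pos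
  have hD := H.one_le_D
  have hc := H.c₀_pos
  have ht0 : 0 < t := lt_trans (by positivity) ht.1
  have htℓ : t ≤ ℓ := ht.2.trans (div_le_self hℓ.le (one_le_pow₀ one_le_two))
  have e : S.defect k j t x φ = ∫ y, k t x y * φ y ∂S.ρ := by
    rw [defect, h0 j hjl]; simp
  have hpkC := pkC_nonneg (m := m) hα Cμ
  rw [e]
  refine (enorm_integral_kernel_mul_le H.kernel hm hα hℓ hD H.diam hφ (h0 l le_rfl) ht0 htℓ
    x).trans ?_
  have h2 : ℓ / 2 ^ j / 2 < t := by
    have := ht.1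
    rwa [pow_succ, ← div_div] at this
  calc ENNReal.ofReal (K * (2 * D * (ℓ / 2 ^ l) / t) ^ α) * poisson m α S.ρ t φ x
      ≤ ENNReal.ofReal (K * ((4 * D) ^ α * 2 ^ (-(α / 2) * ((l : ℝ) - j)))) *
        (ENNReal.ofReal (2 ^ (m + α)) * poisson m α S.ρ (ℓ / 2 ^ j) φ x) := by
        gcongr
        · exact scale_ratio_le hα hℓ (by linarith) hjl ht.1
        · exact poisson_le_of_mem_Ioc hm hα (by positivity) h2 ht.2 φ x
    _ = ENNReal.ofReal (K * (4 * D) ^ α * 2 ^ (m + α)) *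
        (wt α j l * poisson m α S.ρ (ℓ / 2 ^ j) φ x) := by
        rw [wt_eq_ofReal α hjl, ← mul_assoc (ENNReal.ofReal _), ← mul_assoc (ENNReal.ofReal _),
          ← ENNReal.ofReal_mul (by positivity),
          ← ENNReal.ofReal_mul (by positivity)]
        congr 2; ring
    _ ≤ _ := by
        gcongr
        unfold coreC
        have : 0 ≤ K * (3 / c₀) ^ (m + α) * (1 + pkC m α Cμ) := by positivity
        linarith

/-- The level `j` cell lies in the level `l + 1` cell, where `φ = a g`. So the average in the defect
is `a`, and the defect is the integral of the kernel against `φ - a g`, which vanishes on that cell.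
Outside it `pk_le_of_good` applies. -/
lemma Admissible.enorm_defect_far (H : S.Admissible k m α K Cμ ℓ D c₀) {j l : ℕ} (hjl : l + 1 ≤ j)
    {t : ℝ} (ht : t ∈ Ioc (ℓ / 2 ^ (j + 1)) (ℓ / 2 ^ j)) {x : EuclideanSpace ℝ (Fin n)}
    (hx : GoodAt S.toCellTree ℓ (α / (2 * (m + α))) c₀ j x) (hgx : S.gc j x ≠ 0)
    {φ : EuclideanSpace ℝ (Fin n) → ℂ} (hφ : Integrable φ S.ρ) {a : ℂ}
    (ha : ∀ y ∈ S.cell (l + 1) x, φ y = a * S.g y) :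
    ‖S.defect k j t x φ‖ₑ ≤ ENNReal.ofReal (coreC m α K Cμ D c₀) *
      (wt α j l * (poisson m α S.ρ (ℓ / 2 ^ l) φ x + ‖a‖ₑ)) := by
  have hℓ := H.ℓ_pos
  have hα := H.α_pos
  have hm := H.m_pos
  have hD := H.one_le_D
  have hc := H.c₀_pos
  have ht0 : 0 < t := lt_trans (by positivity) ht.1
  have hgi : Integrable (fun y => (S.g y : ℂ)) S.ρ := S.integrable_g.ofReal
  have hpkC := pkC_nonneg (m := m) hα Cμ
  have e : S.defect k j t x φ = ∫ y, k t x y * (φ y - a * S.g y) ∂S.ρ := by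
    have e1 : ∫ y in S.cell j x, φ y ∂S.ρ = a * S.gc j x := by
      rw [setIntegral_congr_fun (CellTree.measurableSet_cell j x) (g := fun y => a * (S.g y : ℂ))
        (fun y hy => ha y (CellTree.cell_subset hjl x hy)), integral_const_mul,
        integral_complex_ofReal]; rfl
    have e2 : ∀ y, k t x y * (φ y - a * S.g y) = k t x y * φ y - a * (k t x y * S.g y) :=
      fun y => by ring
    simp_rw [e2]
    rw [integral_sub (H.integrable ht0 x hφ) ((H.integrable ht0 x hgi).const_mul a),
      integral_const_mul, defect, e1, mul_div_assoc, div_self (by exact_mod_cast hgx), mul_one]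
  rw [e]
  refine (enorm_integral_le_lintegral_enorm _).trans ?_
  set c : ℝ := K * ((3 / c₀) ^ (m + α) * 2 ^ (-(α / 2) * ((j : ℝ) - l))) with hcdef
  have hc0 : 0 ≤ c := by positivity
  have hpt : ∀ y, ‖k t x y * (φ y - a * S.g y)‖ₑ ≤
      ENNReal.ofReal c * (ENNReal.ofReal (pk m α (ℓ / 2 ^ l) ‖x - y‖) * ‖φ y‖ₑ +
        ‖a‖ₑ * (ENNReal.ofReal (S.g y) * ENNReal.ofReal (pk m α (ℓ / 2 ^ l) ‖x - y‖))) := by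
    intro y
    by_cases hy : y ∈ S.cell (l + 1) x
    · simp [ha y hy]
    · have h1 : ‖k t x y‖ₑ ≤ ENNReal.ofReal c * ENNReal.ofReal (pk m α (ℓ / 2 ^ l) ‖x - y‖) := by
        rw [← ENNReal.ofReal_mul hc0, ← ofReal_norm]
        refine ENNReal.ofReal_le_ofReal ((H.kernel.size t ht0 x y).trans ?_)
        rw [hcdef, mul_assoc]
        refine mul_le_mul_of_nonneg_left ?_ K.2
        exact pk_le_of_good hm hα hℓ hc H.c₀_le_one hjl ht0 ht.2 (hx (l + 1) (by omega) hjl y hy)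
      have h2 : ‖φ y - a * S.g y‖ₑ ≤ ‖φ y‖ₑ + ‖a‖ₑ * ENNReal.ofReal (S.g y) := by
        refine (enorm_sub_le).trans ?_
        rw [enorm_mul]
        gcongr
        rw [← ofReal_norm, Complex.norm_real, Real.norm_of_nonneg (S.g_nonneg y)]
      rw [enorm_mul]
      refine (mul_le_mul' h1 h2).trans (le_of_eq ?_)
      ring
  refine (lintegral_mono hpt).trans ?_
  have hmp := measurable_pk_norm_right m α (ℓ / 2 ^ l) x
  rw [lintegral_const_mul' _ _ ENNReal.ofReal_ne_top, lintegral_add_right _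
    (by exact (S.measurable_g.ennreal_ofReal.mul hmp).const_mul _),
    lintegral_const_mul' _ _ enorm_ne_top, ← S.lintegral_μ]
  have hP : ∫⁻ y, ENNReal.ofReal (pk m α (ℓ / 2 ^ l) ‖x - y‖) ∂S.μ ≤
      ENNReal.ofReal (pkC m α Cμ) := lintegral_pk_le hm hα H.order (by positivity) x
  calc ENNReal.ofReal c * (poisson m α S.ρ (ℓ / 2 ^ l) φ x
        + ‖a‖ₑ * ∫⁻ y, ENNReal.ofReal (pk m α (ℓ / 2 ^ l) ‖x - y‖) ∂S.μ)
      ≤ ENNReal.ofReal c * (ENNReal.ofReal (1 + pkC m α Cμ) * poisson m α S.ρ (ℓ / 2 ^ l) φ x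
        + ENNReal.ofReal (1 + pkC m α Cμ) * ‖a‖ₑ) := by
        rw [mul_comm ‖a‖ₑ]
        gcongr
        · refine le_mul_of_one_le_left (zero_le) ?_
          rw [ENNReal.one_le_ofReal]; linarith
        · exact hP.trans (ENNReal.ofReal_le_ofReal (by linarith))
    _ = ENNReal.ofReal (K * (3 / c₀) ^ (m + α) * (1 + pkC m α Cμ)) *
        (wt α j l * (poisson m α S.ρ (ℓ / 2 ^ l) φ x + ‖a‖ₑ)) := by
        rw [wt_comm, wt_eq_ofReal α (by omega : l ≤ j), ← mul_add,
          ← mul_assoc (ENNReal.ofReal _), ← mul_assoc (ENNReal.ofReal _),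
          ← ENNReal.ofReal_mul (by positivity), ← ENNReal.ofReal_mul (by positivity)]
        congr 2; rw [hcdef]; ring
    _ ≤ _ := by
        gcongr
        unfold coreC
        have : 0 ≤ K * (4 * D) ^ α * 2 ^ (m + α) := by positivity
        linarith

/-- The pointwise bound for the defect of a function with mean zero on the cells of level `l` that
is a multiple of `g` on the cell of level `l + 1` of `x`. -/
lemma Admissible.enorm_defect_le (H : S.Admissible k m α K Cμ ℓ D c₀) {j : ℕ} (l : ℕ)
    {t : ℝ} (ht : t ∈ Ioc (ℓ / 2 ^ (j + 1)) (ℓ / 2 ^ j)) {x : EuclideanSpace ℝ (Fin n)}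
    (hx : GoodAt S.toCellTree ℓ (α / (2 * (m + α))) c₀ j x) (hgx : S.gc j x ≠ 0)
    {φ : EuclideanSpace ℝ (Fin n) → ℂ} (hφ : Integrable φ S.ρ) {a : ℂ}
    (h0 : ∀ i ≤ l, ∀ x, ∫ y in S.cell i x, φ y ∂S.ρ = 0)
    (ha : ∀ y ∈ S.cell (l + 1) x, φ y = a * S.g y) :
    ‖S.defect k j t x φ‖ₑ ≤ ENNReal.ofReal (coreC m α K Cμ D c₀) *
      (wt α j l * (poisson m α S.ρ (ℓ / 2 ^ (min j l)) φ x + ‖a‖ₑ)) := by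
  rcases le_or_gt j l with hjl | hjl
  · refine (H.enorm_defect_near hjl ht x hφ h0).trans ?_
    rw [min_eq_left hjl]
    gcongr
    exact le_self_add
  · rw [min_eq_right hjl.le]
    exact H.enorm_defect_far hjl ht hx hgx hφ ha

end StoppedPair

/-! ### Summation of the defect over the levels. -/

variable {n : ℕ} {ι : Type*} [MeasurableSpace ι]

lemma ennreal_add_sq_le (a b : ℝ≥0∞) : (a + b) ^ 2 ≤ 2 * a ^ 2 + 2 * b ^ 2 := by
  have := ENNReal.rpow_add_le_mul_rpow_add_rpow a b (p := 2) (by norm_num)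
  norm_num at this
  rw [← mul_add]; exact this

lemma poisson_le_lintegral {m α : ℝ} (hm : 0 < m) (hα : 0 < α)
    {ρ : Measure (EuclideanSpace ℝ (Fin n))} {s : ℝ} (hs : 0 < s)
    (φ : EuclideanSpace ℝ (Fin n) → ℂ) (x : EuclideanSpace ℝ (Fin n)) :
    poisson m α ρ s φ x ≤ ENNReal.ofReal (s ^ α / s ^ (m + α)) * ∫⁻ y, ‖φ y‖ₑ ∂ρ := by
  rw [poisson, ← lintegral_const_mul' _ _ ENNReal.ofReal_ne_top]
  refine lintegral_mono fun y => ?_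
  gcongr
  unfold pk
  have := norm_nonneg (x - y)
  gcongr
  linarith

namespace StoppedPair

/-- The part of the bound for the defect of `h` that comes from the increments of level `l`. -/
def diffTerm (S : StoppedPair (EuclideanSpace ℝ (Fin n)) ι) (m α ℓ : ℝ) (j l : ℕ)
    (x : EuclideanSpace ℝ (Fin n)) : ℝ≥0∞ :=
  poisson m α S.ρ (ℓ / 2 ^ (min j l)) (fun y => S.diff l y * S.g y) x + ‖S.diff l x‖ₑ

/-- The part of the bound for the defect of `h` that comes from the compensated jumps of
level `l`. -/
def badTerm (S : StoppedPair (EuclideanSpace ℝ (Fin n)) ι) (m α ℓ : ℝ) (j l : ℕ)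
    (x : EuclideanSpace ℝ (Fin n)) : ℝ≥0∞ :=
  poisson m α S.ρ (ℓ / 2 ^ (min j l)) (S.bad l) x + ‖S.comp l x‖ₑ

variable {S : StoppedPair (EuclideanSpace ℝ (Fin n)) ι}
  {k : ℝ → EuclideanSpace ℝ (Fin n) → EuclideanSpace ℝ (Fin n) → ℂ} {m α : ℝ} {K Cμ : ℝ≥0}
  {ℓ D c₀ : ℝ}

variable [Countable ι] [MeasurableSingletonClass ι]

lemma measurable_diffTerm (m α ℓ : ℝ) (j l : ℕ) : Measurable (S.diffTerm m α ℓ j l) :=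
  (measurable_poisson m α S.ρ _ ((S.adapted_diff l).measurable.mul
    (Complex.measurable_ofReal.comp S.measurable_g))).add (S.adapted_diff l).measurable.enorm

lemma measurable_badTerm (m α ℓ : ℝ) (j l : ℕ) : Measurable (S.badTerm m α ℓ j l) :=
  (measurable_poisson m α S.ρ _ (S.measurable_bad l)).add (S.adapted_comp l).measurable.enorm

lemma Admissible.enorm_defect_diff (H : S.Admissible k m α K Cμ ℓ D c₀) {j : ℕ} (l : ℕ)
    {t : ℝ} (ht : t ∈ Ioc (ℓ / 2 ^ (j + 1)) (ℓ / 2 ^ j)) {x : EuclideanSpace ℝ (Fin n)}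
    (hx : GoodAt S.toCellTree ℓ (α / (2 * (m + α))) c₀ j x) (hgx : S.gc j x ≠ 0) :
    ‖S.defect k j t x (fun y => S.diff l y * S.g y)‖ₑ ≤
      ENNReal.ofReal (coreC m α K Cμ D c₀) * (wt α j l * S.diffTerm m α ℓ j l x) :=
  H.enorm_defect_le l ht hx hgx (S.integrable_diff_mul l) (fun _ hi x => S.cellIntegral_diff hi x)
    (fun y hy => by rw [S.adapted_diff l y x hy])

/-- The level `l + 1` cell of a live point carries no jump, so there the compensated jump is just
`-comp * g`, a multiple of `g`. -/
lemma Admissible.enorm_defect_bad (H : S.Admissible k m α K Cμ ℓ D c₀) {j : ℕ} (l : ℕ)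
    {t : ℝ} (ht : t ∈ Ioc (ℓ / 2 ^ (j + 1)) (ℓ / 2 ^ j)) {x : EuclideanSpace ℝ (Fin n)}
    (hx : GoodAt S.toCellTree ℓ (α / (2 * (m + α))) c₀ j x) (hgx : S.gc j x ≠ 0)
    (hlive : ∀ l, S.Live l x) :
    ‖S.defect k j t x (S.bad l)‖ₑ ≤
      ENNReal.ofReal (coreC m α K Cμ D c₀) * (wt α j l * S.badTerm m α ℓ j l x) := by
  have := H.enorm_defect_le (a := -S.comp l x) l ht hx hgx (S.integrable_bad l)
    (fun _ hi x => S.cellIntegral_bad hi x) (fun y hy => by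
      have h1 : S.Live (l + 1) y := by
        rw [S.adapted_live (l + 1) y x hy]; exact hlive (l + 1)
      have h2 : y ∉ S.stopSet l := fun h => h.2 h1
      rw [bad, jump, if_neg h2, S.adapted_comp l y x (S.nested l y x hy)]
      ring)
  rwa [enorm_neg] at this

lemma defect_finset_sum (H : S.Admissible k m α K Cμ ℓ D c₀) {t : ℝ} (ht : 0 < t) (j : ℕ)
    (x : EuclideanSpace ℝ (Fin n)) {φ : ℕ → EuclideanSpace ℝ (Fin n) → ℂ}
    (hφ : ∀ l, Integrable (φ l) S.ρ) (N : ℕ) :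
    S.defect k j t x (fun y => ∑ l ∈ Finset.range N, φ l y) =
      ∑ l ∈ Finset.range N, S.defect k j t x (φ l) := by
  induction N with
  | zero => simp [defect]
  | succ N ih =>
    simp_rw [Finset.sum_range_succ]
    rw [H.defect_add ht j x (integrable_finsetSum _ fun l _ => hφ l) (hφ N), ih]

/-- The defect of `h` at a live point is controlled by the sum over the levels of the bounds for
the increments and for the compensated jumps. -/
lemma Admissible.enorm_defect_h_le (H : S.Admissible k m α K Cμ ℓ D c₀) {j : ℕ}
    {t : ℝ} (ht : t ∈ Ioc (ℓ / 2 ^ (j + 1)) (ℓ / 2 ^ j)) {x : EuclideanSpace ℝ (Fin n)}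
    (hx : GoodAt S.toCellTree ℓ (α / (2 * (m + α))) c₀ j x) (hgx : S.gc j x ≠ 0)
    (hlive : ∀ l, S.Live l x) :
    ‖S.defect k j t x S.h‖ₑ ≤
      ENNReal.ofReal (coreC m α K Cμ D c₀) * ∑' l, wt α j l * S.diffTerm m α ℓ j l x +
      ENNReal.ofReal (coreC m α K Cμ D c₀) * ∑' l, wt α j l * S.badTerm m α ℓ j l x := by
  have hℓ := H.ℓ_pos
  have ht0 : 0 < t := lt_trans (by positivity) ht.1
  set C := ENNReal.ofReal (coreC m α K Cμ D c₀) with hC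
  -- This function dominates `h - stopped N` in modulus for all `N`, so the Poisson average of the
  -- remainder is bounded uniformly in `N`.
  set φ₀ : EuclideanSpace ℝ (Fin n) → ℂ := fun y => ((2 * ‖S.h y‖ + S.A * S.g y : ℝ) : ℂ) with hφ₀
  have hφ₀i : Integrable φ₀ S.ρ :=
    ((S.integrable_h.norm.const_mul 2).add (S.integrable_g.const_mul S.A)).ofReal
  set B := poisson m α S.ρ (ℓ / 2 ^ j) φ₀ x with hB
  have hBtop : B ≠ ∞ := by
    refine ne_top_of_le_ne_top ?_
      (poisson_le_lintegral H.m_pos H.α_pos (by positivity : 0 < ℓ / 2 ^ j) φ₀ x)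
    exact ENNReal.mul_ne_top ENNReal.ofReal_ne_top hφ₀i.2.ne
  set φ : ℕ → EuclideanSpace ℝ (Fin n) → ℂ := fun l y => S.diff l y * S.g y + S.bad l y with hφ
  have hφi : ∀ l, Integrable (φ l) S.ρ := fun l => (S.integrable_diff_mul l).add (S.integrable_bad l)
  have hsum : ∀ N y, ∑ l ∈ Finset.range N, φ l y = S.stopped N y - S.stopped 0 y := by
    intro N y
    rw [← Finset.sum_range_sub (fun l => S.stopped l y)]
    exact Finset.sum_congr rfl fun l _ => (S.stopped_succ_sub l y).symm
  have hroot : ∀ y, S.stopped 0 y = S.avg 0 x * S.g y := fun y => by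
    have h1 : S.Live 0 y := by rw [S.adapted_live 0 y x (S.root y x)]; exact hlive 0
    rw [stopped, if_pos h1, S.adapted_avg 0 y x (S.root y x)]
  -- The first term is a multiple of `g` and has zero defect. The last has mean zero on all cells of
  -- level at most `N`.
  have hdec : ∀ N y, S.h y = (S.avg 0 x * S.g y + ∑ l ∈ Finset.range N, φ l y) +
      (S.h y - S.stopped N y) := by
    intro N y
    rw [hsum, hroot]; ring
  have hbound : ∀ N, j ≤ N → ‖S.defect k j t x S.h‖ₑ ≤
      C * ∑' l, wt α j l * S.diffTerm m α ℓ j l x + C * ∑' l, wt α j l * S.badTerm m α ℓ j l x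
        + C * (wt α j N * B) := by
    intro N hN
    have i0 : Integrable (fun y => S.avg 0 x * (S.g y : ℂ)) S.ρ := S.integrable_g.ofReal.const_mul _
    have i1 : Integrable (fun y => ∑ l ∈ Finset.range N, φ l y) S.ρ :=
      integrable_finsetSum _ fun l _ => hφi l
    have i01 : Integrable (fun y => S.avg 0 x * (S.g y : ℂ) + ∑ l ∈ Finset.range N, φ l y) S.ρ :=
      i0.add i1
    have i2 : Integrable (fun y => S.h y - S.stopped N y) S.ρ :=
      S.integrable_h.sub (S.integrable_stopped N)
    have e : S.defect k j t x S.h =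
        ∑ l ∈ Finset.range N, (S.defect k j t x (fun y => S.diff l y * S.g y) +
          S.defect k j t x (S.bad l)) + S.defect k j t x (fun y => S.h y - S.stopped N y) := by
      conv_lhs => rw [show S.h = fun y => (S.avg 0 x * S.g y + ∑ l ∈ Finset.range N, φ l y) +
        (S.h y - S.stopped N y) from funext (hdec N)]
      rw [H.defect_add ht0 j x i01 i2, H.defect_add ht0 j x i0 i1,
        defect_const_mul_g j t x _ hgx, zero_add, defect_finset_sum H ht0 j x hφi]
      congr 1
      exact Finset.sum_congr rfl fun l _ =>
        H.defect_add ht0 j x (S.integrable_diff_mul l) (S.integrable_bad l)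
    rw [e]
    refine (enorm_add_le _ _).trans (add_le_add ?_ ?_)
    · refine (enorm_sum_le _ _).trans ?_
      calc ∑ l ∈ Finset.range N, ‖S.defect k j t x (fun y => S.diff l y * S.g y) +
            S.defect k j t x (S.bad l)‖ₑ
          ≤ ∑ l ∈ Finset.range N, (C * (wt α j l * S.diffTerm m α ℓ j l x) +
            C * (wt α j l * S.badTerm m α ℓ j l x)) :=
            Finset.sum_le_sum fun l _ => (enorm_add_le _ _).trans
              (add_le_add (H.enorm_defect_diff l ht hx hgx)
                (H.enorm_defect_bad l ht hx hgx hlive))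
        _ ≤ ∑' l, (C * (wt α j l * S.diffTerm m α ℓ j l x) +
            C * (wt α j l * S.badTerm m α ℓ j l x)) := ENNReal.sum_le_tsum _
        _ = _ := by rw [ENNReal.tsum_add, ENNReal.tsum_mul_left, ENNReal.tsum_mul_left]
    · refine (H.enorm_defect_near hN ht x i2 fun i hi z => ?_).trans ?_
      · have h1 := S.cellIntegral_stopped_sub hi z
        rw [← neg_eq_zero, ← integral_neg, ← h1]
        congr 1; funext y; ring
      · rw [← hC]
        gcongr
        rw [hB]; unfold poisson
        refine lintegral_mono fun y => ?_
        gcongr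
        rw [← ofReal_norm, ← ofReal_norm]
        refine ENNReal.ofReal_le_ofReal ?_
        have hg := mul_nonneg S.A_nonneg (S.g_nonneg y)
        rw [hφ₀]; simp only
        rw [Complex.norm_real, Real.norm_of_nonneg (by positivity)]
        refine (norm_sub_le _ _).trans ?_
        linarith [S.norm_stopped_le N y]
  -- The remainder disappears because its weight `wt α j N` tends to zero; no convergence of the
  -- stopped martingale is needed.
  have hlim : Filter.Tendsto (fun N => C * ∑' l, wt α j l * S.diffTerm m α ℓ j l x +
      C * ∑' l, wt α j l * S.badTerm m α ℓ j l x + C * (wt α j N * B)) Filter.atTop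
      (nhds (C * ∑' l, wt α j l * S.diffTerm m α ℓ j l x +
        C * ∑' l, wt α j l * S.badTerm m α ℓ j l x + C * (0 * B))) := by
    have hw : Filter.Tendsto (fun N => wt α j N) Filter.atTop (nhds 0) :=
      ENNReal.tendsto_atTop_zero_of_tsum_ne_top
        (ne_top_of_le_ne_top (wtC_ne_top H.α_pos) (tsum_wt_le α j))
    refine tendsto_const_nhds.add (ENNReal.Tendsto.const_mul ?_ (Or.inr ENNReal.ofReal_ne_top))
    exact ENNReal.Tendsto.mul_const hw (Or.inr hBtop)
  rw [zero_mul, mul_zero, add_zero] at hlim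
  exact ge_of_tendsto hlim (Filter.eventually_atTop.2 ⟨j, hbound⟩)

/-- Averaging against `pk` is bounded on `L²(gρ)`: Cauchy–Schwarz uses the mass of `pk` in one
variable and Fubini its mass in the other. -/
lemma lintegral_diffTerm_sq_le (H : S.Admissible k m α K Cμ ℓ D c₀) (j l : ℕ) :
    ∫⁻ x, S.diffTerm m α ℓ j l x ^ 2 ∂S.μ ≤
      (2 * ENNReal.ofReal (pkC m α Cμ) ^ 2 + 2) * ∫⁻ x, ‖S.diff l x‖ₑ ^ 2 ∂S.μ := by
  have hℓ := H.ℓ_pos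
  set s := ℓ / 2 ^ (min j l) with hs
  have hs0 : 0 < s := by positivity
  set P := ENNReal.ofReal (pkC m α Cμ) with hP
  have hdm : Measurable (fun y => ‖S.diff l y‖ₑ) := (S.adapted_diff l).measurable.enorm
  have h1 : ∀ x, poisson m α S.ρ s (fun y => S.diff l y * S.g y) x =
      ∫⁻ y, ENNReal.ofReal (pk m α s ‖x - y‖) * ‖S.diff l y‖ₑ ∂S.μ := by
    intro x
    rw [S.lintegral_μ, poisson]
    refine lintegral_congr fun y => ?_
    rw [enorm_mul, ← ofReal_norm (S.g y : ℂ), Complex.norm_real,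
      Real.norm_of_nonneg (S.g_nonneg y)]
    ring
  have h2 : ∀ x, poisson m α S.ρ s (fun y => S.diff l y * S.g y) x ^ 2 ≤
      P * poisson m α S.μ s (fun y => ((‖S.diff l y‖ ^ 2 : ℝ) : ℂ)) x := by
    intro x
    rw [h1]
    refine (sq_lintegral_mul_le _ (measurable_pk_norm_right m α s x) hdm).trans ?_
    refine mul_le_mul' (lintegral_pk_le H.m_pos H.α_pos H.order hs0 x) (le_of_eq ?_)
    unfold poisson
    refine lintegral_congr fun y => ?_
    congr 1
    rw [← ofReal_norm ((‖S.diff l y‖ ^ 2 : ℝ) : ℂ), Complex.norm_real,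
      Real.norm_of_nonneg (by positivity), ENNReal.ofReal_pow (norm_nonneg _), ofReal_norm]
  have hm2 : Measurable (fun y => ((‖S.diff l y‖ ^ 2 : ℝ) : ℂ)) :=
    Complex.measurable_ofReal.comp ((S.adapted_diff l).measurable.norm.pow_const 2)
  have h3 : ∫⁻ x, poisson m α S.ρ s (fun y => S.diff l y * S.g y) x ^ 2 ∂S.μ ≤
      P ^ 2 * ∫⁻ x, ‖S.diff l x‖ₑ ^ 2 ∂S.μ := by
    refine (lintegral_mono h2).trans ?_
    rw [lintegral_const_mul' _ _ ENNReal.ofReal_ne_top, sq, mul_assoc]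
    gcongr
    refine (lintegral_poisson_le H.m_pos H.α_pos H.order hs0 hm2).trans (le_of_eq ?_)
    congr 1
    refine lintegral_congr fun y => ?_
    rw [← ofReal_norm ((‖S.diff l y‖ ^ 2 : ℝ) : ℂ), Complex.norm_real,
      Real.norm_of_nonneg (by positivity), ENNReal.ofReal_pow (norm_nonneg _), ofReal_norm]
  calc ∫⁻ x, S.diffTerm m α ℓ j l x ^ 2 ∂S.μ
      ≤ ∫⁻ x, (2 * poisson m α S.ρ s (fun y => S.diff l y * S.g y) x ^ 2 +
          2 * ‖S.diff l x‖ₑ ^ 2) ∂S.μ := lintegral_mono fun x => ennreal_add_sq_le _ _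
    _ = 2 * ∫⁻ x, poisson m α S.ρ s (fun y => S.diff l y * S.g y) x ^ 2 ∂S.μ +
          2 * ∫⁻ x, ‖S.diff l x‖ₑ ^ 2 ∂S.μ := by
        rw [lintegral_add_right _ ((hdm.pow_const 2).const_mul 2),
          lintegral_const_mul' _ _ (by norm_num), lintegral_const_mul' _ _ (by norm_num)]
    _ ≤ 2 * (P ^ 2 * ∫⁻ x, ‖S.diff l x‖ₑ ^ 2 ∂S.μ) + 2 * ∫⁻ x, ‖S.diff l x‖ₑ ^ 2 ∂S.μ := by
        gcongr
    _ = _ := by ring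

/-- Schur's test in the pair of levels: Cauchy–Schwarz in `l` with the weights costs one sum of
weights, and exchanging the sums and adding over `j` costs another. -/
lemma lintegral_tsum_sq_diffTerm_le (H : S.Admissible k m α K Cμ ℓ D c₀) :
    ∫⁻ x, ∑' j, (∑' l, wt α j l * S.diffTerm m α ℓ j l x) ^ 2 ∂S.μ ≤
      wtC α ^ 2 * (2 * ENNReal.ofReal (pkC m α Cμ) ^ 2 + 2) *
        ∑' l, ∫⁻ x, ‖S.diff l x‖ₑ ^ 2 ∂S.μ := by
  have hw := wtC_ne_top H.α_pos
  have hmeas : ∀ j l, Measurable (fun x => wt α j l * S.diffTerm m α ℓ j l x ^ 2) := fun j l =>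
    ((S.measurable_diffTerm m α ℓ j l).pow_const 2).const_mul _
  set P := 2 * ENNReal.ofReal (pkC m α Cμ) ^ 2 + 2 with hP
  calc ∫⁻ x, ∑' j, (∑' l, wt α j l * S.diffTerm m α ℓ j l x) ^ 2 ∂S.μ
      ≤ ∫⁻ x, ∑' j, wtC α * ∑' l, wt α j l * S.diffTerm m α ℓ j l x ^ 2 ∂S.μ := by
        refine lintegral_mono fun x => ENNReal.tsum_le_tsum fun j => ?_
        refine (sq_tsum_mul_le _ _).trans ?_
        gcongr
        exact tsum_wt_le α j
    _ = wtC α * ∑' j, ∑' l, wt α j l * ∫⁻ x, S.diffTerm m α ℓ j l x ^ 2 ∂S.μ := by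
        simp_rw [ENNReal.tsum_mul_left]
        rw [lintegral_const_mul' _ _ hw, lintegral_tsum fun j =>
          (Measurable.tsum fun l => hmeas j l).aemeasurable]
        congr 2; funext j
        rw [lintegral_tsum fun l => (hmeas j l).aemeasurable]
        congr 1; funext l
        rw [lintegral_const_mul _ ((S.measurable_diffTerm m α ℓ j l).pow_const 2)]
    _ ≤ wtC α * ∑' j, ∑' l, wt α j l * (P * ∫⁻ x, ‖S.diff l x‖ₑ ^ 2 ∂S.μ) := by
        gcongr with j l
        exact lintegral_diffTerm_sq_le H j l
    _ = wtC α * ∑' l, (∑' j, wt α l j) * (P * ∫⁻ x, ‖S.diff l x‖ₑ ^ 2 ∂S.μ) := by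
        rw [ENNReal.tsum_comm]
        simp_rw [ENNReal.tsum_mul_right, fun j l => wt_comm α j l]
    _ ≤ wtC α * ∑' l, wtC α * (P * ∫⁻ x, ‖S.diff l x‖ₑ ^ 2 ∂S.μ) := by
        gcongr with l
        exact tsum_wt_le α l
    _ = _ := by rw [ENNReal.tsum_mul_left, ENNReal.tsum_mul_left]; ring

/-- The compensated jumps are controlled in `L¹` only, so they are summed without squares. -/
lemma lintegral_tsum_badTerm_le (H : S.Admissible k m α K Cμ ℓ D c₀) :
    ∫⁻ x, ∑' j, ∑' l, wt α j l * S.badTerm m α ℓ j l x ∂S.μ ≤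
      wtC α * ∑' l, (ENNReal.ofReal (pkC m α Cμ) * ∫⁻ x, ‖S.bad l x‖ₑ ∂S.ρ +
        ∫⁻ x, ‖S.comp l x‖ₑ ∂S.μ) := by
  have hℓ := H.ℓ_pos
  have hmeas : ∀ j l, Measurable (fun x => wt α j l * S.badTerm m α ℓ j l x) := fun j l =>
    (S.measurable_badTerm m α ℓ j l).const_mul _
  set I : ℕ → ℝ≥0∞ := fun l => ENNReal.ofReal (pkC m α Cμ) * ∫⁻ x, ‖S.bad l x‖ₑ ∂S.ρ +
    ∫⁻ x, ‖S.comp l x‖ₑ ∂S.μ with hI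
  calc ∫⁻ x, ∑' j, ∑' l, wt α j l * S.badTerm m α ℓ j l x ∂S.μ
      = ∑' j, ∑' l, wt α j l * ∫⁻ x, S.badTerm m α ℓ j l x ∂S.μ := by
        rw [lintegral_tsum fun j =>
          (Measurable.tsum fun l => hmeas j l).aemeasurable]
        congr 1; funext j
        rw [lintegral_tsum fun l => (hmeas j l).aemeasurable]
        congr 1; funext l
        rw [lintegral_const_mul _ (S.measurable_badTerm m α ℓ j l)]
    _ ≤ ∑' j, ∑' l, wt α j l * I l := by
        gcongr with j l
        unfold badTerm
        rw [lintegral_add_right _ (S.adapted_comp l).measurable.enorm]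
        refine add_le_add ?_ le_rfl
        exact lintegral_poisson_le H.m_pos H.α_pos H.order (by positivity) (S.measurable_bad l)
    _ = ∑' l, (∑' j, wt α l j) * I l := by
        rw [ENNReal.tsum_comm]
        simp_rw [ENNReal.tsum_mul_right, fun j l => wt_comm α j l]
    _ ≤ ∑' l, wtC α * I l := by
        gcongr with l
        exact tsum_wt_le α l
    _ = _ := by rw [ENNReal.tsum_mul_left]

end StoppedPair

/-! ### The square function of the defect and its two majorants. -/

variable {n : ℕ} {ι : Type*} [MeasurableSpace ι]

lemma ennreal_tsum_sq_le (a : ℕ → ℝ≥0∞) : ∑' i, a i ^ 2 ≤ (∑' i, a i) ^ 2 := by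
  rw [sq (∑' i, a i), ← ENNReal.tsum_mul_right]
  refine ENNReal.tsum_le_tsum fun i => ?_
  rw [sq]
  gcongr
  exact ENNReal.le_tsum i

lemma ennreal_tsum_le_of_sum_range_le {a : ℕ → ℝ≥0∞} {b : ℝ≥0∞}
    (h : ∀ N, ∑ i ∈ Finset.range N, a i ≤ b) : ∑' i, a i ≤ b := by
  rw [ENNReal.tsum_eq_iSup_nat]
  exact iSup_le h

/-- On this interval `1/t` is at most `2/a`, while the length is `a/2`, so the constant is `1`. -/
lemma lintegral_Ioc_div_le {a : ℝ} (ha : 0 < a) {F : ℝ → ℝ≥0∞} {M : ℝ≥0∞}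
    (hF : ∀ t ∈ Ioc (a / 2) a, F t ≤ M) :
    ∫⁻ t in Ioc (a / 2) a, F t / ENNReal.ofReal t ≤ M := by
  have h1 : ∀ t ∈ Ioc (a / 2) a, F t / ENNReal.ofReal t ≤ M / ENNReal.ofReal (a / 2) := by
    intro t ht
    exact ENNReal.div_le_div (hF t ht) (ENNReal.ofReal_le_ofReal ht.1.le)
  refine (setLIntegral_mono measurable_const h1).trans ?_
  rw [setLIntegral_const, Real.volume_Ioc, show a - a / 2 = a / 2 by ring]
  refine (ENNReal.div_mul_cancel ?_ ENNReal.ofReal_ne_top).le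
  simpa using ha

namespace StoppedPair

/-- The square of the vertical square function of the defect over one dyadic range of scales. -/
def defectSq (S : StoppedPair (EuclideanSpace ℝ (Fin n)) ι)
    (k : ℝ → EuclideanSpace ℝ (Fin n) → EuclideanSpace ℝ (Fin n) → ℂ) (ℓ : ℝ) (j : ℕ)
    (x : EuclideanSpace ℝ (Fin n)) : ℝ≥0∞ :=
  ∫⁻ t in Ioc (ℓ / 2 ^ (j + 1)) (ℓ / 2 ^ j), ‖S.defect k j t x S.h‖ₑ ^ 2 / ENNReal.ofReal t

/-- The square-summed bound that comes from the increments. -/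
def diffMajorant (S : StoppedPair (EuclideanSpace ℝ (Fin n)) ι) (m α : ℝ) (K Cμ : ℝ≥0)
    (ℓ D c₀ : ℝ) (x : EuclideanSpace ℝ (Fin n)) : ℝ≥0∞ :=
  ENNReal.ofReal (coreC m α K Cμ D c₀) ^ 2 *
    ∑' j, (∑' l, wt α j l * S.diffTerm m α ℓ j l x) ^ 2

/-- The summed bound that comes from the compensated jumps. -/
def badMajorant (S : StoppedPair (EuclideanSpace ℝ (Fin n)) ι) (m α : ℝ) (K Cμ : ℝ≥0)
    (ℓ D c₀ : ℝ) (x : EuclideanSpace ℝ (Fin n)) : ℝ≥0∞ :=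
  ENNReal.ofReal (coreC m α K Cμ D c₀) *
    ∑' j, ∑' l, wt α j l * S.badTerm m α ℓ j l x

variable {S : StoppedPair (EuclideanSpace ℝ (Fin n)) ι}
  {k : ℝ → EuclideanSpace ℝ (Fin n) → EuclideanSpace ℝ (Fin n) → ℂ} {m α : ℝ} {K Cμ : ℝ≥0}
  {ℓ D c₀ : ℝ}

variable [Countable ι] [MeasurableSingletonClass ι]

lemma Admissible.defectSq_le (H : S.Admissible k m α K Cμ ℓ D c₀) {j : ℕ}
    {x : EuclideanSpace ℝ (Fin n)}
    (hx : GoodAt S.toCellTree ℓ (α / (2 * (m + α))) c₀ j x) (hgx : S.gc j x ≠ 0)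
    (hlive : ∀ l, S.Live l x) :
    S.defectSq k ℓ j x ≤
      (ENNReal.ofReal (coreC m α K Cμ D c₀) * ∑' l, wt α j l * S.diffTerm m α ℓ j l x +
        ENNReal.ofReal (coreC m α K Cμ D c₀) * ∑' l, wt α j l * S.badTerm m α ℓ j l x) ^ 2 := by
  have hℓ := H.ℓ_pos
  have e : ℓ / 2 ^ (j + 1) = ℓ / 2 ^ j / 2 := by rw [pow_succ, div_div]
  unfold defectSq
  rw [e]
  refine lintegral_Ioc_div_le (by positivity) fun t ht => ?_
  rw [← e] at ht
  gcongr
  exact H.enorm_defect_h_le ht hx hgx hlive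

/-- The square function of the defect, summed over the scales at which `x` is good, is controlled
by the two majorants. -/
lemma Admissible.tsum_defectSq_le (H : S.Admissible k m α K Cμ ℓ D c₀)
    {x : EuclideanSpace ℝ (Fin n)} (hgx : ∀ j, S.gc j x ≠ 0) (hlive : ∀ l, S.Live l x)
    {p : ℕ → ℝ≥0∞} (hp1 : ∀ j, p j ≤ 1)
    (hp : ∀ j, p j ≠ 0 → GoodAt S.toCellTree ℓ (α / (2 * (m + α))) c₀ j x) :
    ∑' j, p j * S.defectSq k ℓ j x ≤
      2 * S.diffMajorant m α K Cμ ℓ D c₀ x + 2 * S.badMajorant m α K Cμ ℓ D c₀ x ^ 2 := by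
  set C := ENNReal.ofReal (coreC m α K Cμ D c₀) with hC
  calc ∑' j, p j * S.defectSq k ℓ j x
      ≤ ∑' j, (2 * (C * ∑' l, wt α j l * S.diffTerm m α ℓ j l x) ^ 2 +
          2 * (C * ∑' l, wt α j l * S.badTerm m α ℓ j l x) ^ 2) := by
        refine ENNReal.tsum_le_tsum fun j => ?_
        by_cases hj : p j = 0
        · simp [hj]
        · refine (mul_le_of_le_one_left' (hp1 j)).trans ?_
          exact (H.defectSq_le (hp j hj) (hgx j) hlive).trans (ennreal_add_sq_le _ _)
    _ = 2 * ∑' j, (C * ∑' l, wt α j l * S.diffTerm m α ℓ j l x) ^ 2 +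
          2 * ∑' j, (C * ∑' l, wt α j l * S.badTerm m α ℓ j l x) ^ 2 := by
        rw [ENNReal.tsum_add, ENNReal.tsum_mul_left, ENNReal.tsum_mul_left]
    _ ≤ _ := by
        unfold diffMajorant badMajorant
        refine add_le_add (le_of_eq ?_) ?_
        · simp_rw [mul_pow]; rw [ENNReal.tsum_mul_left]
        · gcongr
          -- The inclusion of `ℓ¹` in `ℓ²` turns the square sum over scales into the square of the
          -- sum, whose integral is under control.
          refine (ennreal_tsum_sq_le _).trans (le_of_eq ?_)
          rw [ENNReal.tsum_mul_left]

lemma lintegral_diff_sq (S : StoppedPair (EuclideanSpace ℝ (Fin n)) ι) (l : ℕ) :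
    ∫⁻ x, ‖S.diff l x‖ₑ ^ 2 ∂S.μ = ENNReal.ofReal (∫ x, ‖S.diff l x‖ ^ 2 * S.g x ∂S.ρ) := by
  have hi : Integrable (fun x => ‖S.diff l x‖ ^ 2 * S.g x) S.ρ :=
    S.integrable_adapted_mul (l := l + 1) ((S.adapted_diff l).comp (fun a => ‖a‖ ^ 2))
      (C := (4 * S.A) ^ 2) (fun x => by
        rw [norm_pow, norm_norm]
        exact pow_le_pow_left₀ (norm_nonneg _) (S.norm_diff_le l x) 2) S.integrable_g
  rw [S.lintegral_μ, ofReal_integral_eq_lintegral_ofReal hi (Filter.Eventually.of_forall fun x =>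
    mul_nonneg (by positivity) (S.g_nonneg x))]
  refine lintegral_congr fun x => ?_
  rw [ENNReal.ofReal_mul (by positivity), ENNReal.ofReal_pow (norm_nonneg _), ofReal_norm, mul_comm]

lemma tsum_lintegral_diff_sq_le (S : StoppedPair (EuclideanSpace ℝ (Fin n)) ι) {b : ℝ}
    (h : ∀ N, ∑ l ∈ Finset.range N, ∫ x, ‖S.diff l x‖ ^ 2 * S.g x ∂S.ρ ≤ b) :
    ∑' l, ∫⁻ x, ‖S.diff l x‖ₑ ^ 2 ∂S.μ ≤ ENNReal.ofReal b := by
  refine ennreal_tsum_le_of_sum_range_le fun N => ?_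
  simp_rw [lintegral_diff_sq]
  rw [← ENNReal.ofReal_sum_of_nonneg fun l _ => integral_nonneg fun x =>
    mul_nonneg (by positivity) (S.g_nonneg x)]
  exact ENNReal.ofReal_le_ofReal (h N)

/-- The constant in the energy bound for the increments. -/
def energyC (m α : ℝ) (K Cμ : ℝ≥0) (D c₀ : ℝ) : ℝ≥0∞ :=
  ENNReal.ofReal (coreC m α K Cμ D c₀) ^ 2 *
    (wtC α ^ 2 * (2 * ENNReal.ofReal (pkC m α Cμ) ^ 2 + 2))

lemma energyC_ne_top (hα : 0 < α) : energyC m α K Cμ D c₀ ≠ ∞ :=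
  ENNReal.mul_ne_top (ENNReal.pow_ne_top ENNReal.ofReal_ne_top)
    (ENNReal.mul_ne_top (ENNReal.pow_ne_top (wtC_ne_top hα))
      (ENNReal.add_ne_top.2 ⟨ENNReal.mul_ne_top (by norm_num)
        (ENNReal.pow_ne_top ENNReal.ofReal_ne_top), by norm_num⟩))

lemma lintegral_diffMajorant_le (H : S.Admissible k m α K Cμ ℓ D c₀) {b : ℝ}
    (h : ∀ N, ∑ l ∈ Finset.range N, ∫ x, ‖S.diff l x‖ ^ 2 * S.g x ∂S.ρ ≤ b) :
    ∫⁻ x, S.diffMajorant m α K Cμ ℓ D c₀ x ∂S.μ ≤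
      energyC m α K Cμ D c₀ * ENNReal.ofReal b := by
  unfold diffMajorant energyC
  rw [lintegral_const_mul' _ _ (ENNReal.pow_ne_top ENNReal.ofReal_ne_top), mul_assoc]
  gcongr
  refine (lintegral_tsum_sq_diffTerm_le H).trans ?_
  gcongr
  exact S.tsum_lintegral_diff_sq_le h

/-- The constant in the mass bound for the compensated jumps. -/
def massC (m α : ℝ) (K Cμ : ℝ≥0) (D c₀ : ℝ) : ℝ≥0∞ :=
  ENNReal.ofReal (coreC m α K Cμ D c₀) *
    (wtC α * (ENNReal.ofReal (pkC m α Cμ) * 4 + 2))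

lemma massC_ne_top (hα : 0 < α) : massC m α K Cμ D c₀ ≠ ∞ :=
  ENNReal.mul_ne_top ENNReal.ofReal_ne_top
    (ENNReal.mul_ne_top (wtC_ne_top hα)
      (ENNReal.add_ne_top.2 ⟨ENNReal.mul_ne_top ENNReal.ofReal_ne_top (by norm_num), by norm_num⟩))

lemma lintegral_bad_le (S : StoppedPair (EuclideanSpace ℝ (Fin n)) ι) (l : ℕ) :
    ∫⁻ x, ‖S.bad l x‖ₑ ∂S.ρ ≤ 4 * ENNReal.ofReal (S.stopMass l) := by
  rw [← ofReal_integral_norm_eq_lintegral_enorm (S.integrable_bad l), ← ENNReal.ofReal_ofNat 4,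
    ← ENNReal.ofReal_mul (by norm_num)]
  exact ENNReal.ofReal_le_ofReal (S.integral_norm_bad_le l)

lemma lintegral_comp_le (S : StoppedPair (EuclideanSpace ℝ (Fin n)) ι) (l : ℕ) :
    ∫⁻ x, ‖S.comp l x‖ₑ ∂S.μ ≤ 2 * ENNReal.ofReal (S.stopMass l) := by
  have hi : Integrable (fun y => ‖S.comp l y‖ * S.g y) S.ρ :=
    S.integrable_adapted_mul (l := l) ((S.adapted_comp l).comp norm)
      (fun x => by rw [norm_norm]; exact S.norm_comp_le l x) S.integrable_g
  have e : ∫⁻ x, ‖S.comp l x‖ₑ ∂S.μ = ENNReal.ofReal (∫ y, ‖S.comp l y‖ * S.g y ∂S.ρ) := by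
    rw [S.lintegral_μ, ofReal_integral_eq_lintegral_ofReal hi (Filter.Eventually.of_forall fun x =>
      mul_nonneg (by positivity) (S.g_nonneg x))]
    refine lintegral_congr fun x => ?_
    rw [ENNReal.ofReal_mul (by positivity), ofReal_norm, mul_comm]
  refine (e.le.trans (ENNReal.ofReal_le_ofReal (S.integral_norm_comp_le l))).trans (le_of_eq ?_)
  rw [ENNReal.ofReal_mul (by norm_num), ENNReal.ofReal_ofNat]

lemma tsum_stopMass_le (S : StoppedPair (EuclideanSpace ℝ (Fin n)) ι) :
    ∑' l, ENNReal.ofReal (S.stopMass l) ≤ ENNReal.ofReal (∫ x, ‖S.h x‖ ∂S.ρ) := by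
  refine ennreal_tsum_le_of_sum_range_le fun N => ?_
  rw [← ENNReal.ofReal_sum_of_nonneg fun l _ => S.stopMass_nonneg l]
  exact ENNReal.ofReal_le_ofReal (S.sum_stopMass_le N)

lemma lintegral_badMajorant_le (H : S.Admissible k m α K Cμ ℓ D c₀) :
    ∫⁻ x, S.badMajorant m α K Cμ ℓ D c₀ x ∂S.μ ≤
      massC m α K Cμ D c₀ * ENNReal.ofReal (∫ x, ‖S.h x‖ ∂S.ρ) := by
  unfold badMajorant massC
  rw [lintegral_const_mul' _ _ ENNReal.ofReal_ne_top, mul_assoc]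
  gcongr
  refine (lintegral_tsum_badTerm_le H).trans ?_
  rw [mul_assoc]
  gcongr
  calc ∑' l, (ENNReal.ofReal (pkC m α Cμ) * ∫⁻ x, ‖S.bad l x‖ₑ ∂S.ρ + ∫⁻ x, ‖S.comp l x‖ₑ ∂S.μ)
      ≤ ∑' l, (ENNReal.ofReal (pkC m α Cμ) * (4 * ENNReal.ofReal (S.stopMass l)) +
          2 * ENNReal.ofReal (S.stopMass l)) := by
        refine ENNReal.tsum_le_tsum fun l => ?_
        gcongr
        · exact S.lintegral_bad_le l
        · exact S.lintegral_comp_le l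
    _ = (ENNReal.ofReal (pkC m α Cμ) * 4 + 2) * ∑' l, ENNReal.ofReal (S.stopMass l) := by
        rw [← ENNReal.tsum_mul_left]
        congr 1; funext l; ring
    _ ≤ _ := by
        gcongr
        exact S.tsum_stopMass_le

lemma measurable_diffMajorant : Measurable (S.diffMajorant m α K Cμ ℓ D c₀) :=
  (Measurable.tsum fun j => (Measurable.tsum fun l =>
    (S.measurable_diffTerm m α ℓ j l).const_mul _).pow_const 2).const_mul _

lemma measurable_badMajorant : Measurable (S.badMajorant m α K Cμ ℓ D c₀) :=
  (Measurable.tsum fun j => Measurable.tsum fun l =>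
    (S.measurable_badTerm m α ℓ j l).const_mul _).const_mul _

/-- The set on which the majorants are large has small measure. -/
lemma measure_majorant_gt_le (H : S.Admissible k m α K Cμ ℓ D c₀) {Λ : ℝ} (hΛ : 1 ≤ Λ) :
    S.μ {x | ENNReal.ofReal (4 * Λ ^ 2) < 2 * S.diffMajorant m α K Cμ ℓ D c₀ x +
      2 * S.badMajorant m α K Cμ ℓ D c₀ x ^ 2} ≤
      (energyC m α K Cμ D c₀ * ENNReal.ofReal (14 * S.A) + massC m α K Cμ D c₀) *
        ENNReal.ofReal (∫ x, ‖S.h x‖ ∂S.ρ) / ENNReal.ofReal Λ := by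
  have hΛ0 : 0 < Λ := by linarith
  have hne : ENNReal.ofReal Λ ≠ 0 := by simpa using hΛ0
  set M := ENNReal.ofReal (∫ x, ‖S.h x‖ ∂S.ρ) with hM
  -- If both majorants are below `Λ`, the sum is at most `2Λ + 2Λ² ≤ 4Λ²`, as `Λ ≥ 1`.
  have hsub : {x | ENNReal.ofReal (4 * Λ ^ 2) < 2 * S.diffMajorant m α K Cμ ℓ D c₀ x +
      2 * S.badMajorant m α K Cμ ℓ D c₀ x ^ 2} ⊆
      {x | ENNReal.ofReal Λ ≤ S.diffMajorant m α K Cμ ℓ D c₀ x} ∪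
      {x | ENNReal.ofReal Λ ≤ S.badMajorant m α K Cμ ℓ D c₀ x} := by
    intro x hx
    by_contra hcon
    simp only [mem_union, mem_ofPred_eq, not_or, not_le] at hcon hx
    refine absurd hx (not_lt.2 ?_)
    calc 2 * S.diffMajorant m α K Cμ ℓ D c₀ x + 2 * S.badMajorant m α K Cμ ℓ D c₀ x ^ 2
        ≤ 2 * ENNReal.ofReal Λ + 2 * ENNReal.ofReal Λ ^ 2 := by
          gcongr
          · exact hcon.1.le
          · exact hcon.2.le
      _ = ENNReal.ofReal (2 * Λ + 2 * Λ ^ 2) := by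
          rw [ENNReal.ofReal_add (by positivity) (by positivity), ENNReal.ofReal_mul (by norm_num),
            ENNReal.ofReal_mul (by norm_num), ENNReal.ofReal_pow hΛ0.le, ENNReal.ofReal_ofNat]
      _ ≤ _ := ENNReal.ofReal_le_ofReal (by nlinarith)
  refine (measure_mono hsub).trans ((measure_union_le _ _).trans ?_)
  have h1 := meas_ge_le_lintegral_div (μ := S.μ)
    (S.measurable_diffMajorant (m := m) (α := α) (K := K) (Cμ := Cμ) (ℓ := ℓ) (D := D)
      (c₀ := c₀)).aemeasurable hne ENNReal.ofReal_ne_top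
  have h2 := meas_ge_le_lintegral_div (μ := S.μ)
    (S.measurable_badMajorant (m := m) (α := α) (K := K) (Cμ := Cμ) (ℓ := ℓ) (D := D)
      (c₀ := c₀)).aemeasurable hne ENNReal.ofReal_ne_top
  have h3 := lintegral_diffMajorant_le H S.sum_integral_norm_diff_sq_le_mass
  have h4 := lintegral_badMajorant_le H
  calc _ ≤ _ := add_le_add h1 h2
    _ ≤ (energyC m α K Cμ D c₀ * ENNReal.ofReal (14 * S.A * ∫ x, ‖S.h x‖ ∂S.ρ)) /
          ENNReal.ofReal Λ + (massC m α K Cμ D c₀ * M) / ENNReal.ofReal Λ := by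
        gcongr
    _ = _ := by
        have := S.A_nonneg
        rw [ENNReal.ofReal_mul (by positivity), ← ENNReal.add_div]
        congr 1; ring

end StoppedPair

/-! ### Size of the stopped cells and of the cells with small average. -/

namespace StoppedPair

open CellTree

variable {X : Type*} [MeasurableSpace X] {S : StoppedPair X ι}
  [Countable ι] [MeasurableSingletonClass ι]

lemma μ_apply (S : StoppedPair X ι) {E : Set X} (hE : MeasurableSet E) :
    S.μ E = ENNReal.ofReal (∫ x in E, S.g x ∂S.ρ) := by
  rw [μ, withDensity_apply _ hE, ofReal_integral_eq_lintegral_ofReal S.integrable_g.integrableOn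
    (Filter.Eventually.of_forall S.g_nonneg)]

/-- The points lying in a stopped cell have small measure. -/
lemma mul_measure_not_live_le (h0 : ∀ x, S.Live 0 x) :
    ENNReal.ofReal S.A * S.μ {x | ¬ ∀ l, S.Live l x} ≤ ENNReal.ofReal (∫ x, ‖S.h x‖ ∂S.ρ) := by
  have hsub : {x | ¬ ∀ l, S.Live l x} ⊆ ⋃ l, S.stopSet l := by
    classical
    intro x hx
    simp only [mem_ofPred_eq, not_forall] at hx
    -- The first level that is not live is positive, since the root is live.
    have h1 := Nat.find_spec hx
    obtain ⟨l, hl⟩ : ∃ l, Nat.find hx = l + 1 :=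
      Nat.exists_eq_succ_of_ne_zero fun h => by rw [h] at h1; exact h1 (h0 x)
    refine mem_iUnion.2 ⟨l, ?_, by rw [← hl]; exact h1⟩
    exact not_not.1 (Nat.find_min hx (by omega : l < Nat.find hx))
  calc ENNReal.ofReal S.A * S.μ {x | ¬ ∀ l, S.Live l x}
      ≤ ENNReal.ofReal S.A * ∑' l, S.μ (S.stopSet l) := by
        gcongr
        exact (measure_mono hsub).trans (measure_iUnion_le _)
    _ = ∑' l, ENNReal.ofReal (S.A * ∫ x in S.stopSet l, S.g x ∂S.ρ) := by
        rw [← ENNReal.tsum_mul_left]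
        congr 1; funext l
        rw [μ_apply S (S.measurableSet_stopSet l), ENNReal.ofReal_mul S.A_nonneg]
    _ ≤ ENNReal.ofReal (∫ x, ‖S.h x‖ ∂S.ρ) := by
        rw [ENNReal.tsum_eq_iSup_nat]
        refine iSup_le fun N => ?_
        rw [← ENNReal.ofReal_sum_of_nonneg fun l _ => mul_nonneg S.A_nonneg
          (integral_nonneg fun x => S.g_nonneg x)]
        exact ENNReal.ofReal_le_ofReal ((Finset.sum_le_sum fun l _ =>
          S.mul_setIntegral_g_stopSet_le l).trans (S.sum_stopMass_le N))

/-- The points lying in a cell on which the mean of `h` is small. -/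
def smallSet (S : StoppedPair X ι) (η : ℝ) : Set X := {x | ∃ i, ‖S.hc i x‖ ≤ η * S.gc i x}

lemma measurableSet_smallSet (S : StoppedPair X ι) (η : ℝ) : MeasurableSet (S.smallSet η) := by
  have : S.smallSet η = ⋃ i, {x | ‖S.hc i x‖ ≤ η * S.gc i x} := by ext x; simp [smallSet]
  rw [this]
  exact MeasurableSet.iUnion fun i => measurableSet_le (S.adapted_hc i).measurable.norm
    ((S.adapted_gc i).measurable.const_mul _)

lemma norm_setIntegral_le_of_adapted {i : ℕ} {E : Set X} {η : ℝ}
    (hE : S.Adapted i (fun x => x ∈ E)) (h : ∀ x ∈ E, ‖S.hc i x‖ ≤ η * S.gc i x) :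
    ‖∫ x in E, S.h x ∂S.ρ‖ ≤ ∫ x in E, η * S.g x ∂S.ρ := by
  have hm : MeasurableSet E := hE.measurableSet
  have i1 := S.integrable_h.indicator hm
  have i2 := (S.integrable_g.const_mul η).indicator hm
  rw [← integral_indicator hm, ← integral_indicator hm]
  refine (hasSum_fiber_integral (𝒟 := S.toCellTree) i i1).norm_le_of_bounded
    (hasSum_fiber_integral (𝒟 := S.toCellTree) i i2) fun c => ?_
  by_cases hc : ∃ x ∈ E, S.idx i x = c
  · obtain ⟨x, hx, rfl⟩ := hc
    have hcell : S.idx i ⁻¹' {S.idx i x} = S.cell i x := rfl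
    have hmem : ∀ y ∈ S.cell i x, y ∈ E := fun y hy => (hE y x hy).mpr hx
    rw [hcell, setIntegral_congr_fun (measurableSet_cell i x) (g := S.h)
      (fun y hy => indicator_of_mem (hmem y hy) _),
      setIntegral_congr_fun (measurableSet_cell i x) (g := fun y => η * S.g y)
      (fun y hy => indicator_of_mem (hmem y hy) _), integral_const_mul]
    exact h x hx
  · have hmem : ∀ y ∈ S.idx i ⁻¹' {c}, y ∉ E := fun y hy hyE => hc ⟨y, hyE, hy⟩
    have hmc : MeasurableSet (S.idx i ⁻¹' {c}) := S.measurable_idx i (measurableSet_singleton c)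
    rw [setIntegral_congr_fun hmc (g := fun _ => 0) (fun y hy => indicator_of_notMem (hmem y hy) _),
      setIntegral_congr_fun hmc (g := fun _ => 0) (fun y hy => indicator_of_notMem (hmem y hy) _)]
    simp

/-- Sorting the points by the first level at which the average is small decomposes the set into
disjoint unions of cells. On each of these cells the `h`-mass is at most `η` times the `g`-mass. -/
lemma norm_setIntegral_smallSet_le {η : ℝ} (hη : 0 ≤ η) :
    ‖∫ x in S.smallSet η, S.h x ∂S.ρ‖ ≤ η * ∫ x, S.g x ∂S.ρ := by
  set F : ℕ → Set X := fun i => {x | ‖S.hc i x‖ ≤ η * S.gc i x ∧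
    ∀ l < i, ¬ ‖S.hc l x‖ ≤ η * S.gc l x} with hF
  have hU : S.smallSet η = ⋃ i, F i := by
    classical
    ext x
    simp only [smallSet, mem_ofPred_eq, mem_iUnion, hF]
    exact ⟨fun h => ⟨Nat.find h, Nat.find_spec h, fun l hl => Nat.find_min h hl⟩,
      fun ⟨i, hi, _⟩ => ⟨i, hi⟩⟩
  have hFa : ∀ i, S.Adapted i (fun x => x ∈ F i) := by
    intro i x y hxy
    have h1 : ∀ l ≤ i, S.hc l x = S.hc l y ∧ S.gc l x = S.gc l y := fun l hl =>
      ⟨S.adapted_hc l x y (idx_eq_of_le hl hxy), S.adapted_gc l x y (idx_eq_of_le hl hxy)⟩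
    simp only [hF, mem_ofPred_eq]
    refine propext (and_congr ?_ (forall₂_congr fun l hl => ?_))
    · rw [(h1 i le_rfl).1, (h1 i le_rfl).2]
    · rw [(h1 l hl.le).1, (h1 l hl.le).2]
  have hFm : ∀ i, MeasurableSet (F i) := fun i => (hFa i).measurableSet
  have hFd : Pairwise (Function.onFun Disjoint F) := by
    intro i j hij
    refine Set.disjoint_left.2 fun x hx hx' => ?_
    rcases hij.lt_or_gt with h | h
    · exact hx'.2 i h hx.1
    · exact hx.2 j h hx'.1
  have i2 := S.integrable_g.const_mul η
  have s1 := hasSum_integral_iUnion hFm hFd S.integrable_h.integrableOn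
  have s2 := hasSum_integral_iUnion hFm hFd i2.integrableOn
  rw [hU, ← integral_const_mul]
  refine (s1.norm_le_of_bounded s2 fun i =>
    norm_setIntegral_le_of_adapted (hFa i) fun x hx => hx.1).trans ?_
  exact setIntegral_le_integral i2 (Filter.Eventually.of_forall fun x =>
    mul_nonneg hη (S.g_nonneg x))

end StoppedPair

/-! ### Densities for a positive and a complex measure. -/

section Density

variable {X : Type*} [MeasurableSpace X]

lemma signedMeasure_withDensity_rnDeriv_eq {ρ : Measure X} [SigmaFinite ρ] {s : SignedMeasure X}
    (h : ∀ E, MeasurableSet E → ρ E = 0 → s E = 0) : ρ.withDensityᵥ (s.rnDeriv ρ) = s := by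
  refine s.withDensityᵥ_rnDeriv_eq ρ fun E hE => ?_
  by_cases hm : MeasurableSet E
  · exact h E hm (by rwa [Measure.toENNRealVectorMeasure_apply_measurable hm] at hE)
  · exact s.not_measurable hm

lemma complexMeasure_withDensity_rnDeriv_eq {ρ : Measure X} [SigmaFinite ρ]
    {ν : ComplexMeasure X} (h : ν.variation ≪ ρ) : ρ.withDensityᵥ (ν.rnDeriv ρ) = ν := by
  have h0 : ∀ E, MeasurableSet E → ρ E = 0 → ν E = 0 := fun E _ hE => by
    have h1 := VectorMeasure.enorm_measure_le_variation ν E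
    rw [h hE] at h1
    simpa using h1
  have hre := signedMeasure_withDensity_rnDeriv_eq (ρ := ρ) (s := ComplexMeasure.re ν)
    fun E hE h1 => by
      change (ν E).re = 0
      rw [h0 E hE h1]; rfl
  have him := signedMeasure_withDensity_rnDeriv_eq (ρ := ρ) (s := ComplexMeasure.im ν)
    fun E hE h1 => by
      change (ν E).im = 0
      rw [h0 E hE h1]; rfl
  have hi := ν.integrable_rnDeriv ρ
  ext E hE : 1
  apply Complex.ext
  · rw [withDensityᵥ_apply hi hE, ← RCLike.re_eq_complex_re, ← integral_re hi.integrableOn]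
    change ∫ x in E, (ComplexMeasure.re ν).rnDeriv ρ x ∂ρ = (ComplexMeasure.re ν) E
    conv_rhs => rw [← hre]
    rw [withDensityᵥ_apply (SignedMeasure.integrable_rnDeriv _ _) hE]
  · rw [withDensityᵥ_apply hi hE, ← RCLike.im_eq_complex_im, ← integral_im hi.integrableOn]
    change ∫ x in E, (ComplexMeasure.im ν).rnDeriv ρ x ∂ρ = (ComplexMeasure.im ν) E
    conv_rhs => rw [← him]
    rw [withDensityᵥ_apply (SignedMeasure.integrable_rnDeriv _ _) hE]

lemma measurable_complexMeasure_rnDeriv (ν : ComplexMeasure X) (ρ : Measure X) :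
    Measurable (ν.rnDeriv ρ) := by
  have h1 := SignedMeasure.measurable_rnDeriv (ComplexMeasure.re ν) ρ
  have h2 := SignedMeasure.measurable_rnDeriv (ComplexMeasure.im ν) ρ
  have e : ν.rnDeriv ρ = fun x => (((ComplexMeasure.re ν).rnDeriv ρ x : ℝ) : ℂ) +
      (((ComplexMeasure.im ν).rnDeriv ρ x : ℝ) : ℂ) * Complex.I := by
    funext x; apply Complex.ext <;> simp [ComplexMeasure.rnDeriv]
  rw [e]
  exact (Complex.measurable_ofReal.comp h1).add
    ((Complex.measurable_ofReal.comp h2).mul_const _)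

/-- A finite measure and a complex measure of finite variation have densities with respect to a
common finite measure. -/
lemma exists_common_density (μ : Measure X) [IsFiniteMeasure μ] (ν : ComplexMeasure X)
    [IsFiniteMeasure ν.variation] :
    ∃ (ρ : Measure X) (g : X → ℝ) (h : X → ℂ), IsFiniteMeasure ρ ∧ Measurable g ∧
      Integrable g ρ ∧ (∀ x, 0 ≤ g x) ∧ Measurable h ∧ Integrable h ρ ∧
      ρ.withDensity (fun x => ENNReal.ofReal (g x)) = μ ∧ ρ.withDensityᵥ h = ν := by
  -- Both measures are absolutely continuous with respect to this sum, although `ν` need not have a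
  -- density with respect to `μ`.
  set ρ := μ + ν.variation with hρ
  have hμ : μ ≪ ρ := Measure.absolutelyContinuous_of_le (Measure.le_add_right le_rfl)
  have hν : ν.variation ≪ ρ := Measure.absolutelyContinuous_of_le (Measure.le_add_left le_rfl)
  refine ⟨ρ, fun x => (μ.rnDeriv ρ x).toReal, ν.rnDeriv ρ, inferInstance,
    (Measure.measurable_rnDeriv μ ρ).ennreal_toReal, Measure.integrable_toReal_rnDeriv,
    fun x => ENNReal.toReal_nonneg, measurable_complexMeasure_rnDeriv ν ρ,
    ν.integrable_rnDeriv ρ, ?_, complexMeasure_withDensity_rnDeriv_eq hν⟩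
  conv_rhs => rw [← Measure.withDensity_rnDeriv_eq μ ρ hμ]
  refine withDensity_congr_ae ?_
  filter_upwards [Measure.rnDeriv_lt_top μ ρ] with x hx
  exact ENNReal.ofReal_toReal hx.ne

/-- Integrability with respect to `|h| ρ` is that of `‖h‖ φ` with respect to `ρ`; the bounded phase
`h / ‖h‖` turns one product into the other. -/
lemma integrable_mul_of_withDensity {ρ : Measure X} {h : X → ℂ} (hm : Measurable h)
    {φ : X → ℂ} (hφ : Integrable φ (ρ.withDensity fun x => ‖h x‖ₑ)) :
    Integrable (fun x => φ x * h x) ρ := by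
  have h1 := (integrable_withDensity_iff_integrable_smul₀' (f := fun x => ‖h x‖ₑ)
    hm.enorm.aemeasurable
    (Filter.Eventually.of_forall fun x => enorm_lt_top)).1 hφ
  simp only [toReal_enorm] at h1
  have h2 : Integrable (fun x => (h x / ‖h x‖) * (‖h x‖ • φ x)) ρ := by
    refine h1.bdd_mul (c := 1) ?_ (Filter.Eventually.of_forall fun x => ?_)
    · exact (hm.div (Complex.measurable_ofReal.comp hm.norm)).aestronglyMeasurable
    · rw [norm_div, Complex.norm_real, norm_norm]; exact div_self_le_one _
  refine h2.congr (Filter.Eventually.of_forall fun x => ?_)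
  simp only [Complex.real_smul]
  by_cases hx : h x = 0
  · simp [hx]
  · have : (‖h x‖ : ℂ) ≠ 0 := by simpa using hx
    field_simp

/-- Both sides are additive and continuous in `φ` for the `L¹(|h| ρ)` norm, and they agree on
multiples of indicators. -/
lemma vectorMeasure_integral_withDensity {ρ : Measure X} {h : X → ℂ} (hm : Measurable h)
    (hi : Integrable h ρ) {φ : X → ℂ} (hφ : Integrable φ (ρ.withDensity fun x => ‖h x‖ₑ)) :
    (ρ.withDensityᵥ h).integral φ (ContinuousLinearMap.mul ℝ ℂ) = ∫ x, φ x * h x ∂ρ := by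
  set ν := ρ.withDensityᵥ h with hν
  have hvar : ν.variation = ρ.withDensity fun x => ‖h x‖ₑ := Measure.variation_withDensityᵥ hi
  have hfin : IsFiniteMeasure ν.variation := by
    rw [hvar]; exact isFiniteMeasure_withDensity hi.2.ne
  rw [← hvar] at hφ
  have key : ∀ ψ : X → ℂ, Integrable ψ ν.variation → Integrable (fun x => ψ x * h x) ρ :=
    fun ψ hψ => integrable_mul_of_withDensity hm (by rwa [hvar] at hψ)
  refine Integrable.induction (P := fun φ => ν.integral φ (ContinuousLinearMap.mul ℝ ℂ) =
    ∫ x, φ x * h x ∂ρ) ?_ ?_ ?_ ?_ hφ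
  · intro c s hs _
    have e1 : (fun x => s.indicator (fun _ => c) x * h x) = s.indicator (fun x => c * h x) := by
      funext x; by_cases hx : x ∈ s <;> simp [hx]
    rw [e1, integral_indicator hs, integral_const_mul, ← withDensityᵥ_apply hi hs, ← hν]
    exact VectorMeasure.integral_indicator_const c hs
  · intro f g _ hf hg h1 h2
    rw [VectorMeasure.integral_add hf hg, h1, h2]
    simp only [Pi.add_apply, add_mul]
    rw [integral_add (key f hf) (key g hg)]
  · refine isClosed_eq VectorMeasure.continuous_integral ?_
    refine LipschitzWith.continuous (K := 1) (LipschitzWith.of_dist_le_mul fun f g => ?_)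
    have hf := key f (L1.integrable_coeFn f)
    have hg := key g (L1.integrable_coeFn g)
    have e : ∀ u : X → ℝ, ∫ x, u x ∂ν.variation = ∫ x, ‖h x‖ * u x ∂ρ := fun u => by
      rw [hvar, integral_withDensity_eq_integral_toReal_smul hm.enorm
        (Filter.Eventually.of_forall fun x => enorm_lt_top)]
      simp
    rw [dist_eq_norm, ← integral_sub hf hg, NNReal.coe_one, one_mul, L1.dist_eq_integral_dist, e]
    refine (norm_integral_le_integral_norm _).trans (le_of_eq ?_)
    refine integral_congr_ae (Filter.Eventually.of_forall fun x => ?_)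
    simp only [dist_eq_norm]
    rw [← sub_mul, norm_mul, mul_comm]
  · intro f g hfg hf h1
    rw [← VectorMeasure.integral_congr_ae hfg, h1]
    refine integral_congr_ae ?_
    rw [hvar] at hfg
    have := (ae_withDensity_iff hm.enorm).1 hfg
    filter_upwards [this] with x hx
    by_cases h0 : h x = 0
    · simp [h0]
    · rw [hx (by simpa using h0)]

end Density

/-! ### Randomly shifted dyadic grids and good points. -/

variable {n : ℕ}

/-- The position of `x` along the `k`-th axis in the grid of level `i` with shift `w`, measured in
units of the side length `ℓ / 2 ^ i` of the grid. -/
def gridPos (ℓ : ℝ) (i : ℕ) (k : Fin n) (w : Fin n → ℝ) (x : EuclideanSpace ℝ (Fin n)) : ℝ :=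
  2 ^ i * (x k / ℓ - w k)

/-- The index of the dyadic cube of level `i` containing `x` in the grid with shift `w`. -/
def gridIdx (ℓ : ℝ) (w : Fin n → ℝ) (i : ℕ) (x : EuclideanSpace ℝ (Fin n)) : Fin n → ℤ :=
  if i = 0 then 0 else fun k => ⌊gridPos ℓ i k w x⌋

lemma gridIdx_of_pos (ℓ : ℝ) (w : Fin n → ℝ) {i : ℕ} (hi : 1 ≤ i) (x : EuclideanSpace ℝ (Fin n)) :
    gridIdx ℓ w i x = fun k => ⌊gridPos ℓ i k w x⌋ := if_neg (by omega)

lemma measurable_gridPos (ℓ : ℝ) (i : ℕ) (k : Fin n) :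
    Measurable (fun p : (Fin n → ℝ) × EuclideanSpace ℝ (Fin n) => gridPos ℓ i k p.1 p.2) := by
  unfold gridPos
  have h1 : Measurable (fun p : (Fin n → ℝ) × EuclideanSpace ℝ (Fin n) => p.2 k) := by fun_prop
  have h2 : Measurable (fun p : (Fin n → ℝ) × EuclideanSpace ℝ (Fin n) => p.1 k) := by fun_prop
  fun_prop

lemma measurable_gridIdx (ℓ : ℝ) (i : ℕ) :
    Measurable (fun p : (Fin n → ℝ) × EuclideanSpace ℝ (Fin n) => gridIdx ℓ p.1 i p.2) := by
  unfold gridIdx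
  by_cases hi : i = 0
  · simp only [hi, if_true]; exact measurable_const
  · simp only [hi, if_false]
    exact measurable_pi_iff.2 fun k => Int.measurable_floor.comp (measurable_gridPos ℓ i k)

/-- The dyadic grid with shift `w`, with the whole space as the only cell of level `0`. -/
def gridTree (ℓ : ℝ) (w : Fin n → ℝ) : CellTree (EuclideanSpace ℝ (Fin n)) (Fin n → ℤ) where
  idx := gridIdx ℓ w
  measurable_idx i := (measurable_gridIdx ℓ i).comp measurable_prodMk_left
  nested i x y h := by
    rcases Nat.eq_zero_or_pos i with rfl | hi
    · simp [gridIdx]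
    · rw [gridIdx_of_pos _ _ (by omega), gridIdx_of_pos _ _ (by omega)] at h
      rw [gridIdx_of_pos _ _ hi, gridIdx_of_pos _ _ hi]
      funext k
      have hk := congrFun h k
      have e : ∀ z : EuclideanSpace ℝ (Fin n),
          gridPos ℓ i k w z = gridPos ℓ (i + 1) k w z / (2 : ℕ) := fun z => by
        unfold gridPos; rw [pow_succ]; push_cast; ring
      rw [e x, e y, Int.floor_div_natCast, Int.floor_div_natCast, hk]
  root x y := by simp [gridIdx]

lemma gridTree_idx (ℓ : ℝ) (w : Fin n → ℝ) (i : ℕ) : (gridTree ℓ w).idx i = gridIdx ℓ w i := rfl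

lemma abs_sub_eq_gridPos {ℓ : ℝ} (hℓ : 0 < ℓ) (i : ℕ) (k : Fin n) (w : Fin n → ℝ)
    (x y : EuclideanSpace ℝ (Fin n)) :
    |x k - y k| = |gridPos ℓ i k w x - gridPos ℓ i k w y| * (ℓ / 2 ^ i) := by
  have hp : 0 < ℓ / 2 ^ i := by positivity
  rw [← abs_of_pos hp, ← abs_mul]
  congr 1
  unfold gridPos
  field_simp
  ring

lemma diamLE_gridTree {ℓ : ℝ} (hℓ : 0 < ℓ) (w : Fin n → ℝ) :
    DiamLE (gridTree ℓ w) ℓ (n + 1) := by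
  intro i hi y z h
  rw [gridTree_idx, gridIdx_of_pos _ _ hi, gridIdx_of_pos _ _ hi] at h
  have hp : 0 < ℓ / 2 ^ i := by positivity
  have hk : ∀ k, |y k - z k| ≤ ℓ / 2 ^ i := fun k => by
    rw [abs_sub_eq_gridPos hℓ i k w]
    have := (Int.abs_sub_lt_one_of_floor_eq_floor (congrFun h k)).le
    exact mul_le_of_le_one_left hp.le this
  have h2 : ‖y - z‖ ^ 2 ≤ ((n + 1 : ℝ) * (ℓ / 2 ^ i)) ^ 2 := by
    rw [EuclideanSpace.norm_sq_eq]
    calc ∑ k, ‖(y - z) k‖ ^ 2 ≤ ∑ _k : Fin n, (ℓ / 2 ^ i) ^ 2 := by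
          refine Finset.sum_le_sum fun k _ => ?_
          exact pow_le_pow_left₀ (norm_nonneg _) (hk k) 2
      _ = n * (ℓ / 2 ^ i) ^ 2 := by simp
      _ ≤ _ := by
          rw [mul_pow]
          gcongr
          nlinarith [(Nat.cast_nonneg n : (0 : ℝ) ≤ n)]
  exact (le_abs_self _).trans (abs_le_of_sq_le_sq h2 (by positivity))

/-- The pairs of a shift and a point that is far from the boundaries of the cells of level at
most `j`. -/
def gridGood (n : ℕ) (ℓ γ c₀ : ℝ) (j : ℕ) : Set ((Fin n → ℝ) × EuclideanSpace ℝ (Fin n)) :=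
  {p | ∀ i ∈ Finset.Icc 1 j, ∀ k, c₀ * (2 : ℝ) ^ (-(γ * ((j : ℝ) - i))) ≤
    |gridPos ℓ i k p.1 p.2 - round (gridPos ℓ i k p.1 p.2)|}

lemma measurableSet_gridGood (ℓ γ c₀ : ℝ) (j : ℕ) : MeasurableSet (gridGood n ℓ γ c₀ j) := by
  have : gridGood n ℓ γ c₀ j = ⋂ i ∈ Finset.Icc 1 j, ⋂ k,
      {p | c₀ * (2 : ℝ) ^ (-(γ * ((j : ℝ) - i))) ≤
        |gridPos ℓ i k p.1 p.2 - round (gridPos ℓ i k p.1 p.2)|} := by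
    ext p; simp [gridGood]
  rw [this]
  refine Finset.measurableSet_biInter _ fun i _ => MeasurableSet.iInter fun k => ?_
  refine measurableSet_le measurable_const ?_
  have hz := measurable_gridPos (n := n) ℓ i k
  have hr : Measurable (fun p : (Fin n → ℝ) × EuclideanSpace ℝ (Fin n) =>
      ((round (gridPos ℓ i k p.1 p.2) : ℤ) : ℝ)) := by
    simp_rw [round_eq]
    exact measurable_from_top.comp (Int.measurable_floor.comp (hz.add_const _))
  exact (hz.sub hr).abs

/-- Different integer parts mean that an integer separates `a` and `b`, and it is at least as far
from `a` as the nearest integer. -/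
lemma abs_sub_round_le_of_floor_ne {a b : ℝ} (h : ⌊b⌋ ≠ ⌊a⌋) : |a - round a| ≤ |a - b| := by
  rcases lt_or_gt_of_ne h with h | h
  · refine (round_le a ⌊a⌋).trans ?_
    have h1 : b < ⌊a⌋ := Int.floor_lt.1 h
    have h2 := Int.floor_le a
    rw [abs_of_nonneg (by linarith), abs_of_nonneg (by linarith)]; linarith
  · refine (round_le a ⌊b⌋).trans ?_
    have h1 : a < ⌊b⌋ := Int.floor_lt.1 h
    have h2 := Int.floor_le b
    rw [abs_of_nonpos (by linarith), abs_of_nonpos (by linarith)]; linarith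

lemma goodAt_of_mem_gridGood {ℓ γ c₀ : ℝ} (hℓ : 0 < ℓ) {j : ℕ} {w : Fin n → ℝ}
    {x : EuclideanSpace ℝ (Fin n)} (h : (w, x) ∈ gridGood n ℓ γ c₀ j) :
    GoodAt (gridTree ℓ w) ℓ γ c₀ j x := by
  intro i hi hij y hy
  rw [gridTree_idx, gridIdx_of_pos _ _ hi, gridIdx_of_pos _ _ hi] at hy
  obtain ⟨k, hk⟩ := Function.ne_iff.1 hy
  have h1 := h i (Finset.mem_Icc.2 ⟨hi, hij⟩) k
  have h2 : |x k - y k| ≤ ‖x - y‖ := PiLp.norm_apply_le (x - y) k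
  refine le_trans ?_ h2
  rw [abs_sub_eq_gridPos hℓ i k w]
  gcongr
  exact h1.trans (abs_sub_round_le_of_floor_ne hk)

/-- The uniform distribution of the shift. -/
def shiftMeasure (n : ℕ) : Measure (Fin n → ℝ) :=
  Measure.pi fun _ => (volume : Measure ℝ).restrict (Ico 0 1)

instance : IsProbabilityMeasure ((volume : Measure ℝ).restrict (Ico 0 1)) :=
  ⟨by simp⟩

instance (n : ℕ) : IsProbabilityMeasure (shiftMeasure n) := by
  unfold shiftMeasure; infer_instance

/-- As `s` runs over `[0,1)`, `2^i (a - s)` sweeps an interval of length `2^i`, and its nearest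
integer takes at most `2^i + 2` values. Each confines `s` to an interval of length `2δ/2^i`, and
`2^i + 2 ≤ 2 * 2^i` because `i ≥ 1`. -/
lemma volume_near_int_le {i : ℕ} (hi : 1 ≤ i) (a : ℝ) {δ : ℝ} (hδ : 0 ≤ δ) :
    (volume : Measure ℝ) {s | s ∈ Ico (0 : ℝ) 1 ∧
      |2 ^ i * (a - s) - round ((2 : ℝ) ^ i * (a - s))| < δ} ≤ ENNReal.ofReal (4 * δ) := by
  set b : ℝ := 2 ^ i * a with hb
  have hsub : {s | s ∈ Ico (0 : ℝ) 1 ∧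
      |2 ^ i * (a - s) - round ((2 : ℝ) ^ i * (a - s))| < δ} ⊆
      ⋃ p ∈ Finset.Icc (⌊b⌋ - 2 ^ i) (⌊b⌋ + 1), Metric.ball ((b - (p : ℤ)) / 2 ^ i) (δ / 2 ^ i) := by
    rintro s ⟨hs, hs2⟩
    set z : ℝ := 2 ^ i * (a - s) with hz
    have hz' : z = b - 2 ^ i * s := by rw [hz, hb]; ring
    have h2 : (0 : ℝ) < 2 ^ i := by positivity
    have h3 := abs_le.1 (abs_sub_round z)
    have h4 := Int.floor_le b
    have h5 := Int.lt_floor_add_one b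
    have h6 : 2 ^ i * s < 2 ^ i := by nlinarith [hs.2]
    have h7 : 0 ≤ 2 ^ i * s := by nlinarith [hs.1]
    refine mem_iUnion₂.2 ⟨round z, Finset.mem_Icc.2 ⟨?_, ?_⟩, ?_⟩
    · have : (⌊b⌋ : ℝ) - 2 ^ i - 1 < round z := by linarith [h3.2]
      have : (⌊b⌋ - 2 ^ i - 1 : ℤ) < round z := by exact_mod_cast this
      linarith
    · have : (round z : ℝ) < ⌊b⌋ + 2 := by linarith [h3.1]
      have : round z < ⌊b⌋ + 2 := by exact_mod_cast this
      linarith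
    · rw [Metric.mem_ball, Real.dist_eq, lt_div_iff₀ h2]
      have e : s - (b - round z) / 2 ^ i = -(z - round z) / 2 ^ i := by
        rw [hz']; field_simp; ring
      rw [e, abs_div, abs_neg, abs_of_pos h2, div_mul_cancel₀ _ h2.ne']
      exact hs2
  refine (measure_mono hsub).trans ((measure_biUnion_finset_le _ _).trans ?_)
  simp_rw [Real.volume_ball]
  rw [Finset.sum_const, Int.card_Icc, nsmul_eq_mul]
  have e : (⌊b⌋ + 1 + 1 - (⌊b⌋ - 2 ^ i)).toNat = 2 ^ i + 2 := by
    have : ⌊b⌋ + 1 + 1 - (⌊b⌋ - 2 ^ i) = ((2 ^ i + 2 : ℕ) : ℤ) := by push_cast; ring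
    rw [this, Int.toNat_natCast]
  rw [e, ← ENNReal.ofReal_natCast, ← ENNReal.ofReal_mul (by positivity)]
  refine ENNReal.ofReal_le_ofReal ?_
  push_cast
  have h2 : (2 : ℝ) ≤ 2 ^ i := by
    calc (2 : ℝ) = 2 ^ 1 := by norm_num
      _ ≤ 2 ^ i := pow_le_pow_right₀ (by norm_num) hi
  calc ((2 : ℝ) ^ i + 2) * (2 * (δ / 2 ^ i)) ≤ (2 ^ i + 2 ^ i) * (2 * (δ / 2 ^ i)) := by gcongr
    _ = 4 * δ := by field_simp; ring

lemma shiftMeasure_near_int_le (ℓ : ℝ) {i : ℕ} (hi : 1 ≤ i) (k : Fin n)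
    (x : EuclideanSpace ℝ (Fin n)) {δ : ℝ} (hδ : 0 ≤ δ) :
    shiftMeasure n {w | |gridPos ℓ i k w x - round (gridPos ℓ i k w x)| < δ} ≤
      ENNReal.ofReal (4 * δ) := by
  set T : Set ℝ := {s | |2 ^ i * (x k / ℓ - s) - round ((2 : ℝ) ^ i * (x k / ℓ - s))| < δ} with hT
  have hTm : MeasurableSet T := by
    have hr : Measurable (fun s : ℝ => ((round ((2 : ℝ) ^ i * (x k / ℓ - s)) : ℤ) : ℝ)) := by
      simp_rw [round_eq]
      exact measurable_from_top.comp (Int.measurable_floor.comp (by fun_prop))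
    exact measurableSet_lt (by fun_prop) measurable_const
  have hmp := measurePreserving_eval (fun _ : Fin n => (volume : Measure ℝ).restrict (Ico 0 1)) k
  have := hmp.measure_preimage hTm.nullMeasurableSet
  change shiftMeasure n (Function.eval k ⁻¹' T) ≤ _
  unfold shiftMeasure
  rw [this, Measure.restrict_apply hTm]
  refine le_trans (measure_mono ?_) (volume_near_int_le hi (x k / ℓ) hδ)
  exact fun s hs => ⟨hs.2, hs.1⟩

/-- A point is good for most shifts. -/
lemma shiftMeasure_not_good_le (ℓ : ℝ) {γ c₀ : ℝ} (hγ : 0 < γ) (hc : 0 ≤ c₀) (j : ℕ)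
    (x : EuclideanSpace ℝ (Fin n)) :
    shiftMeasure n {w | (w, x) ∉ gridGood n ℓ γ c₀ j} ≤
      ENNReal.ofReal (4 * n * c₀ * (1 - 2 ^ (-γ))⁻¹) := by
  set q : ℝ := 2 ^ (-γ) with hq
  have hq0 : 0 ≤ q := by positivity
  have hq1 : q < 1 := Real.rpow_lt_one_of_one_lt_of_neg one_lt_two (by linarith)
  have hδ : ∀ i ∈ Finset.range j, c₀ * (2 : ℝ) ^ (-(γ * ((j : ℝ) - (i + 1 : ℕ)))) =
      c₀ * q ^ (j - 1 - i) := by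
    intro i hi
    have hi := Finset.mem_range.1 hi
    rw [hq, ← Real.rpow_natCast, ← Real.rpow_mul (by norm_num)]
    congr 2
    rw [show j - 1 - i = j - (i + 1) by omega, Nat.cast_sub (by omega)]; ring
  have hsub : {w | (w, x) ∉ gridGood n ℓ γ c₀ j} ⊆ ⋃ i ∈ Finset.range j, ⋃ k ∈ Finset.univ,
      {w | |gridPos ℓ (i + 1) k w x - round (gridPos ℓ (i + 1) k w x)| <
        c₀ * q ^ (j - 1 - i)} := by
    intro w hw
    simp only [gridGood, mem_ofPred_eq, not_forall, not_le] at hw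
    obtain ⟨i, hi, k, hk⟩ := hw
    obtain ⟨hi1, hi2⟩ := Finset.mem_Icc.1 hi
    obtain ⟨i, rfl⟩ : ∃ i', i = i' + 1 := ⟨i - 1, by omega⟩
    have hmem : i ∈ Finset.range j := Finset.mem_range.2 (by omega)
    rw [hδ i hmem] at hk
    exact mem_iUnion₂.2 ⟨i, hmem, mem_iUnion₂.2 ⟨k, Finset.mem_univ k, hk⟩⟩
  -- The union bound over levels and axes sums to a geometric series in `2^(-γ)`, uniformly in `j`.
  refine (measure_mono hsub).trans ((measure_biUnion_finset_le _ _).trans ?_)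
  calc ∑ i ∈ Finset.range j, shiftMeasure n (⋃ k ∈ Finset.univ,
        {w | |gridPos ℓ (i + 1) k w x - round (gridPos ℓ (i + 1) k w x)| < c₀ * q ^ (j - 1 - i)})
      ≤ ∑ i ∈ Finset.range j, ∑ _k : Fin n, ENNReal.ofReal (4 * (c₀ * q ^ (j - 1 - i))) := by
        refine Finset.sum_le_sum fun i _ => (measure_biUnion_finset_le _ _).trans ?_
        exact Finset.sum_le_sum fun k _ =>
          shiftMeasure_near_int_le ℓ (by omega) k x (by positivity)
    _ = ENNReal.ofReal (∑ i ∈ Finset.range j, 4 * n * c₀ * q ^ (j - 1 - i)) := by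
        rw [ENNReal.ofReal_sum_of_nonneg fun i _ => by positivity]
        refine Finset.sum_congr rfl fun i _ => ?_
        rw [Finset.sum_const, Finset.card_univ, Fintype.card_fin, nsmul_eq_mul,
          ← ENNReal.ofReal_natCast, ← ENNReal.ofReal_mul (by positivity)]
        congr 1; ring
    _ ≤ _ := by
        refine ENNReal.ofReal_le_ofReal ?_
        rw [← Finset.mul_sum, Finset.sum_range_reflect (fun i => q ^ i) j,
          ← tsum_geometric_of_lt_one hq0 hq1]
        gcongr
        exact (summable_geometric_of_lt_one hq0 hq1).sum_le_tsum _ fun i _ => by positivity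

/-! ### Joint measurability in the shift and the point. -/

variable {n : ℕ}

/-- The same measures with the dyadic grid of shift `w`. -/
def StoppedPair.onGrid (S : StoppedPair (EuclideanSpace ℝ (Fin n)) (Fin n → ℤ)) (ℓ : ℝ)
    (w : Fin n → ℝ) : StoppedPair (EuclideanSpace ℝ (Fin n)) (Fin n → ℤ) :=
  { S with toCellTree := gridTree ℓ w }

lemma measurable_gridCellIntegral {F : Type*} [NormedAddCommGroup F] [NormedSpace ℝ F]
    [MeasurableSpace F] [BorelSpace F] [SecondCountableTopology F]
    (ρ : Measure (EuclideanSpace ℝ (Fin n))) [SFinite ρ] {φ : EuclideanSpace ℝ (Fin n) → F}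
    (hφ : Measurable φ) (ℓ : ℝ) (i : ℕ) :
    Measurable (fun p : (Fin n → ℝ) × EuclideanSpace ℝ (Fin n) =>
      ∫ y in (gridTree ℓ p.1).cell i p.2, φ y ∂ρ) := by
  have hE : MeasurableSet {q : ((Fin n → ℝ) × EuclideanSpace ℝ (Fin n)) ×
      EuclideanSpace ℝ (Fin n) | gridIdx ℓ q.1.1 i q.2 = gridIdx ℓ q.1.1 i q.1.2} := by
    refine measurableSet_eq_fun ?_ ?_
    · exact (measurable_gridIdx ℓ i).comp ((measurable_fst.comp measurable_fst).prodMk measurable_snd)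
    · exact (measurable_gridIdx ℓ i).comp measurable_fst
  have h1 : Measurable (Function.uncurry fun (p : (Fin n → ℝ) × EuclideanSpace ℝ (Fin n))
      (y : EuclideanSpace ℝ (Fin n)) => ((gridTree ℓ p.1).cell i p.2).indicator φ y) := by
    have := (hφ.comp measurable_snd).indicator hE
    convert this using 1
    funext q
    simp only [Function.uncurry, indicator]
    rfl
  have h2 := (h1.stronglyMeasurable.integral_prod_right (ν := ρ)).measurable
  convert h2 using 2 with p
  rw [integral_indicator (CellTree.measurableSet_cell i p.2)]

lemma measurable_theta {k : ℝ → EuclideanSpace ℝ (Fin n) → EuclideanSpace ℝ (Fin n) → ℂ}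
    (hk : Measurable fun p : ℝ × EuclideanSpace ℝ (Fin n) × EuclideanSpace ℝ (Fin n) =>
      k p.1 p.2.1 p.2.2)
    (ρ : Measure (EuclideanSpace ℝ (Fin n))) [SFinite ρ] {φ : EuclideanSpace ℝ (Fin n) → ℂ}
    (hφ : Measurable φ) :
    Measurable (fun q : ℝ × EuclideanSpace ℝ (Fin n) => ∫ y, k q.1 q.2 y * φ y ∂ρ) := by
  have h1 : Measurable (Function.uncurry fun (q : ℝ × EuclideanSpace ℝ (Fin n))
      (y : EuclideanSpace ℝ (Fin n)) => k q.1 q.2 y * φ y) := by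
    have h2 : Measurable (fun p : (ℝ × EuclideanSpace ℝ (Fin n)) × EuclideanSpace ℝ (Fin n) =>
        k p.1.1 p.1.2 p.2) := hk.comp (g := fun q : ℝ × EuclideanSpace ℝ (Fin n) × EuclideanSpace ℝ (Fin n) =>
          k q.1 q.2.1 q.2.2)
        (f := fun p : (ℝ × EuclideanSpace ℝ (Fin n)) × EuclideanSpace ℝ (Fin n) =>
          (p.1.1, p.1.2, p.2)) (by fun_prop)
    exact h2.mul (hφ.comp measurable_snd)
  exact (h1.stronglyMeasurable.integral_prod_right (ν := ρ)).measurable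

namespace StoppedPair

variable (S : StoppedPair (EuclideanSpace ℝ (Fin n)) (Fin n → ℤ)) (ℓ : ℝ)

lemma measurable_onGrid_gc (i : ℕ) :
    Measurable (fun p : (Fin n → ℝ) × EuclideanSpace ℝ (Fin n) => (S.onGrid ℓ p.1).gc i p.2) :=
  measurable_gridCellIntegral S.ρ S.measurable_g ℓ i

lemma measurable_onGrid_hc (i : ℕ) :
    Measurable (fun p : (Fin n → ℝ) × EuclideanSpace ℝ (Fin n) => (S.onGrid ℓ p.1).hc i p.2) :=
  measurable_gridCellIntegral S.ρ S.measurable_h ℓ i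

lemma measurable_onGrid_tc (i : ℕ) :
    Measurable (fun p : (Fin n → ℝ) × EuclideanSpace ℝ (Fin n) => (S.onGrid ℓ p.1).tc i p.2) :=
  measurable_gridCellIntegral S.ρ S.measurable_h.norm ℓ i

lemma measurableSet_onGrid_live :
    MeasurableSet {p : (Fin n → ℝ) × EuclideanSpace ℝ (Fin n) |
      ∀ l, (S.onGrid ℓ p.1).Live l p.2} := by
  have : {p : (Fin n → ℝ) × EuclideanSpace ℝ (Fin n) | ∀ l, (S.onGrid ℓ p.1).Live l p.2} =
      ⋂ i, {p | (S.onGrid ℓ p.1).tc i p.2 ≤ S.A * (S.onGrid ℓ p.1).gc i p.2} := by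
    ext p
    simp only [mem_ofPred_eq, mem_iInter]
    exact ⟨fun h i => h i i le_rfl, fun h l i _ => h i⟩
  rw [this]
  exact MeasurableSet.iInter fun i => measurableSet_le (S.measurable_onGrid_tc ℓ i)
    ((S.measurable_onGrid_gc ℓ i).const_mul _)

lemma measurableSet_onGrid_smallSet (η : ℝ) :
    MeasurableSet {p : (Fin n → ℝ) × EuclideanSpace ℝ (Fin n) |
      p.2 ∈ (S.onGrid ℓ p.1).smallSet η} := by
  have : {p : (Fin n → ℝ) × EuclideanSpace ℝ (Fin n) | p.2 ∈ (S.onGrid ℓ p.1).smallSet η} =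
      ⋃ i, {p | ‖(S.onGrid ℓ p.1).hc i p.2‖ ≤ η * (S.onGrid ℓ p.1).gc i p.2} := by
    ext p; simp [smallSet]
  rw [this]
  exact MeasurableSet.iUnion fun i => measurableSet_le (S.measurable_onGrid_hc ℓ i).norm
    ((S.measurable_onGrid_gc ℓ i).const_mul _)

lemma measurable_onGrid_defectSq
    {k : ℝ → EuclideanSpace ℝ (Fin n) → EuclideanSpace ℝ (Fin n) → ℂ}
    (hk : Measurable fun p : ℝ × EuclideanSpace ℝ (Fin n) × EuclideanSpace ℝ (Fin n) =>
      k p.1 p.2.1 p.2.2) (j : ℕ) :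
    Measurable (fun p : (Fin n → ℝ) × EuclideanSpace ℝ (Fin n) =>
      (S.onGrid ℓ p.1).defectSq k ℓ j p.2) := by
  have h1 := measurable_theta hk S.ρ S.measurable_h
  have h2 := measurable_theta hk S.ρ (Complex.measurable_ofReal.comp S.measurable_g)
  have hq : Measurable (fun q : ((Fin n → ℝ) × EuclideanSpace ℝ (Fin n)) × ℝ => (q.2, q.1.2)) := by
    fun_prop
  have h3 : Measurable (fun q : ((Fin n → ℝ) × EuclideanSpace ℝ (Fin n)) × ℝ =>
      (S.onGrid ℓ q.1.1).defect k j q.2 q.1.2 S.h) :=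
    (h1.comp hq).sub ((((S.measurable_onGrid_hc ℓ j).comp measurable_fst).div
      (Complex.measurable_ofReal.comp ((S.measurable_onGrid_gc ℓ j).comp measurable_fst))).mul
        (h2.comp hq))
  exact Measurable.lintegral_prod_right' (ν := volume.restrict (Ioc (ℓ / 2 ^ (j + 1)) (ℓ / 2 ^ j)))
    ((h3.enorm.pow_const 2).div (ENNReal.measurable_ofReal.comp measurable_snd))

/-- The square function of the defect over the scales at which the point is good. -/
def goodDefectSq (k : ℝ → EuclideanSpace ℝ (Fin n) → EuclideanSpace ℝ (Fin n) → ℂ) (γ c₀ : ℝ)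
    (p : (Fin n → ℝ) × EuclideanSpace ℝ (Fin n)) : ℝ≥0∞ :=
  ∑' j, (gridGood n ℓ γ c₀ j).indicator 1 p * (S.onGrid ℓ p.1).defectSq k ℓ j p.2

lemma measurable_goodDefectSq
    {k : ℝ → EuclideanSpace ℝ (Fin n) → EuclideanSpace ℝ (Fin n) → ℂ}
    (hk : Measurable fun p : ℝ × EuclideanSpace ℝ (Fin n) × EuclideanSpace ℝ (Fin n) =>
      k p.1 p.2.1 p.2.2) (γ c₀ : ℝ) : Measurable (S.goodDefectSq ℓ k γ c₀) :=
  Measurable.tsum fun j => (measurable_one.indicator (measurableSet_gridGood ℓ γ c₀ j)).mul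
    (S.measurable_onGrid_defectSq ℓ hk j)

end StoppedPair

/-- The kernel extended by zero to `t ≤ 0`. -/
def extendKernel (k : ℝ → EuclideanSpace ℝ (Fin n) → EuclideanSpace ℝ (Fin n) → ℂ) (t : ℝ)
    (x y : EuclideanSpace ℝ (Fin n)) : ℂ := if 0 < t then k t x y else 0

lemma extendKernel_of_pos (k : ℝ → EuclideanSpace ℝ (Fin n) → EuclideanSpace ℝ (Fin n) → ℂ)
    {t : ℝ} (ht : 0 < t) : extendKernel k t = k t := by
  funext x y; simp [extendKernel, ht]

namespace IsSquareKernel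

variable {k : ℝ → EuclideanSpace ℝ (Fin n) → EuclideanSpace ℝ (Fin n) → ℂ} {m α : ℝ} {K : ℝ≥0}

/-- Measurability of `k` is assumed for `t > 0` only. The extension is jointly measurable on the
whole line, as the applications of Fubini require, and has the same square functions. -/
lemma measurable_extendKernel (hk : IsSquareKernel k m α K) :
    Measurable fun p : ℝ × EuclideanSpace ℝ (Fin n) × EuclideanSpace ℝ (Fin n) =>
      extendKernel k p.1 p.2.1 p.2.2 := by
  have hs : MeasurableSet {p : ℝ × EuclideanSpace ℝ (Fin n) × EuclideanSpace ℝ (Fin n) |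
      0 < p.1} := measurableSet_lt measurable_const measurable_fst
  refine measurable_of_restrict_of_restrict_compl hs ?_ ?_
  · have h : Measurable (fun q : {p : ℝ × EuclideanSpace ℝ (Fin n) × EuclideanSpace ℝ (Fin n) |
        0 < p.1} => ((⟨q.1.1, q.2⟩, q.1.2) :
          Ioi (0 : ℝ) × EuclideanSpace ℝ (Fin n) × EuclideanSpace ℝ (Fin n))) :=
      ((measurable_fst.comp measurable_subtype_coe).subtype_mk).prodMk
        (measurable_snd.comp measurable_subtype_coe)
    have := hk.measurable.comp h
    convert this using 1
    funext q
    simp only [domRestrict_apply, extendKernel, Function.comp]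
    exact if_pos q.2
  · have : {p : ℝ × EuclideanSpace ℝ (Fin n) × EuclideanSpace ℝ (Fin n) | 0 < p.1}ᶜ.domRestrict
        (fun p => extendKernel k p.1 p.2.1 p.2.2) = fun _ => 0 := by
      funext q
      simp only [domRestrict_apply, extendKernel]
      exact if_neg q.2
    rw [this]; exact measurable_const

lemma extendKernel (hk : IsSquareKernel k m α K) : IsSquareKernel (extendKernel k) m α K where
  measurable := by
    convert hk.measurable using 2 with p
    rw [extendKernel_of_pos k p.1.2]
  size t ht x y := by rw [extendKernel_of_pos k ht]; exact hk.size t ht x y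
  holder t ht x y z h := by rw [extendKernel_of_pos k ht]; exact hk.holder t ht x y z h

end IsSquareKernel

lemma squareTrunc_extendKernel
    (k : ℝ → EuclideanSpace ℝ (Fin n) → EuclideanSpace ℝ (Fin n) → ℂ) (Q : Cube n)
    (ν : ComplexMeasure (EuclideanSpace ℝ (Fin n))) :
    squareTrunc (extendKernel k) Q ν = squareTrunc k Q ν := by
  funext x
  unfold squareTrunc
  congr 1
  refine setLIntegral_congr_fun measurableSet_Ioo fun t ht => ?_
  simp only [thetaMeasure, extendKernel_of_pos k ht.1]

lemma squareFun_extendKernel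
    (k : ℝ → EuclideanSpace ℝ (Fin n) → EuclideanSpace ℝ (Fin n) → ℂ)
    (μ : Measure (EuclideanSpace ℝ (Fin n))) (f : EuclideanSpace ℝ (Fin n) → ℂ) :
    squareFun (extendKernel k) μ f = squareFun k μ f := by
  funext x
  unfold squareFun
  congr 1
  refine setLIntegral_congr_fun measurableSet_Ioi fun t ht => ?_
  simp only [thetaFun, extendKernel_of_pos k ht]

/-! ### Controlled points fill a fixed proportion of every grid. -/

variable {n : ℕ}

namespace StoppedPair

/-- A live cell of zero `g`-mass has zero `h`-mass, so its points belong to `smallSet`. -/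
lemma gc_ne_zero {X ι : Type*} [MeasurableSpace X] [MeasurableSpace ι] {S : StoppedPair X ι}
    {x : X} {η : ℝ} (hlive : ∀ l, S.Live l x) (hx : x ∉ S.smallSet η) (i : ℕ) :
    S.gc i x ≠ 0 := by
  intro h0
  refine hx ⟨i, ?_⟩
  refine (S.norm_hc_le i x).trans ((hlive i).tc_le.trans ?_)
  simp [h0]

/-- The variation measure `|h| ρ`. -/
def τ {X ι : Type*} [MeasurableSpace X] [MeasurableSpace ι] (S : StoppedPair X ι) : Measure X :=
  S.ρ.withDensity (fun x => ‖S.h x‖ₑ)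

lemma enorm_setIntegral_h_le {X ι : Type*} [MeasurableSpace X] [MeasurableSpace ι]
    (S : StoppedPair X ι) {E : Set X} (hE : MeasurableSet E) :
    ‖∫ x in E, S.h x ∂S.ρ‖ₑ ≤ S.τ E := by
  rw [τ, withDensity_apply _ hE]
  exact enorm_integral_le_lintegral_enorm _

/-- The pairs of a shift `w` and a point `x` of `E₀` at which the pair `(g ρ, h ρ)` is under
control in the grid of shift `w`. -/
def controlled (S : StoppedPair (EuclideanSpace ℝ (Fin n)) (Fin n → ℤ)) (ℓ : ℝ)
    (k : ℝ → EuclideanSpace ℝ (Fin n) → EuclideanSpace ℝ (Fin n) → ℂ) (γ c₀ Λ : ℝ)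
    (E₀ : Set (EuclideanSpace ℝ (Fin n))) : Set ((Fin n → ℝ) × EuclideanSpace ℝ (Fin n)) :=
  {p | p.2 ∈ E₀ ∧ (∀ l, (S.onGrid ℓ p.1).Live l p.2) ∧ p.2 ∉ (S.onGrid ℓ p.1).smallSet (1 / 4) ∧
    S.goodDefectSq ℓ k γ c₀ p ≤ ENNReal.ofReal (4 * Λ ^ 2)}

variable {S : StoppedPair (EuclideanSpace ℝ (Fin n)) (Fin n → ℤ)}
  {k : ℝ → EuclideanSpace ℝ (Fin n) → EuclideanSpace ℝ (Fin n) → ℂ} {m α : ℝ} {K Cμ : ℝ≥0}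
  {ℓ D c₀ : ℝ}

lemma measurableSet_controlled
    (hk : Measurable fun p : ℝ × EuclideanSpace ℝ (Fin n) × EuclideanSpace ℝ (Fin n) =>
      k p.1 p.2.1 p.2.2) (γ c₀ Λ : ℝ) {E₀ : Set (EuclideanSpace ℝ (Fin n))}
    (hE₀ : MeasurableSet E₀) : MeasurableSet (S.controlled ℓ k γ c₀ Λ E₀) :=
  (measurable_snd hE₀).inter ((S.measurableSet_onGrid_live ℓ).inter
    ((S.measurableSet_onGrid_smallSet ℓ (1 / 4)).compl.inter
      (measurableSet_le (S.measurable_goodDefectSq ℓ hk γ c₀) measurable_const)))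

/-- In every grid, the controlled points of `E₀` fill a fixed proportion of the mass of `g ρ`. -/
lemma le_measure_controlled {w : Fin n → ℝ} (H : (S.onGrid ℓ w).Admissible k m α K Cμ ℓ D c₀)
    (hk : Measurable fun p : ℝ × EuclideanSpace ℝ (Fin n) × EuclideanSpace ℝ (Fin n) =>
      k p.1 p.2.1 p.2.2)
    {E₀ U : Set (EuclideanSpace ℝ (Fin n))} (hE₀m : MeasurableSet E₀) (hUm : MeasurableSet U)
    {M B ε Λ : ℝ} (hM : 0 < M) (hg : ∫ x, S.g x ∂S.ρ = M) (hh : ∫ x, S.h x ∂S.ρ = (M : ℂ))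
    (hB : ∫ x, ‖S.h x‖ ∂S.ρ ≤ B * M) (hε : 0 < ε)
    (habs : ∀ E, MeasurableSet E → S.μ E ≤ ENNReal.ofReal (ε * M) →
      S.τ E ≤ ENNReal.ofReal (M / 32))
    (hU : S.τ U ≤ ENNReal.ofReal (M / 16))
    (hE₀ : S.μ (E₀ᶜ \ U) ≤ ENNReal.ofReal (ε / 4 * M)) (hBA : B ≤ S.A) (hA0 : 0 < S.A)
    (hA : 4 * B ≤ ε * S.A)
    (hΛ : 1 ≤ Λ) (hΛC : (energyC m α K Cμ D c₀ * ENNReal.ofReal (14 * S.A) +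
      massC m α K Cμ D c₀) * ENNReal.ofReal B ≤ ENNReal.ofReal (ε / 4 * Λ)) :
    ENNReal.ofReal (ε * M) ≤
      S.μ {x | (w, x) ∈ S.controlled ℓ k (α / (2 * (m + α))) c₀ Λ E₀} := by
  set S' := S.onGrid ℓ w with hS'
  set T := S'.smallSet (1 / 4) with hT
  have hTm : MeasurableSet T := S'.measurableSet_smallSet _
  set L : Set (EuclideanSpace ℝ (Fin n)) := {x | ¬ ∀ l, S'.Live l x} with hL
  have hLm : MeasurableSet L := by
    have : L = (⋂ l, {x | S'.Live l x})ᶜ := by ext x; simp [hL]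
    rw [this]
    exact (MeasurableSet.iInter fun l => S'.measurableSet_live l).compl
  set Y : Set (EuclideanSpace ℝ (Fin n)) := {x | ENNReal.ofReal (4 * Λ ^ 2) <
    2 * S'.diffMajorant m α K Cμ ℓ D c₀ x + 2 * S'.badMajorant m α K Cμ ℓ D c₀ x ^ 2} with hY
  have hYm : MeasurableSet Y := measurableSet_lt measurable_const
    ((measurable_diffMajorant.const_mul 2).add ((measurable_badMajorant.pow_const 2).const_mul 2))
  set Z : Set (EuclideanSpace ℝ (Fin n)) :=
    {x | (w, x) ∈ S.controlled ℓ k (α / (2 * (m + α))) c₀ Λ E₀} with hZ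
  have hZm : MeasurableSet Z :=
    measurable_prodMk_left (measurableSet_controlled hk (α / (2 * (m + α))) c₀ Λ hE₀m)
  have hB0 : 0 ≤ B := by
    have h1 : 0 ≤ ∫ x, ‖S.h x‖ ∂S.ρ := integral_nonneg fun _ => norm_nonneg _
    by_contra hneg
    nlinarith
  -- Outside `T` and `U`, a point that is not controlled must lie outside `E₀`, in a stopped cell,
  -- or where the majorants are large. The set `U` is kept apart because only its variation is known
  -- to be small.
  have hcover : Tᶜ ⊆ (U ∪ Z) ∪ ((E₀ᶜ \ U) ∪ L ∪ Y) := by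
    intro x hx
    by_contra hcon
    simp only [mem_union, not_or, mem_sdiff, mem_compl_iff, not_and, not_not] at hcon
    obtain ⟨⟨h1, h2⟩, ⟨h3, h4⟩, h5⟩ := hcon
    have hxE : x ∈ E₀ := by by_contra hne; exact h1 (h3 hne)
    have hlive : ∀ l, S'.Live l x := not_not.1 h4
    refine h2 ⟨hxE, hlive, hx, ?_⟩
    refine le_trans ?_ (not_lt.1 h5)
    unfold goodDefectSq
    refine H.tsum_defectSq_le (fun j => gc_ne_zero hlive hx j) hlive (fun j => ?_) fun j hj => ?_
    · exact indicator_le_self' (fun _ _ => zero_le) _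
    · have hmem : (w, x) ∈ gridGood n ℓ (α / (2 * (m + α))) c₀ j := by
        by_contra hne
        exact hj (indicator_of_notMem hne _)
      exact goodAt_of_mem_gridGood H.ℓ_pos hmem
  have hμL : S.μ L ≤ ENNReal.ofReal (ε / 4 * M) := by
    -- The level `0` cell is the whole space, where `|ν|` has mass at most `B M ≤ A M`.
    have h0 : ∀ x, S'.Live 0 x := by
      intro x i hi
      obtain rfl : i = 0 := by omega
      have e1 : S'.tc 0 x = ∫ x, ‖S.h x‖ ∂S.ρ := by
        rw [tc, CellTree.cell_zero, Measure.restrict_univ]; rfl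
      have e2 : S'.gc 0 x = ∫ x, S.g x ∂S.ρ := by
        rw [gc, CellTree.cell_zero, Measure.restrict_univ]; rfl
      rw [e1, e2, hg]
      refine hB.trans ?_
      change B * M ≤ S.A * M
      gcongr
    have h1 : ENNReal.ofReal S.A * S.μ L ≤ ENNReal.ofReal (∫ x, ‖S.h x‖ ∂S.ρ) :=
      mul_measure_not_live_le h0
    have h2 : ENNReal.ofReal S.A * S.μ L ≤ ENNReal.ofReal S.A * ENNReal.ofReal (ε / 4 * M) := by
      refine h1.trans ?_
      rw [← ENNReal.ofReal_mul hA0.le]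
      refine ENNReal.ofReal_le_ofReal (hB.trans ?_)
      nlinarith
    rwa [ENNReal.mul_le_mul_iff_right (by simpa using hA0) ENNReal.ofReal_ne_top] at h2
  have hμY : S.μ Y ≤ ENNReal.ofReal (ε / 4 * M) := by
    refine (measure_majorant_gt_le H hΛ).trans ?_
    change (energyC m α K Cμ D c₀ * ENNReal.ofReal (14 * S.A) + massC m α K Cμ D c₀) *
      ENNReal.ofReal (∫ x, ‖S.h x‖ ∂S.ρ) / ENNReal.ofReal Λ ≤ _
    refine ENNReal.div_le_of_le_mul ?_
    calc _ ≤ (energyC m α K Cμ D c₀ * ENNReal.ofReal (14 * S.A) + massC m α K Cμ D c₀) *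
          (ENNReal.ofReal B * ENNReal.ofReal M) := by
          gcongr
          rw [← ENNReal.ofReal_mul hB0]
          exact ENNReal.ofReal_le_ofReal hB
      _ ≤ ENNReal.ofReal (ε / 4 * Λ) * ENNReal.ofReal M := by rw [← mul_assoc]; gcongr
      _ = _ := by
          rw [← ENNReal.ofReal_mul (by positivity), ← ENNReal.ofReal_mul (by positivity)]
          congr 1; ring
  -- Each of the three exceptional sets has measure at most `(ε/4) M`, so their union is small
  -- enough for `habs`.
  have hbad : S.μ ((E₀ᶜ \ U) ∪ L ∪ Y) ≤ ENNReal.ofReal (ε * M) := by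
    refine (measure_union_le _ _).trans ((add_le_add ((measure_union_le _ _).trans
      (add_le_add hE₀ hμL)) hμY).trans ?_)
    rw [← ENNReal.ofReal_add (by positivity) (by positivity),
      ← ENNReal.ofReal_add (by positivity) (by positivity)]
    refine ENNReal.ofReal_le_ofReal ?_
    have := mul_pos hε hM
    linarith
  -- If the controlled set were too small, absolute continuity would apply to it as well. The
  -- complement of `T` would then have variation at most `M/16 + M/32 + M/32 = M/8`, while `T`
  -- contributes at most `M/4` to the total mass `M`.
  by_contra hlt
  push Not at hlt
  have hτZ := habs Z hZm hlt.le
  have hτb := habs _ (((hE₀m.compl.diff hUm).union hLm).union hYm) hbad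
  have hτ : S.τ Tᶜ ≤ ENNReal.ofReal (M / 8) := by
    refine (measure_mono hcover).trans ((measure_union_le _ _).trans
      ((add_le_add ((measure_union_le _ _).trans (add_le_add hU hτZ)) hτb).trans ?_))
    rw [← ENNReal.ofReal_add (by positivity) (by positivity),
      ← ENNReal.ofReal_add (by positivity) (by positivity)]
    exact ENNReal.ofReal_le_ofReal (by linarith)
  have h1 : ‖∫ x in T, S.h x ∂S.ρ‖ ≤ 1 / 4 * M := by
    rw [← hg]; exact S'.norm_setIntegral_smallSet_le (by norm_num)
  have h2 : ‖∫ x in Tᶜ, S.h x ∂S.ρ‖ ≤ M / 8 := by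
    have h3 := (S.enorm_setIntegral_h_le hTm.compl).trans hτ
    rwa [← ofReal_norm, ENNReal.ofReal_le_ofReal_iff (by positivity)] at h3
  have h3 : (M : ℂ) = ∫ x in T, S.h x ∂S.ρ + ∫ x in Tᶜ, S.h x ∂S.ρ := by
    rw [integral_add_compl hTm S.integrable_h, hh]
  have h4 : M ≤ 1 / 4 * M + M / 8 := by
    calc M = ‖(M : ℂ)‖ := by rw [Complex.norm_real, Real.norm_of_nonneg hM.le]
      _ ≤ _ := by rw [h3]; exact (norm_add_le _ _).trans (add_le_add h1 h2)
  linarith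

end StoppedPair

/-- If all sections of a set over a probability space have large measure, then many points lie in
the sections of a large part of the probability space. -/
lemma le_measure_of_le_measure_sections {W X : Type*} [MeasurableSpace W] [MeasurableSpace X]
    (P : Measure W) [IsProbabilityMeasure P] (μ : Measure X) [IsFiniteMeasure μ]
    {E : Set (W × X)} (hE : MeasurableSet E) {ε M : ℝ} (hε : 0 ≤ ε) (hM : 0 ≤ M)
    (hμ : μ univ = ENNReal.ofReal M) (h : ∀ w, ENNReal.ofReal (ε * M) ≤ μ {x | (w, x) ∈ E}) :
    ENNReal.ofReal (ε / 2 * M) ≤ μ {x | ENNReal.ofReal (ε / 2) ≤ P {w | (w, x) ∈ E}} := by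
  set G : Set X := {x | ENNReal.ofReal (ε / 2) ≤ P {w | (w, x) ∈ E}} with hG
  have hPm : Measurable (fun x => P {w | (w, x) ∈ E}) := measurable_measure_prodMk_right hE
  have hGm : MeasurableSet G := measurableSet_le measurable_const hPm
  have h1 : ENNReal.ofReal (ε * M) ≤ (P.prod μ) E := by
    rw [Measure.prod_apply hE]
    calc ENNReal.ofReal (ε * M) = ∫⁻ _w, ENNReal.ofReal (ε * M) ∂P := by simp
      _ ≤ _ := lintegral_mono h
  -- The section at `x` has probability at most `1` on `G` and at most `ε/2` off `G`; the second
  -- part uses up only half of the lower bound.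
  have h2 : (P.prod μ) E ≤ μ G + ENNReal.ofReal (ε / 2 * M) := by
    rw [Measure.prod_apply_symm hE]
    calc ∫⁻ x, P {w | (w, x) ∈ E} ∂μ
        ≤ ∫⁻ x, (G.indicator 1 x + ENNReal.ofReal (ε / 2)) ∂μ := by
          refine lintegral_mono fun x => ?_
          by_cases hx : x ∈ G
          · rw [indicator_of_mem hx]
            exact (prob_le_one).trans le_self_add
          · rw [indicator_of_notMem hx, zero_add]
            exact (not_le.1 hx).le
      _ = _ := by
          rw [lintegral_add_right _ measurable_const, lintegral_indicator_one hGm, lintegral_const,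
            hμ, ← ENNReal.ofReal_mul (by positivity)]
  have h3 := h1.trans h2
  rw [show ε * M = ε / 2 * M + ε / 2 * M by ring,
    ENNReal.ofReal_add (by positivity) (by positivity)] at h3
  exact (ENNReal.add_le_add_iff_right ENNReal.ofReal_ne_top).1 h3

/-! ### The square function of a bounded function at controlled points. -/

variable {n : ℕ}

/-- Elimination of `v`, which stands for `θ_t μ`: the second identity, with `‖b‖ ≥ 1/4`, bounds `v`
by the testing measure and its defect, and the first then bounds `u = θ_t(fμ)`. The constant is `64
= 2 * 2 * 4²`. -/
lemma enorm_sq_le_of_decomposition {u d a v u' d' b : ℂ} (h : u = d + a * v)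
    (h' : u' = d' + b * v) (hb : 1 / 4 ≤ ‖b‖) {N : ℝ≥0∞} (hN : ENNReal.ofReal (‖a‖ ^ 2) ≤ N) :
    ‖u‖ₑ ^ 2 ≤ 2 * ‖d‖ₑ ^ 2 + 64 * N * (‖u'‖ₑ ^ 2 + ‖d'‖ₑ ^ 2) := by
  have e : ∀ z : ℂ, ‖z‖ₑ ^ 2 = ENNReal.ofReal (‖z‖ ^ 2) := fun z => by
    rw [ENNReal.ofReal_pow (norm_nonneg _), ofReal_norm]
  have hv : ‖v‖ ≤ 4 * (‖u'‖ + ‖d'‖) := by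
    have h1 : ‖b‖ * ‖v‖ ≤ ‖u'‖ + ‖d'‖ := by
      rw [← norm_mul, show b * v = u' - d' by rw [h']; ring]
      exact norm_sub_le _ _
    nlinarith [norm_nonneg v]
  have hv2 : ‖v‖ ^ 2 ≤ 32 * (‖u'‖ ^ 2 + ‖d'‖ ^ 2) := by
    have := pow_le_pow_left₀ (norm_nonneg v) hv 2
    nlinarith [sq_nonneg (‖u'‖ - ‖d'‖)]
  have hu : ‖u‖ ^ 2 ≤ 2 * ‖d‖ ^ 2 + 2 * (‖a‖ ^ 2 * ‖v‖ ^ 2) := by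
    have h1 : ‖u‖ ≤ ‖d‖ + ‖a‖ * ‖v‖ := by
      rw [h, ← norm_mul]; exact norm_add_le _ _
    have := pow_le_pow_left₀ (norm_nonneg u) h1 2
    nlinarith [sq_nonneg (‖d‖ - ‖a‖ * ‖v‖)]
  have hu2 : ‖u‖ ^ 2 ≤ 2 * ‖d‖ ^ 2 + 64 * ‖a‖ ^ 2 * (‖u'‖ ^ 2 + ‖d'‖ ^ 2) := by
    have := mul_le_mul_of_nonneg_left hv2 (sq_nonneg ‖a‖)
    linarith
  calc ‖u‖ₑ ^ 2 ≤ ENNReal.ofReal (2 * ‖d‖ ^ 2 + 64 * ‖a‖ ^ 2 * (‖u'‖ ^ 2 + ‖d'‖ ^ 2)) := by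
        rw [e]; exact ENNReal.ofReal_le_ofReal hu2
    _ = 2 * ‖d‖ₑ ^ 2 + 64 * ENNReal.ofReal (‖a‖ ^ 2) * (‖u'‖ₑ ^ 2 + ‖d'‖ₑ ^ 2) := by
        rw [ENNReal.ofReal_add (by positivity) (by positivity), ENNReal.ofReal_mul (by norm_num),
          ENNReal.ofReal_mul (by positivity), ENNReal.ofReal_mul (by norm_num),
          ENNReal.ofReal_add (by positivity) (by positivity), e, e, e]
        simp
    _ ≤ _ := by gcongr

lemma iUnion_dyadic_Ioc {ℓ : ℝ} (hℓ : 0 < ℓ) :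
    ⋃ j : ℕ, Ioc (ℓ / 2 ^ (j + 1)) (ℓ / 2 ^ j) = Ioc 0 ℓ := by
  ext t
  simp only [mem_iUnion, mem_Ioc]
  constructor
  · rintro ⟨j, h1, h2⟩
    exact ⟨lt_trans (by positivity) h1, h2.trans (div_le_self hℓ.le (one_le_pow₀ one_le_two))⟩
  · rintro ⟨h1, h2⟩
    obtain ⟨j, hj1, hj2⟩ := exists_nat_pow_near (x := ℓ / t) (y := 2)
      ((one_le_div h1).2 h2) one_lt_two
    refine ⟨j, ?_, ?_⟩
    · rw [div_lt_iff₀ (by positivity)]; rw [div_lt_iff₀ h1] at hj2; linarith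
    · rw [le_div_iff₀ (by positivity)]; rw [le_div_iff₀ h1] at hj1; linarith

lemma lintegral_Ioc_eq_tsum {ℓ : ℝ} (hℓ : 0 < ℓ) (F : ℝ → ℝ≥0∞) :
    ∫⁻ t in Ioc 0 ℓ, F t = ∑' j : ℕ, ∫⁻ t in Ioc (ℓ / 2 ^ (j + 1)) (ℓ / 2 ^ j), F t := by
  rw [← iUnion_dyadic_Ioc hℓ, lintegral_iUnion (fun _ => measurableSet_Ioc)]
  have hd : ∀ i j : ℕ, i < j → Disjoint (Ioc (ℓ / 2 ^ (i + 1)) (ℓ / 2 ^ i))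
      (Ioc (ℓ / 2 ^ (j + 1)) (ℓ / 2 ^ j)) := fun i j hij => by
    refine Set.disjoint_left.2 fun t h1 h2 => ?_
    have : ℓ / 2 ^ j ≤ ℓ / 2 ^ (i + 1) :=
      div_le_div_of_nonneg_left hℓ.le (by positivity) (pow_le_pow_right₀ one_le_two hij)
    exact absurd (h2.2.trans this) (not_le.2 h1.1)
  intro i j hij
  rcases hij.lt_or_gt with h | h
  · exact hd i j h
  · exact (hd j i h).symm

/-- The square of the vertical square function over one dyadic range of scales. -/
def shellSq (k : ℝ → EuclideanSpace ℝ (Fin n) → EuclideanSpace ℝ (Fin n) → ℂ)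
    (μ : Measure (EuclideanSpace ℝ (Fin n))) (f : EuclideanSpace ℝ (Fin n) → ℂ) (ℓ : ℝ) (j : ℕ)
    (x : EuclideanSpace ℝ (Fin n)) : ℝ≥0∞ :=
  ∫⁻ t in Ioc (ℓ / 2 ^ (j + 1)) (ℓ / 2 ^ j), ‖thetaFun k μ f t x‖ₑ ^ 2 / ENNReal.ofReal t

lemma measurable_shellSq {k : ℝ → EuclideanSpace ℝ (Fin n) → EuclideanSpace ℝ (Fin n) → ℂ}
    (hk : Measurable fun p : ℝ × EuclideanSpace ℝ (Fin n) × EuclideanSpace ℝ (Fin n) =>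
      k p.1 p.2.1 p.2.2)
    (μ : Measure (EuclideanSpace ℝ (Fin n))) [SFinite μ] {f : EuclideanSpace ℝ (Fin n) → ℂ}
    (hf : Measurable f) (ℓ : ℝ) (j : ℕ) : Measurable (shellSq k μ f ℓ j) := by
  have h1 : Measurable (fun q : EuclideanSpace ℝ (Fin n) × ℝ => thetaFun k μ f q.2 q.1) :=
    (measurable_theta hk μ hf).comp measurable_swap
  exact Measurable.lintegral_prod_right'
    (ν := volume.restrict (Ioc (ℓ / 2 ^ (j + 1)) (ℓ / 2 ^ j)))
    ((h1.enorm.pow_const 2).div (ENNReal.measurable_ofReal.comp measurable_snd))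

namespace StoppedPair

variable {S : StoppedPair (EuclideanSpace ℝ (Fin n)) (Fin n → ℤ)}
  {k : ℝ → EuclideanSpace ℝ (Fin n) → EuclideanSpace ℝ (Fin n) → ℂ} {m α : ℝ} {K Cμ : ℝ≥0}
  {ℓ D c₀ : ℝ}

lemma ofBounded_μ {X ι : Type*} [MeasurableSpace X] [MeasurableSpace ι] (𝒟 : CellTree X ι)
    (ρ : Measure X) [IsFiniteMeasure ρ] (f : X → ℂ)
    (A : ℝ) (hA : 0 ≤ A) (hf : Measurable f) (hfA : ∀ x, ‖f x‖ ≤ A) :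
    (ofBounded 𝒟 ρ f A hA hf hfA).μ = ρ := by
  simp only [μ, ofBounded, ENNReal.ofReal_one]
  exact withDensity_one

lemma badMajorant_of_bounded {S : StoppedPair (EuclideanSpace ℝ (Fin n)) (Fin n → ℤ)}
    (hg : ∀ x, S.g x = 1) (hh : ∀ x, ‖S.h x‖ ≤ S.A)
    (x : EuclideanSpace ℝ (Fin n)) : S.badMajorant m α K Cμ ℓ D c₀ x = 0 := by
  have h1 : ∀ l, S.bad l = fun _ => 0 := fun l => funext fun y => bad_of_bounded hg hh l y
  simp [badMajorant, badTerm, h1, comp_of_bounded hg hh, poisson]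

lemma gc_ofBounded {w : Fin n → ℝ} {f : EuclideanSpace ℝ (Fin n) → ℂ}
    {A : ℝ} (hA : 0 ≤ A) (hf : Measurable f) (hfA : ∀ x, ‖f x‖ ≤ A) (j : ℕ)
    (x : EuclideanSpace ℝ (Fin n)) :
    (ofBounded (gridTree ℓ w) S.μ f A hA hf hfA).gc j x = (S.onGrid ℓ w).gc j x := by
  rw [gc_eq_measureReal (fun _ => rfl)]
  change S.μ.real ((gridTree ℓ w).cell j x) = _
  rw [Measure.real, S.μ_apply (CellTree.measurableSet_cell j x), ENNReal.toReal_ofReal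
    (integral_nonneg fun y => S.g_nonneg y)]
  rfl

lemma integral_mul_μ (S : StoppedPair (EuclideanSpace ℝ (Fin n)) (Fin n → ℤ))
    (φ : EuclideanSpace ℝ (Fin n) → ℂ) : ∫ y, φ y ∂S.μ = ∫ y, φ y * S.g y ∂S.ρ := by
  rw [μ, integral_withDensity_eq_integral_toReal_smul S.measurable_g.ennreal_ofReal
    (Filter.Eventually.of_forall fun x => ENNReal.ofReal_lt_top)]
  refine integral_congr_ae (Filter.Eventually.of_forall fun y => ?_)
  simp only [ENNReal.toReal_ofReal (S.g_nonneg y), Complex.real_smul]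
  ring

lemma measurable_defect (S : StoppedPair (EuclideanSpace ℝ (Fin n)) (Fin n → ℤ))
    (hk : Measurable fun p : ℝ × EuclideanSpace ℝ (Fin n) × EuclideanSpace ℝ (Fin n) =>
      k p.1 p.2.1 p.2.2) (j : ℕ) (x : EuclideanSpace ℝ (Fin n)) :
    Measurable (fun t => S.defect k j t x S.h) := by
  have hx : Measurable (fun t : ℝ => (t, x)) := by fun_prop
  exact ((measurable_theta hk S.ρ S.measurable_h).comp hx).sub
    (((measurable_theta hk S.ρ (Complex.measurable_ofReal.comp S.measurable_g)).comp hx).const_mul _)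

/-- At controlled points the square function of `f` is dominated by the martingale majorant and
the maximal function of `f`. -/
lemma tsum_shellSq_le {w : Fin n → ℝ} (H : (S.onGrid ℓ w).Admissible k m α K Cμ ℓ D c₀)
    (hk : Measurable fun p : ℝ × EuclideanSpace ℝ (Fin n) × EuclideanSpace ℝ (Fin n) =>
      k p.1 p.2.1 p.2.2)
    {f : EuclideanSpace ℝ (Fin n) → ℂ} {A : ℝ} (hA : 0 ≤ A) (hf : Measurable f)
    (hfA : ∀ x, ‖f x‖ ≤ A) {E₀ : Set (EuclideanSpace ℝ (Fin n))} {lam Λ : ℝ}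
    (hE₀ : ∀ x ∈ E₀, ∫⁻ t in Ioc 0 ℓ, ‖∫ y, k t x y * S.h y ∂S.ρ‖ₑ ^ 2 / ENNReal.ofReal t ≤
      ENNReal.ofReal (lam ^ 2)) {x : EuclideanSpace ℝ (Fin n)}
    (hx : (w, x) ∈ S.controlled ℓ k (α / (2 * (m + α))) c₀ Λ E₀) :
    ∑' j, (gridGood n ℓ (α / (2 * (m + α))) c₀ j).indicator 1 (w, x) * shellSq k S.μ f ℓ j x ≤
      4 * (ofBounded (gridTree ℓ w) S.μ f A hA hf hfA).diffMajorant m α K Cμ ℓ D c₀ x +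
      64 * ENNReal.ofReal (lam ^ 2 + 4 * Λ ^ 2) *
        ⨆ l, ENNReal.ofReal
          ((ofBounded (gridTree ℓ w) S.μ f A hA hf hfA).absAvg l x ^ 2) := by
  obtain ⟨hxE, hlive, hsm, hW⟩ := hx
  set F := ofBounded (gridTree ℓ w) S.μ f A hA hf hfA with hF
  have hFμ : F.μ = S.μ := ofBounded_μ _ _ _ _ _ _ _
  have HF : F.Admissible k m α K Cμ ℓ D c₀ :=
    { H with diam := H.diam, order := by rw [hFμ]; exact H.order }
  have hℓ := H.ℓ_pos
  set N := ⨆ l, ENNReal.ofReal (F.absAvg l x ^ 2) with hN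
  set good : ℕ → ℝ≥0∞ := fun j => (gridGood n ℓ (α / (2 * (m + α))) c₀ j).indicator 1 (w, x)
    with hgood
  have hgood1 : ∀ j, good j ≤ 1 := fun j => indicator_le_self' (fun _ _ => zero_le) _
  have hgoodAt : ∀ j, good j ≠ 0 → GoodAt (gridTree ℓ w) ℓ (α / (2 * (m + α))) c₀ j x :=
    fun j hj => goodAt_of_mem_gridGood hℓ (by
      by_contra hne; exact hj (indicator_of_notMem hne _))
  have hgc : ∀ j, (S.onGrid ℓ w).gc j x ≠ 0 := fun j => gc_ne_zero hlive hsm j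
  have hgcF : ∀ j, F.gc j x ≠ 0 := fun j => by rw [hF, gc_ofBounded]; exact hgc j
  set V : ℕ → ℝ≥0∞ := fun j => ∫⁻ t in Ioc (ℓ / 2 ^ (j + 1)) (ℓ / 2 ^ j),
    ‖∫ y, k t x y * S.h y ∂S.ρ‖ₑ ^ 2 / ENNReal.ofReal t with hV
  have hshell : ∀ j, shellSq k S.μ f ℓ j x ≤
      2 * F.defectSq k ℓ j x + 64 * N * (V j + (S.onGrid ℓ w).defectSq k ℓ j x) := by
    intro j
    have hmt : Measurable (fun t : ℝ => (ENNReal.ofReal t)) := ENNReal.measurable_ofReal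
    have m1 : Measurable (fun t => ‖F.defect k j t x F.h‖ₑ ^ 2 / ENNReal.ofReal t) :=
      ((F.measurable_defect hk j x).enorm.pow_const 2).div hmt
    have m2 : Measurable (fun t => ‖(S.onGrid ℓ w).defect k j t x S.h‖ₑ ^ 2 / ENNReal.ofReal t) :=
      (((S.onGrid ℓ w).measurable_defect hk j x).enorm.pow_const 2).div hmt
    have m3 : Measurable (fun t => ‖∫ y, k t x y * S.h y ∂S.ρ‖ₑ ^ 2 / ENNReal.ofReal t) :=
      (((measurable_theta hk S.ρ S.measurable_h).comp
        (by fun_prop : Measurable (fun t : ℝ => (t, x)))).enorm.pow_const 2).div hmt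
    -- Both measures are compared with the same `θ_t μ`, which is eliminated. The average of `f` is
    -- replaced by its maximal function, which does not depend on the scale.
    have hpt : ∀ t, ‖thetaFun k S.μ f t x‖ₑ ^ 2 / ENNReal.ofReal t ≤
        2 * (‖F.defect k j t x F.h‖ₑ ^ 2 / ENNReal.ofReal t) +
        64 * N * (‖∫ y, k t x y * S.h y ∂S.ρ‖ₑ ^ 2 / ENNReal.ofReal t +
          ‖(S.onGrid ℓ w).defect k j t x S.h‖ₑ ^ 2 / ENNReal.ofReal t) := by
      intro t
      have h1 : thetaFun k S.μ f t x = F.defect k j t x F.h +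
          F.avg j x * ∫ y, k t x y * S.g y ∂S.ρ := by
        have e : ∫ y, k t x y * S.g y ∂S.ρ = ∫ y, k t x y * F.g y ∂F.ρ := by
          rw [← S.integral_mul_μ]
          refine integral_congr_ae (Filter.Eventually.of_forall fun y => ?_)
          change k t x y = k t x y * ((1 : ℝ) : ℂ)
          simp
        rw [e, defect]
        change _ = _ - F.avg j x * _ + _
        rw [sub_add_cancel]; rfl
      have h2 : ∫ y, k t x y * S.h y ∂S.ρ = (S.onGrid ℓ w).defect k j t x S.h +
          (S.onGrid ℓ w).avg j x * ∫ y, k t x y * S.g y ∂S.ρ := by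
        rw [defect]
        exact (sub_add_cancel _ _).symm
      have h3 : 1 / 4 ≤ ‖(S.onGrid ℓ w).avg j x‖ := by
        have hpos : 0 < (S.onGrid ℓ w).gc j x :=
          lt_of_le_of_ne ((S.onGrid ℓ w).gc_nonneg j x) (hgc j).symm
        rw [avg, norm_div, Complex.norm_real, Real.norm_of_nonneg hpos.le, le_div_iff₀ hpos]
        by_contra hlt
        exact hsm ⟨j, (not_le.1 hlt).le⟩
      have h4 : ENNReal.ofReal (‖F.avg j x‖ ^ 2) ≤ N :=
        (ENNReal.ofReal_le_ofReal (pow_le_pow_left₀ (norm_nonneg _)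
          (F.norm_avg_le_absAvg j x) 2)).trans
          (le_iSup (fun l => ENNReal.ofReal (F.absAvg l x ^ 2)) j)
      have := ENNReal.div_le_div_right (enorm_sq_le_of_decomposition h1 h2 h3 h4)
        (ENNReal.ofReal t)
      refine this.trans (le_of_eq ?_)
      simp only [div_eq_mul_inv]
      ring
    refine (lintegral_mono hpt).trans (le_of_eq ?_)
    rw [lintegral_add_left (m1.const_mul 2), lintegral_const_mul _ m1,
      lintegral_const_mul _ (by exact m3.add m2), lintegral_add_left m3]
    rfl
  -- A bounded density has no stopped cells, so only the square-summed majorant remains.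
  have hFd : ∑' j, good j * F.defectSq k ℓ j x ≤ 2 * F.diffMajorant m α K Cμ ℓ D c₀ x := by
    have := HF.tsum_defectSq_le hgcF (live_of_bounded (fun _ => rfl) hfA · x) hgood1 hgoodAt
    rwa [badMajorant_of_bounded (fun _ => rfl) hfA, zero_pow two_ne_zero, mul_zero,
      add_zero] at this
  have hVsum : ∑' j, V j ≤ ENNReal.ofReal (lam ^ 2) := by
    rw [hV, ← lintegral_Ioc_eq_tsum hℓ]
    exact hE₀ x hxE
  calc ∑' j, good j * shellSq k S.μ f ℓ j x
      ≤ ∑' j, (2 * (good j * F.defectSq k ℓ j x) + 64 * N * (V j +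
          good j * (S.onGrid ℓ w).defectSq k ℓ j x)) := by
        refine ENNReal.tsum_le_tsum fun j => ?_
        calc good j * shellSq k S.μ f ℓ j x
            ≤ good j * (2 * F.defectSq k ℓ j x +
              64 * N * (V j + (S.onGrid ℓ w).defectSq k ℓ j x)) := by
              gcongr; exact hshell j
          _ = 2 * (good j * F.defectSq k ℓ j x) + 64 * N * (good j * V j +
                good j * (S.onGrid ℓ w).defectSq k ℓ j x) := by ring
          _ ≤ _ := by
              gcongr
              exact mul_le_of_le_one_left' (hgood1 j)
    _ = 2 * ∑' j, good j * F.defectSq k ℓ j x + 64 * N * (∑' j, V j +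
          S.goodDefectSq ℓ k (α / (2 * (m + α))) c₀ (w, x)) := by
        rw [ENNReal.tsum_add, ENNReal.tsum_mul_left, ENNReal.tsum_mul_left, ENNReal.tsum_add]
        rfl
    _ ≤ 2 * (2 * F.diffMajorant m α K Cμ ℓ D c₀ x) + 64 * N * (ENNReal.ofReal (lam ^ 2) +
          ENNReal.ofReal (4 * Λ ^ 2)) := by gcongr
    _ = _ := by
        rw [ENNReal.ofReal_add (by positivity) (by positivity)]
        ring

/-- The constant in the averaged bound for the square function at controlled points. -/
def controlledC (m α : ℝ) (K Cμ : ℝ≥0) (D c₀ lam Λ : ℝ) : ℝ≥0∞ :=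
  8 * energyC m α K Cμ D c₀ + 256 * ENNReal.ofReal (lam ^ 2 + 4 * Λ ^ 2)

/-- Integrates the pointwise bound: the first term by the energy of the increments of `f`, the
second by Doob's inequality. Neither constant involves the sup bound `A` of `f`. -/
lemma lintegral_tsum_shellSq_le {w : Fin n → ℝ}
    (H : (S.onGrid ℓ w).Admissible k m α K Cμ ℓ D c₀)
    (hk : Measurable fun p : ℝ × EuclideanSpace ℝ (Fin n) × EuclideanSpace ℝ (Fin n) =>
      k p.1 p.2.1 p.2.2)
    {f : EuclideanSpace ℝ (Fin n) → ℂ} {A : ℝ} (hA : 0 ≤ A) (hf : Measurable f)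
    (hfA : ∀ x, ‖f x‖ ≤ A) {E₀ : Set (EuclideanSpace ℝ (Fin n))} {lam Λ : ℝ}
    (hE₀ : ∀ x ∈ E₀, ∫⁻ t in Ioc 0 ℓ, ‖∫ y, k t x y * S.h y ∂S.ρ‖ₑ ^ 2 / ENNReal.ofReal t ≤
      ENNReal.ofReal (lam ^ 2)) :
    ∫⁻ x, (S.controlled ℓ k (α / (2 * (m + α))) c₀ Λ E₀).indicator 1 (w, x) *
        ∑' j, (gridGood n ℓ (α / (2 * (m + α))) c₀ j).indicator 1 (w, x) * shellSq k S.μ f ℓ j x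
        ∂S.μ ≤ controlledC m α K Cμ D c₀ lam Λ * ∫⁻ x, ‖f x‖ₑ ^ 2 ∂S.μ := by
  set F := ofBounded (gridTree ℓ w) S.μ f A hA hf hfA with hF
  have hFμ : F.μ = S.μ := ofBounded_μ _ _ _ _ _ _ _
  have HF : F.Admissible k m α K Cμ ℓ D c₀ :=
    { H with diam := H.diam, order := by rw [hFμ]; exact H.order }
  have hFg : ∀ x, F.g x = 1 := fun _ => rfl
  set N : EuclideanSpace ℝ (Fin n) → ℝ≥0∞ := fun x => ⨆ l, ENNReal.ofReal (F.absAvg l x ^ 2)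
    with hN
  have hNm : Measurable N := Measurable.iSup fun l =>
    ((F.adapted_absAvg l).measurable.pow_const 2).ennreal_ofReal
  have hD : ∫⁻ x, F.diffMajorant m α K Cμ ℓ D c₀ x ∂S.μ ≤
      energyC m α K Cμ D c₀ * (2 * ∫⁻ x, ‖f x‖ₑ ^ 2 ∂S.μ) := by
    have h1 := lintegral_diffMajorant_le HF (sum_integral_norm_diff_sq_le_of_bounded hFg hfA)
    rw [hFμ] at h1
    refine h1.trans ?_
    gcongr
    rw [ENNReal.ofReal_mul (by norm_num), ENNReal.ofReal_ofNat,
      ofReal_integral_eq_lintegral_ofReal (integrable_norm_sq hFg hfA)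
        (Filter.Eventually.of_forall fun x => by positivity)]
    refine le_of_eq ?_
    congr 1
    refine lintegral_congr fun x => ?_
    rw [ENNReal.ofReal_pow (norm_nonneg _), ofReal_norm]; rfl
  have hNi : ∫⁻ x, N x ∂S.μ ≤ 4 * ∫⁻ x, ‖f x‖ₑ ^ 2 ∂S.μ :=
    lintegral_iSup_absAvg_sq_le hFg hfA
  calc _ ≤ ∫⁻ x, (4 * F.diffMajorant m α K Cμ ℓ D c₀ x +
          64 * ENNReal.ofReal (lam ^ 2 + 4 * Λ ^ 2) * N x) ∂S.μ := by
        refine lintegral_mono fun x => ?_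
        by_cases hx : (w, x) ∈ S.controlled ℓ k (α / (2 * (m + α))) c₀ Λ E₀
        · rw [indicator_of_mem hx, Pi.one_apply, one_mul]
          exact tsum_shellSq_le H hk hA hf hfA hE₀ hx
        · rw [indicator_of_notMem hx, zero_mul]; exact zero_le
    _ = 4 * ∫⁻ x, F.diffMajorant m α K Cμ ℓ D c₀ x ∂S.μ +
          64 * ENNReal.ofReal (lam ^ 2 + 4 * Λ ^ 2) * ∫⁻ x, N x ∂S.μ := by
        rw [lintegral_add_right _ (hNm.const_mul _), lintegral_const_mul' _ _ (by norm_num),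
          lintegral_const_mul _ hNm]
    _ ≤ 4 * (energyC m α K Cμ D c₀ * (2 * ∫⁻ x, ‖f x‖ₑ ^ 2 ∂S.μ)) +
          64 * ENNReal.ofReal (lam ^ 2 + 4 * Λ ^ 2) * (4 * ∫⁻ x, ‖f x‖ₑ ^ 2 ∂S.μ) := by
        gcongr
    _ = _ := by unfold controlledC; ring

end StoppedPair

/-! ### Averaging over the grids. -/

variable {n : ℕ}

namespace StoppedPair

variable {S : StoppedPair (EuclideanSpace ℝ (Fin n)) (Fin n → ℤ)}
  {k : ℝ → EuclideanSpace ℝ (Fin n) → EuclideanSpace ℝ (Fin n) → ℂ} {m α : ℝ} {K Cμ : ℝ≥0}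
  {ℓ D c₀ : ℝ}

/-- The points that are controlled in a large part of the grids. -/
def largeSet (S : StoppedPair (EuclideanSpace ℝ (Fin n)) (Fin n → ℤ)) (ℓ : ℝ)
    (k : ℝ → EuclideanSpace ℝ (Fin n) → EuclideanSpace ℝ (Fin n) → ℂ) (γ c₀ Λ ε : ℝ)
    (E₀ : Set (EuclideanSpace ℝ (Fin n))) : Set (EuclideanSpace ℝ (Fin n)) :=
  {x | ENNReal.ofReal (ε / 2) ≤ shiftMeasure n {w | (w, x) ∈ S.controlled ℓ k γ c₀ Λ E₀}}

lemma measurableSet_largeSet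
    (hk : Measurable fun p : ℝ × EuclideanSpace ℝ (Fin n) × EuclideanSpace ℝ (Fin n) =>
      k p.1 p.2.1 p.2.2) (γ c₀ Λ ε : ℝ) {E₀ : Set (EuclideanSpace ℝ (Fin n))}
    (hE₀ : MeasurableSet E₀) : MeasurableSet (S.largeSet ℓ k γ c₀ Λ ε E₀) :=
  measurableSet_le measurable_const
    (measurable_measure_prodMk_right (measurableSet_controlled hk γ c₀ Λ hE₀))

lemma largeSet_subset {γ c₀ Λ ε : ℝ} (hε : 0 < ε) (E₀ : Set (EuclideanSpace ℝ (Fin n))) :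
    S.largeSet ℓ k γ c₀ Λ ε E₀ ⊆ E₀ := by
  intro x hx
  by_contra hne
  have : {w | (w, x) ∈ S.controlled ℓ k γ c₀ Λ E₀} = ∅ := by
    ext w; simp only [mem_ofPred_eq, mem_empty_iff_false, iff_false]
    exact fun h => hne h.1
  rw [largeSet, mem_ofPred_eq, this, measure_empty] at hx
  simp only [nonpos_iff_eq_zero, ENNReal.ofReal_eq_zero] at hx
  linarith

/-- The local part of the square function is bounded on the points that are controlled in a large
part of the grids. -/
lemma lintegral_largeSet_tsum_shellSq_le
    (H : ∀ w, (S.onGrid ℓ w).Admissible k m α K Cμ ℓ D c₀)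
    (hk : Measurable fun p : ℝ × EuclideanSpace ℝ (Fin n) × EuclideanSpace ℝ (Fin n) =>
      k p.1 p.2.1 p.2.2)
    {f : EuclideanSpace ℝ (Fin n) → ℂ} {A : ℝ} (hA : 0 ≤ A) (hf : Measurable f)
    (hfA : ∀ x, ‖f x‖ ≤ A) {E₀ : Set (EuclideanSpace ℝ (Fin n))} (hE₀m : MeasurableSet E₀)
    {lam Λ ε : ℝ} (hε : 0 < ε)
    (hE₀ : ∀ x ∈ E₀, ∫⁻ t in Ioc 0 ℓ, ‖∫ y, k t x y * S.h y ∂S.ρ‖ₑ ^ 2 / ENNReal.ofReal t ≤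
      ENNReal.ofReal (lam ^ 2))
    (hgood : ∀ j x, shiftMeasure n {w | (w, x) ∉ gridGood n ℓ (α / (2 * (m + α))) c₀ j} ≤
      ENNReal.ofReal (ε / 4)) :
    ∫⁻ x in S.largeSet ℓ k (α / (2 * (m + α))) c₀ Λ ε E₀, ∑' j, shellSq k S.μ f ℓ j x ∂S.μ ≤
      ENNReal.ofReal (4 / ε) * (controlledC m α K Cμ D c₀ lam Λ * ∫⁻ x, ‖f x‖ₑ ^ 2 ∂S.μ) := by
  set γ := α / (2 * (m + α)) with hγ
  set Ct := S.controlled ℓ k γ c₀ Λ E₀ with hCt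
  have hCtm : MeasurableSet Ct := measurableSet_controlled hk γ c₀ Λ hE₀m
  have hGm := measurableSet_gridGood (n := n) ℓ γ c₀
  set P := shiftMeasure n with hP
  set Φ : (Fin n → ℝ) → EuclideanSpace ℝ (Fin n) → ℝ≥0∞ := fun w x => Ct.indicator 1 (w, x) *
    ∑' j, (gridGood n ℓ γ c₀ j).indicator 1 (w, x) * shellSq k S.μ f ℓ j x with hΦ
  have hsm : ∀ j, Measurable (shellSq k S.μ f ℓ j) := measurable_shellSq hk S.μ hf ℓ
  have hΦm : Measurable (Function.uncurry Φ) := by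
    have h1 : Measurable (fun p : (Fin n → ℝ) × EuclideanSpace ℝ (Fin n) =>
        Ct.indicator (1 : (Fin n → ℝ) × EuclideanSpace ℝ (Fin n) → ℝ≥0∞) p * ∑' j, (gridGood n ℓ γ c₀ j).indicator 1 p *
          shellSq k S.μ f ℓ j p.2) :=
      (measurable_one.indicator hCtm).mul (Measurable.tsum fun j =>
        (measurable_one.indicator (hGm j)).mul ((hsm j).comp measurable_snd))
    exact h1
  -- The restriction to good scales is removed scale by scale: each shell enters the average over
  -- `w` with probability at least `ε/4`, which the factor `4/ε` compensates.
  have hpt : ∀ x ∈ S.largeSet ℓ k γ c₀ Λ ε E₀, ∑' j, shellSq k S.μ f ℓ j x ≤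
      ENNReal.ofReal (4 / ε) * ∫⁻ w, Φ w x ∂P := by
    intro x hx
    have hsec : ∀ {E : Set ((Fin n → ℝ) × EuclideanSpace ℝ (Fin n))}, MeasurableSet E →
        MeasurableSet {w | (w, x) ∈ E} := fun hE => measurable_prodMk_right hE
    have e : ∫⁻ w, Φ w x ∂P =
        ∑' j, P {w | (w, x) ∈ Ct ∩ gridGood n ℓ γ c₀ j} * shellSq k S.μ f ℓ j x := by
      have e1 : ∀ w, Φ w x = ∑' j, {w | (w, x) ∈ Ct ∩ gridGood n ℓ γ c₀ j}.indicator 1 w *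
          shellSq k S.μ f ℓ j x := by
        intro w
        rw [hΦ]; simp only
        rw [← ENNReal.tsum_mul_left]
        congr 1; funext j
        rw [← mul_assoc]
        congr 1
        by_cases h1 : (w, x) ∈ Ct <;> by_cases h2 : (w, x) ∈ gridGood n ℓ γ c₀ j <;>
          simp [h1, h2, indicator]
      simp_rw [e1]
      have hm : ∀ j, Measurable ({w | (w, x) ∈ Ct ∩ gridGood n ℓ γ c₀ j}.indicator
          (1 : (Fin n → ℝ) → ℝ≥0∞)) := fun j =>
        measurable_one.indicator (hsec (hCtm.inter (hGm j)))
      rw [lintegral_tsum fun j => ((hm j).mul_const _).aemeasurable]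
      congr 1; funext j
      rw [lintegral_mul_const _ (hm j), lintegral_indicator_one (hsec (hCtm.inter (hGm j)))]
    rw [e, ← ENNReal.tsum_mul_left]
    refine ENNReal.tsum_le_tsum fun j => ?_
    rw [← mul_assoc]
    refine le_mul_of_one_le_left' ?_
    -- Being controlled has probability at least `ε/2` and being bad at scale `j` at most `ε/4`. No
    -- independence of the two events is needed.
    have h1 : ENNReal.ofReal (ε / 2) ≤ P {w | (w, x) ∈ Ct ∩ gridGood n ℓ γ c₀ j} +
        ENNReal.ofReal (ε / 4) := by
      have hx' : ENNReal.ofReal (ε / 2) ≤ P {w | (w, x) ∈ Ct} := hx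
      refine hx'.trans (le_trans (measure_mono ?_) ((measure_union_le _ _).trans
        (add_le_add le_rfl (hgood j x))))
      intro w hw
      by_cases h2 : (w, x) ∈ gridGood n ℓ γ c₀ j
      · exact Or.inl ⟨hw, h2⟩
      · exact Or.inr h2
    rw [show ε / 2 = ε / 4 + ε / 4 by ring, ENNReal.ofReal_add (by positivity) (by positivity),
      ENNReal.add_le_add_iff_right ENNReal.ofReal_ne_top] at h1
    calc (1 : ℝ≥0∞) = ENNReal.ofReal (4 / ε) * ENNReal.ofReal (ε / 4) := by
          rw [← ENNReal.ofReal_mul (by positivity), ← ENNReal.ofReal_one]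
          congr 1; field_simp
      _ ≤ _ := by gcongr
  calc ∫⁻ x in S.largeSet ℓ k γ c₀ Λ ε E₀, ∑' j, shellSq k S.μ f ℓ j x ∂S.μ
      ≤ ∫⁻ x in S.largeSet ℓ k γ c₀ Λ ε E₀, ENNReal.ofReal (4 / ε) * ∫⁻ w, Φ w x ∂P ∂S.μ :=
        setLIntegral_mono' (measurableSet_largeSet hk γ c₀ Λ ε hE₀m) hpt
    _ ≤ ∫⁻ x, ENNReal.ofReal (4 / ε) * ∫⁻ w, Φ w x ∂P ∂S.μ := setLIntegral_le_lintegral _ _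
    _ = ENNReal.ofReal (4 / ε) * ∫⁻ w, ∫⁻ x, Φ w x ∂S.μ ∂P := by
        rw [lintegral_const_mul' _ _ ENNReal.ofReal_ne_top,
          lintegral_lintegral_swap hΦm.aemeasurable]
    _ ≤ ENNReal.ofReal (4 / ε) * ∫⁻ _w, controlledC m α K Cμ D c₀ lam Λ *
          ∫⁻ x, ‖f x‖ₑ ^ 2 ∂S.μ ∂P := by
        gcongr with w
        exact lintegral_tsum_shellSq_le (H w) hk hA hf hfA hE₀
    _ = _ := by simp

end StoppedPair

/-- The square of the vertical square function. -/
def squareSq (k : ℝ → EuclideanSpace ℝ (Fin n) → EuclideanSpace ℝ (Fin n) → ℂ)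
    (μ : Measure (EuclideanSpace ℝ (Fin n))) (f : EuclideanSpace ℝ (Fin n) → ℂ)
    (x : EuclideanSpace ℝ (Fin n)) : ℝ≥0∞ :=
  ∫⁻ t in Ioi (0 : ℝ), ‖thetaFun k μ f t x‖ₑ ^ 2 / ENNReal.ofReal t

/-! ### Large scales, and the passage from bounded to square integrable functions. -/

section Tail

variable {k : ℝ → EuclideanSpace ℝ (Fin n) → EuclideanSpace ℝ (Fin n) → ℂ} {m α : ℝ} {K : ℝ≥0}

lemma enorm_thetaFun_sq_le (hk : IsSquareKernel k m α K) (hm : 0 < m) (hα : 0 < α)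
    (μ : Measure (EuclideanSpace ℝ (Fin n))) {f : EuclideanSpace ℝ (Fin n) → ℂ}
    (hf : Measurable f) {t : ℝ} (ht : 0 < t) (x : EuclideanSpace ℝ (Fin n)) :
    ‖thetaFun k μ f t x‖ₑ ^ 2 ≤ ENNReal.ofReal ((K * t ^ (-m)) ^ 2) *
      (μ univ * ∫⁻ y, ‖f y‖ₑ ^ 2 ∂μ) := by
  have h1 : ‖thetaFun k μ f t x‖ₑ ≤ ENNReal.ofReal (K * t ^ (-m)) * ∫⁻ y, ‖f y‖ₑ ∂μ := by
    refine (enorm_integral_le_lintegral_enorm _).trans ?_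
    rw [← lintegral_const_mul' _ _ ENNReal.ofReal_ne_top]
    refine lintegral_mono fun y => ?_
    rw [enorm_mul]
    gcongr
    rw [← ofReal_norm]
    exact ENNReal.ofReal_le_ofReal (hk.norm_le hm hα ht x y)
  have h2 : (∫⁻ y, ‖f y‖ₑ ∂μ) ^ 2 ≤ μ univ * ∫⁻ y, ‖f y‖ₑ ^ 2 ∂μ := by
    simpa using sq_lintegral_mul_le μ (p := fun _ => 1) measurable_const hf.enorm
  calc ‖thetaFun k μ f t x‖ₑ ^ 2 ≤ (ENNReal.ofReal (K * t ^ (-m)) * ∫⁻ y, ‖f y‖ₑ ∂μ) ^ 2 := by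
        gcongr
    _ = ENNReal.ofReal ((K * t ^ (-m)) ^ 2) * (∫⁻ y, ‖f y‖ₑ ∂μ) ^ 2 := by
        rw [mul_pow, ENNReal.ofReal_pow (by positivity)]
    _ ≤ _ := by gcongr

/-- The uniform bound `K t^(-m)` for the kernel and Cauchy–Schwarz reduce this to the convergent
integral of `t^(-2m-1)` over `(ℓ, ∞)`. -/
lemma lintegral_Ioi_thetaFun_le (hk : IsSquareKernel k m α K) (hm : 0 < m) (hα : 0 < α)
    (μ : Measure (EuclideanSpace ℝ (Fin n))) {f : EuclideanSpace ℝ (Fin n) → ℂ}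
    (hf : Measurable f) {ℓ : ℝ} (hℓ : 0 < ℓ) (x : EuclideanSpace ℝ (Fin n)) :
    ∫⁻ t in Ioi ℓ, ‖thetaFun k μ f t x‖ₑ ^ 2 / ENNReal.ofReal t ≤
      ENNReal.ofReal (K ^ 2 * (ℓ ^ (-m)) ^ 2 / (2 * m)) * (μ univ * ∫⁻ y, ‖f y‖ₑ ^ 2 ∂μ) := by
  set R := μ univ * ∫⁻ y, ‖f y‖ₑ ^ 2 ∂μ with hR
  have hpt : ∀ t ∈ Ioi ℓ, ‖thetaFun k μ f t x‖ₑ ^ 2 / ENNReal.ofReal t ≤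
      ENNReal.ofReal (K ^ 2 * t ^ (-2 * m - 1)) * R := by
    intro t ht
    have ht0 : 0 < t := hℓ.trans ht
    refine (ENNReal.div_le_div_right (enorm_thetaFun_sq_le hk hm hα μ hf ht0 x) _).trans
      (le_of_eq ?_)
    rw [div_eq_mul_inv, mul_right_comm, ← div_eq_mul_inv, ← ENNReal.ofReal_div_of_pos ht0]
    congr 2
    rw [Real.rpow_sub_one ht0.ne', mul_pow, ← Real.rpow_natCast (t ^ (-m)),
      ← Real.rpow_mul ht0.le, mul_div_assoc]
    congr 3
    push_cast; ring
  have hmeas : Measurable (fun t : ℝ => ENNReal.ofReal (K ^ 2 * t ^ (-2 * m - 1))) := by fun_prop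
  refine (setLIntegral_mono' measurableSet_Ioi hpt).trans ?_
  rw [lintegral_mul_const _ hmeas]
  gcongr
  have hi := (integrableOn_Ioi_rpow_of_lt (a := -2 * m - 1) (by linarith) hℓ).const_mul
    ((K : ℝ) ^ 2)
  rw [← ofReal_integral_eq_lintegral_ofReal hi]
  · refine ENNReal.ofReal_le_ofReal (le_of_eq ?_)
    rw [integral_const_mul, integral_Ioi_rpow_of_lt (by linarith) hℓ,
      ← Real.rpow_natCast (ℓ ^ (-m)), ← Real.rpow_mul hℓ.le, mul_div_assoc]
    congr 1
    rw [show -2 * m - 1 + 1 = -(2 * m) by ring, neg_div_neg_eq]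
    congr 2
    push_cast; ring
  · refine (ae_restrict_iff' measurableSet_Ioi).2 (Filter.Eventually.of_forall fun t ht => ?_)
    have : 0 < t := hℓ.trans ht
    change 0 ≤ (K : ℝ) ^ 2 * t ^ (-2 * m - 1)
    positivity

lemma squareSq_eq_tsum_shellSq_add (μ : Measure (EuclideanSpace ℝ (Fin n)))
    (f : EuclideanSpace ℝ (Fin n) → ℂ) {ℓ : ℝ} (hℓ : 0 < ℓ) (x : EuclideanSpace ℝ (Fin n)) :
    squareSq k μ f x =
      ∑' j, shellSq k μ f ℓ j x +
        ∫⁻ t in Ioi ℓ, ‖thetaFun k μ f t x‖ₑ ^ 2 / ENNReal.ofReal t := by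
  rw [squareSq, ← Ioc_union_Ioi_eq_Ioi hℓ.le, lintegral_union measurableSet_Ioi
    (Set.disjoint_left.2 fun t h1 h2 => not_lt.2 h1.2 h2), lintegral_Ioc_eq_tsum hℓ]
  rfl

/-- A bound for the square function on bounded functions extends to all square integrable
functions. -/
lemma lintegral_squareSq_le_of_bounded (hk : IsSquareKernel k m α K) (hm : 0 < m) (hα : 0 < α)
    (hkm : Measurable fun p : ℝ × EuclideanSpace ℝ (Fin n) × EuclideanSpace ℝ (Fin n) =>
      k p.1 p.2.1 p.2.2)
    (μ : Measure (EuclideanSpace ℝ (Fin n))) [IsFiniteMeasure μ]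
    (G : Set (EuclideanSpace ℝ (Fin n))) {C : ℝ≥0∞}
    (hC : ∀ (f : EuclideanSpace ℝ (Fin n) → ℂ) (A : ℝ), 0 ≤ A → Measurable f → (∀ x, ‖f x‖ ≤ A) →
      ∫⁻ x in G, squareSq k μ f x ∂μ ≤
        C * ∫⁻ x, ‖f x‖ₑ ^ 2 ∂μ)
    {f : EuclideanSpace ℝ (Fin n) → ℂ} (hf : Measurable f) (hf2 : MemLp f 2 μ) :
    ∫⁻ x in G, squareSq k μ f x ∂μ ≤
      C * ∫⁻ x, ‖f x‖ₑ ^ 2 ∂μ := by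
  -- Truncation of large values. For each `t` and `x` the transforms converge by dominated
  -- convergence, and Fatou's lemma, once in `t` and once in `x`, passes the bound to the limit.
  set F : ℕ → EuclideanSpace ℝ (Fin n) → ℂ := fun N => {x | ‖f x‖ ≤ N}.indicator f with hF
  have hFm : ∀ N, Measurable (F N) := fun N =>
    hf.indicator (measurableSet_le hf.norm measurable_const)
  have hFN : ∀ N x, ‖F N x‖ ≤ N := fun N x => by
    by_cases hx : ‖f x‖ ≤ N
    · rw [hF]; simp only; rwa [indicator_of_mem (by exact hx)]
    · rw [hF]; simp only
      rw [indicator_of_notMem (by exact hx), norm_zero]; positivity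
  have hFf : ∀ N x, ‖F N x‖ ≤ ‖f x‖ := fun N x => norm_indicator_le_norm_self f x
  have hFlim : ∀ x, Filter.Tendsto (fun N => F N x) Filter.atTop (nhds (f x)) := by
    intro x
    obtain ⟨N₀, hN₀⟩ := exists_nat_ge ‖f x‖
    refine tendsto_const_nhds.congr' ?_
    filter_upwards [Filter.eventually_ge_atTop N₀] with N hN
    rw [hF]; simp only
    rw [indicator_of_mem]
    exact hN₀.trans (by exact_mod_cast hN)
  have hfi : Integrable f μ := hf2.integrable (by norm_num)
  have hθ : ∀ t, 0 < t → ∀ x, Filter.Tendsto (fun N => thetaFun k μ (F N) t x) Filter.atTop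
      (nhds (thetaFun k μ f t x)) := by
    intro t ht x
    refine tendsto_integral_of_dominated_convergence (fun y => ‖k t x y * f y‖)
      (fun N => ((hk.measurable_right ht x).mul (hFm N)).aestronglyMeasurable)
      (hk.integrable_mul hm hα ht x hfi).norm (fun N => Filter.Eventually.of_forall fun y => ?_)
      (Filter.Eventually.of_forall fun y => (hFlim y).const_mul _)
    rw [norm_mul, norm_mul]
    gcongr
    exact hFf N y
  have hmeas2 : ∀ N, Measurable (fun q : EuclideanSpace ℝ (Fin n) × ℝ =>
      ‖thetaFun k μ (F N) q.2 q.1‖ₑ ^ 2 / ENNReal.ofReal q.2) := fun N =>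
    (((measurable_theta hkm μ (hFm N)).comp measurable_swap).enorm.pow_const 2).div
      (ENNReal.measurable_ofReal.comp measurable_snd)
  have hmeas0 : ∀ x N, Measurable (fun t : ℝ =>
      ‖thetaFun k μ (F N) t x‖ₑ ^ 2 / ENNReal.ofReal t) := fun x N =>
    (((measurable_theta hkm μ (hFm N)).comp
      (by fun_prop : Measurable fun t : ℝ => (t, x))).enorm.pow_const 2).div
      ENNReal.measurable_ofReal
  have hmeas1 : ∀ N, Measurable (fun x => squareSq k μ (F N) x) := fun N =>
    Measurable.lintegral_prod_right' (ν := volume.restrict (Ioi 0)) (hmeas2 N)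
  have hpt : ∀ x, squareSq k μ f x ≤
      Filter.liminf (fun N => squareSq k μ (F N) x)
        Filter.atTop := by
    intro x
    refine le_trans (setLIntegral_mono' measurableSet_Ioi fun t ht => le_of_eq ?_)
      (lintegral_liminf_le (hmeas0 x))
    refine (Filter.Tendsto.liminf_eq ?_).symm
    have h1 : Filter.Tendsto (fun N => ‖thetaFun k μ (F N) t x‖ₑ ^ 2) Filter.atTop
        (nhds (‖thetaFun k μ f t x‖ₑ ^ 2)) := ENNReal.Tendsto.pow (hθ t ht x).enorm
    exact ENNReal.Tendsto.div_const h1 (Or.inr (by simpa using ht))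
  calc _ ≤ ∫⁻ x in G, Filter.liminf (fun N => squareSq k μ (F N) x) Filter.atTop ∂μ := lintegral_mono hpt
    _ ≤ Filter.liminf (fun N => ∫⁻ x in G, squareSq k μ (F N) x ∂μ) Filter.atTop :=
        lintegral_liminf_le hmeas1
    _ ≤ _ := by
        refine Filter.liminf_le_of_frequently_le' (Filter.Frequently.of_forall fun N => ?_)
        refine (hC (F N) N (by positivity) (hFm N) (hFN N)).trans ?_
        gcongr with x
        rw [← ofReal_norm, ← ofReal_norm]
        exact ENNReal.ofReal_le_ofReal (hFf N x)

end Tail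

/-! ### Cubes, and reduction to densities and to the restriction of `μ` to the cube. -/

variable {n : ℕ}

lemma Cube.measurableSet (Q : Cube n) : MeasurableSet Q.toSet := by
  have : Q.toSet = ⋂ i, {x : EuclideanSpace ℝ (Fin n) | |x i - Q.center i| ≤ Q.side / 2} := by
    ext x; simp [Cube.toSet]
  rw [this]
  exact MeasurableSet.iInter fun i => measurableSet_le (by fun_prop) measurable_const

lemma Cube.subset_ball (Q : Cube n) :
    Q.toSet ⊆ Metric.ball Q.center ((n + 1) * Q.side) := by
  intro x hx
  have hs := Q.side_pos
  rw [Metric.mem_ball, dist_eq_norm]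
  have h2 : ‖x - Q.center‖ ^ 2 < ((n + 1 : ℝ) * Q.side) ^ 2 := by
    rw [EuclideanSpace.norm_sq_eq]
    calc ∑ i, ‖(x - Q.center) i‖ ^ 2 ≤ ∑ _i : Fin n, (Q.side / 2) ^ 2 := by
          refine Finset.sum_le_sum fun i _ => ?_
          exact pow_le_pow_left₀ (norm_nonneg _) (hx i) 2
      _ = n * (Q.side / 2) ^ 2 := by simp
      _ < _ := by
          have h0 : (0 : ℝ) ≤ n := Nat.cast_nonneg n
          have h1 : 0 < Q.side ^ 2 := by positivity
          nlinarith [mul_nonneg h0 h1.le, mul_nonneg (mul_nonneg h0 h0) h1.le]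
  exact lt_of_pow_lt_pow_left₀ 2 (by positivity) h2

lemma Cube.measure_le (Q : Cube n) {μ : Measure (EuclideanSpace ℝ (Fin n))} {m : ℝ} {C : ℝ≥0}
    (hμ : IsOfOrder μ m C) : μ Q.toSet ≤ ENNReal.ofReal (C * (n + 1) ^ m * Q.side ^ m) := by
  have hs := Q.side_pos
  refine (measure_mono Q.subset_ball).trans ((hμ _ _ (by positivity)).trans (le_of_eq ?_))
  rw [Real.mul_rpow (by positivity) hs.le, mul_assoc]

section Reduction

variable {k : ℝ → EuclideanSpace ℝ (Fin n) → EuclideanSpace ℝ (Fin n) → ℂ} {m α : ℝ} {K : ℝ≥0}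

lemma thetaMeasure_withDensity (hk : IsSquareKernel k m α K) (hm : 0 < m) (hα : 0 < α)
    {ρ : Measure (EuclideanSpace ℝ (Fin n))} {h : EuclideanSpace ℝ (Fin n) → ℂ}
    (hhm : Measurable h) (hh : Integrable h ρ) {t : ℝ} (ht : 0 < t)
    (x : EuclideanSpace ℝ (Fin n)) :
    thetaMeasure k (ρ.withDensityᵥ h) t x = ∫ y, k t x y * h y ∂ρ := by
  have : IsFiniteMeasure (ρ.withDensity fun x => ‖h x‖ₑ) := isFiniteMeasure_withDensity hh.2.ne
  refine vectorMeasure_integral_withDensity hhm hh ?_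
  exact Integrable.of_bound (hk.measurable_right ht x).aestronglyMeasurable (K * t ^ (-m))
    (Filter.Eventually.of_forall fun y => hk.norm_le hm hα ht x y)

lemma squareTrunc_withDensity (hk : IsSquareKernel k m α K) (hm : 0 < m) (hα : 0 < α)
    {ρ : Measure (EuclideanSpace ℝ (Fin n))} {h : EuclideanSpace ℝ (Fin n) → ℂ}
    (hhm : Measurable h) (hh : Integrable h ρ) (Q : Cube n) (x : EuclideanSpace ℝ (Fin n)) :
    squareTrunc k Q (ρ.withDensityᵥ h) x =
      (∫⁻ t in Ioc 0 Q.side, ‖∫ y, k t x y * h y ∂ρ‖ₑ ^ 2 / ENNReal.ofReal t) ^ (1 / 2 : ℝ) := by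
  unfold squareTrunc
  congr 1
  rw [← setLIntegral_congr Ioo_ae_eq_Ioc]
  refine setLIntegral_congr_fun measurableSet_Ioo fun t ht => ?_
  simp only [thetaMeasure_withDensity hk hm hα hhm hh ht.1]

lemma ennreal_rpow_half_sq (a : ℝ≥0∞) : (a ^ (1 / 2 : ℝ)) ^ 2 = a := by
  rw [← ENNReal.rpow_natCast, ← ENNReal.rpow_mul]; norm_num

lemma eLpNorm_two_sq {β : Type*} [MeasurableSpace β] {E : Type*} [TopologicalSpace E]
    [ContinuousENorm E] (μ : Measure β) (f : β → E) :
    eLpNorm f 2 μ ^ 2 = ∫⁻ x, ‖f x‖ₑ ^ 2 ∂μ := by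
  rw [eLpNorm_eq_lintegral_rpow_enorm_toReal (by norm_num) (by norm_num)]
  simp only [ENNReal.toReal_ofNat, ENNReal.rpow_ofNat]
  exact ennreal_rpow_half_sq _

/-- A bound for the square of the square function with respect to the restriction of `μ` to a set
`E ⊇ G` gives the bound for functions vanishing outside `G`. -/
lemma eLpNorm_indicator_squareFun_le {μ : Measure (EuclideanSpace ℝ (Fin n))} {E G : Set (EuclideanSpace ℝ (Fin n))}
    (hG : MeasurableSet G) (hGE : G ⊆ E) {C : ℝ≥0}
    (hC : ∀ f : EuclideanSpace ℝ (Fin n) → ℂ, Measurable f → MemLp f 2 (μ.restrict E) →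
      ∫⁻ x in G, squareSq k (μ.restrict E) f x ∂(μ.restrict E) ≤
        (C : ℝ≥0∞) ^ 2 * ∫⁻ x, ‖f x‖ₑ ^ 2 ∂(μ.restrict E))
    {f : EuclideanSpace ℝ (Fin n) → ℂ} (hf : MemLp f 2 μ) (hf0 : ∀ᵐ x ∂μ, x ∉ G → f x = 0) :
    eLpNorm (G.indicator (squareFun k μ f)) 2 μ ≤ C * eLpNorm f 2 μ := by
  set f' := G.indicator (hf.1.mk f) with hf'
  have hfm : Measurable f' := hf.1.stronglyMeasurable_mk.measurable.indicator hG
  have hae : f =ᵐ[μ] f' := by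
    filter_upwards [hf0, hf.1.ae_eq_mk] with x h1 h2
    by_cases hx : x ∈ G
    · rw [hf', indicator_of_mem hx, h2]
    · rw [hf', indicator_of_notMem hx, h1 hx]
  -- The representative `f'` vanishes everywhere off `G ⊆ E`, so restricting the measure to `E`
  -- changes no integral.
  have hθ : ∀ t x, thetaFun k μ f t x = thetaFun k (μ.restrict E) f' t x := by
    intro t x
    unfold thetaFun
    rw [setIntegral_eq_integral_of_forall_compl_eq_zero fun y hy => by
      rw [hf', indicator_of_notMem (fun h => hy (hGE h)), mul_zero]]
    refine integral_congr_ae ?_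
    filter_upwards [hae] with y hy
    rw [hy]
  have hsq : ∀ x, squareFun k μ f x ^ 2 = squareSq k (μ.restrict E) f' x := by
    intro x
    unfold squareFun squareSq
    rw [ennreal_rpow_half_sq]
    simp_rw [hθ]
  have h1 : eLpNorm (G.indicator (squareFun k μ f)) 2 μ ^ 2 =
      ∫⁻ x in G, squareSq k (μ.restrict E) f' x ∂(μ.restrict E) := by
    rw [eLpNorm_two_sq, Measure.restrict_restrict hG, inter_eq_self_of_subset_left hGE,
      ← lintegral_indicator hG]
    refine lintegral_congr fun x => ?_
    by_cases hx : x ∈ G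
    · rw [indicator_of_mem hx, indicator_of_mem hx, ← hsq]; rfl
    · rw [indicator_of_notMem hx, indicator_of_notMem hx]; simp
  have h2 : ∫⁻ x, ‖f' x‖ₑ ^ 2 ∂(μ.restrict E) ≤ eLpNorm f 2 μ ^ 2 := by
    rw [eLpNorm_congr_ae hae, eLpNorm_two_sq]
    exact setLIntegral_le_lintegral _ _
  have h3 : eLpNorm (G.indicator (squareFun k μ f)) 2 μ ^ 2 ≤ (C * eLpNorm f 2 μ) ^ 2 := by
    rw [h1, mul_pow]
    refine (hC f' hfm ((hf.ae_eq hae).restrict E)).trans ?_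
    gcongr
  exact (ENNReal.pow_le_pow_left_iff two_ne_zero).1 h3

end Reduction

/-! ### Assembly of small and large scales. -/

variable {n : ℕ}

namespace StoppedPair

variable {S : StoppedPair (EuclideanSpace ℝ (Fin n)) (Fin n → ℤ)}
  {k : ℝ → EuclideanSpace ℝ (Fin n) → EuclideanSpace ℝ (Fin n) → ℂ} {m α : ℝ} {K Cμ : ℝ≥0}
  {ℓ D c₀ : ℝ}

/-- The square function is bounded on the points that are controlled in a large part of the
grids. -/
lemma lintegral_largeSet_squareSq_le
    (H : ∀ w, (S.onGrid ℓ w).Admissible k m α K Cμ ℓ D c₀)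
    (hk : Measurable fun p : ℝ × EuclideanSpace ℝ (Fin n) × EuclideanSpace ℝ (Fin n) =>
      k p.1 p.2.1 p.2.2)
    {E₀ : Set (EuclideanSpace ℝ (Fin n))} (hE₀m : MeasurableSet E₀)
    {lam Λ ε R : ℝ} (hε : 0 < ε) (hR : 0 ≤ R)
    (hE₀ : ∀ x ∈ E₀, ∫⁻ t in Ioc 0 ℓ, ‖∫ y, k t x y * S.h y ∂S.ρ‖ₑ ^ 2 / ENNReal.ofReal t ≤
      ENNReal.ofReal (lam ^ 2))
    (hgood : ∀ j x, shiftMeasure n {w | (w, x) ∉ gridGood n ℓ (α / (2 * (m + α))) c₀ j} ≤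
      ENNReal.ofReal (ε / 4)) (hμ : S.μ univ ≤ ENNReal.ofReal (R * ℓ ^ m))
    {f : EuclideanSpace ℝ (Fin n) → ℂ} (hf : Measurable f) (hf2 : MemLp f 2 S.μ) :
    ∫⁻ x in S.largeSet ℓ k (α / (2 * (m + α))) c₀ Λ ε E₀, squareSq k S.μ f x ∂S.μ ≤
      (ENNReal.ofReal (4 / ε) * controlledC m α K Cμ D c₀ lam Λ +
        ENNReal.ofReal (K ^ 2 * R ^ 2 / (2 * m))) * ∫⁻ x, ‖f x‖ₑ ^ 2 ∂S.μ := by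
  have H₀ := H 0
  have hm := H₀.m_pos
  have hℓ := H₀.ℓ_pos
  refine lintegral_squareSq_le_of_bounded H₀.kernel hm H₀.α_pos hk S.μ _ ?_ hf hf2
  intro f A hA hf hfA
  set I := ∫⁻ x, ‖f x‖ₑ ^ 2 ∂S.μ with hI
  set G := S.largeSet ℓ k (α / (2 * (m + α))) c₀ Λ ε E₀ with hG
  simp_rw [squareSq_eq_tsum_shellSq_add (k := k) S.μ f hℓ]
  rw [lintegral_add_left (Measurable.tsum fun j => measurable_shellSq hk S.μ hf ℓ j), add_mul]
  refine add_le_add ?_ ?_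
  · rw [mul_assoc]
    exact lintegral_largeSet_tsum_shellSq_le H hk hA hf hfA hE₀m hε hE₀ hgood
  · have hpt := lintegral_Ioi_thetaFun_le H₀.kernel hm H₀.α_pos S.μ hf hℓ
    calc _ ≤ ∫⁻ _x in G, ENNReal.ofReal (K ^ 2 * (ℓ ^ (-m)) ^ 2 / (2 * m)) * (S.μ univ * I) ∂S.μ :=
          lintegral_mono hpt
      _ = ENNReal.ofReal (K ^ 2 * (ℓ ^ (-m)) ^ 2 / (2 * m)) * (S.μ univ * I) * S.μ G :=
          setLIntegral_const _ _
      -- Cauchy–Schwarz and the integration in `x` each contribute one factor of total mass, at most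
      -- `R ℓ^m`; together they cancel `ℓ^(-2m)`.
      _ ≤ ENNReal.ofReal (K ^ 2 * (ℓ ^ (-m)) ^ 2 / (2 * m)) * (ENNReal.ofReal (R * ℓ ^ m) * I) *
          ENNReal.ofReal (R * ℓ ^ m) := by
          gcongr
          exact (measure_mono (subset_univ _)).trans hμ
      _ = ENNReal.ofReal (K ^ 2 * (ℓ ^ (-m)) ^ 2 / (2 * m)) * ENNReal.ofReal (R * ℓ ^ m) *
          ENNReal.ofReal (R * ℓ ^ m) * I := by ring
      _ = _ := by
          rw [← ENNReal.ofReal_mul (by positivity), ← ENNReal.ofReal_mul (by positivity)]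
          congr 2
          rw [Real.rpow_neg hℓ.le]
          have : 0 < ℓ ^ m := by positivity
          field_simp

end StoppedPair

/-- The measure of the points where the truncated square function is large. -/
lemma measure_squareTrunc_gt_le {k : ℝ → EuclideanSpace ℝ (Fin n) → EuclideanSpace ℝ (Fin n) → ℂ}
    {μ : Measure (EuclideanSpace ℝ (Fin n))} {Q : Cube n}
    {ν : ComplexMeasure (EuclideanSpace ℝ (Fin n))} {E : Set (EuclideanSpace ℝ (Fin n))}
    {s : ℝ} {B₁ B₂ : ℝ≥0} {M lam ε : ℝ} (hlam : 0 < lam) (hM : 0 ≤ M)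
    (h : (⨆ (r : ℝ) (_ : 0 < r), ENNReal.ofReal (r ^ s) *
      μ {x | x ∈ E ∧ ENNReal.ofReal r < squareTrunc k Q ν x}) ≤ B₂ * ν.variation univ)
    (hν : ν.variation univ ≤ B₁ * ENNReal.ofReal M) (hl : B₁ * B₂ ≤ ε * lam ^ s) :
    μ {x | x ∈ E ∧ ENNReal.ofReal lam < squareTrunc k Q ν x} ≤ ENNReal.ofReal (ε * M) := by
  have hpos : 0 < lam ^ s := by positivity
  have h1 := (le_iSup₂ (f := fun (r : ℝ) (_ : 0 < r) => ENNReal.ofReal (r ^ s) *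
      μ {x | x ∈ E ∧ ENNReal.ofReal r < squareTrunc k Q ν x}) lam hlam).trans h
  have hε : 0 ≤ ε := by
    by_contra hneg
    have : (0 : ℝ) ≤ B₁ * B₂ := by positivity
    nlinarith
  have h2 : ENNReal.ofReal (lam ^ s) *
      μ {x | x ∈ E ∧ ENNReal.ofReal lam < squareTrunc k Q ν x} ≤
      ENNReal.ofReal (lam ^ s) * ENNReal.ofReal (ε * M) := by
    refine h1.trans ?_
    calc (B₂ : ℝ≥0∞) * ν.variation univ ≤ B₂ * (B₁ * ENNReal.ofReal M) := by gcongr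
      _ = ENNReal.ofReal (B₁ * B₂ * M) := by
          rw [ENNReal.ofReal_mul (by positivity), ENNReal.ofReal_mul (by positivity),
            ENNReal.ofReal_coe_nnreal, ENNReal.ofReal_coe_nnreal]
          ring
      _ ≤ ENNReal.ofReal (lam ^ s * (ε * M)) := by
          refine ENNReal.ofReal_le_ofReal ?_
          calc B₁ * B₂ * M ≤ ε * lam ^ s * M := by gcongr
            _ = _ := by ring
      _ = _ := ENNReal.ofReal_mul hpos.le
  rwa [ENNReal.mul_le_mul_iff_right (by simpa using hpos) ENNReal.ofReal_ne_top] at h2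

end VerticalSquareFunction

end

/-! ### Choice of the constants and proof of the theorem. -/

theorem proposition2p3 (n : ℕ) (m α : ℝ) (hm : 0 < m) (hα : 0 < α) (K Cμ B₁ B₂ ε₀ : ℝ≥0)
    (hε₀ : 0 < ε₀) (hε₀' : ε₀ < 1) (s : ℝ) (hs : 0 < s) :
    ∃ c C : ℝ≥0, 0 < c ∧
      ∀ (k : ℝ → EuclideanSpace ℝ (Fin n) → EuclideanSpace ℝ (Fin n) → ℂ)
        (μ : Measure (EuclideanSpace ℝ (Fin n))) (Q : Cube n)
        (ν : ComplexMeasure (EuclideanSpace ℝ (Fin n))) (U : Set (EuclideanSpace ℝ (Fin n))),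
        IsSquareKernel k m α K →
        IsOfOrder μ m Cμ →
        ν.variation.support ⊆ Q.toSet →
        ν Q.toSet = (μ.real Q.toSet : ℂ) →
        ν.variation univ ≤ B₁ * μ Q.toSet →
        (∀ A ⊆ Q.toSet, MeasurableSet A → μ A ≤ ε₀ * μ Q.toSet →
          ν.variation A ≤ ν.variation univ / (32 * B₁)) →
        MeasurableSet U →
        ν.variation U ≤ ν.variation univ / (16 * B₁) →
        (⨆ (r : ℝ) (_ : 0 < r), ENNReal.ofReal (r ^ s) *
          μ {x | x ∈ Q.toSet \ U ∧ ENNReal.ofReal r < squareTrunc k Q ν x})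
            ≤ B₂ * ν.variation univ →
        ∃ G : Set (EuclideanSpace ℝ (Fin n)), MeasurableSet G ∧ G ⊆ Q.toSet \ U ∧
          c * μ Q.toSet ≤ μ G ∧
          ∀ f : EuclideanSpace ℝ (Fin n) → ℂ, MemLp f 2 μ → (∀ᵐ x ∂μ, x ∉ G → f x = 0) →
            eLpNorm (G.indicator (squareFun k μ f)) 2 μ ≤ C * eLpNorm f 2 μ := by
  obtain ⟨ε, hε⟩ : ∃ ε : ℝ, ε = ε₀ := ⟨_, rfl⟩
  obtain ⟨B, hB⟩ : ∃ B : ℝ, B = B₁ := ⟨_, rfl⟩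
  have hε0 : 0 < ε := by rw [hε]; exact_mod_cast hε₀
  have hε1 : ε < 1 := by rw [hε]; exact_mod_cast hε₀'
  have hB0 : 0 ≤ B := by rw [hB]; exact B₁.2
  set γ := α / (2 * (m + α)) with hγ
  have hγ0 : 0 < γ := by positivity
  have hq1 : (2 : ℝ) ^ (-γ) < 1 := Real.rpow_lt_one_of_one_lt_of_neg one_lt_two (by linarith)
  have hq3 : 1 - (2 : ℝ) ^ (-γ) ≠ 0 := (sub_pos.2 hq1).ne'
  have hq2 : 0 < (1 - (2 : ℝ) ^ (-γ))⁻¹ := inv_pos.2 (by linarith)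
  -- Makes the probability of being bad at a given scale at most `ε/4`; `n + 1` replaces `n` to
  -- avoid division by zero in dimension `0`.
  obtain ⟨c₀, hc₀, hc₀1, hc₀ε⟩ : ∃ c₀ : ℝ, 0 < c₀ ∧ c₀ ≤ 1 ∧
      4 * n * c₀ * (1 - (2 : ℝ) ^ (-γ))⁻¹ ≤ ε / 4 := by
    have hR : 0 < 4 * (n + 1 : ℝ) * (1 - (2 : ℝ) ^ (-γ))⁻¹ := by positivity
    refine ⟨min 1 (ε / 4 / (4 * (n + 1) * (1 - (2 : ℝ) ^ (-γ))⁻¹)),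
      lt_min one_pos (by positivity), min_le_left _ _, ?_⟩
    calc _ ≤ 4 * (n + 1 : ℝ) * (ε / 4 / (4 * (n + 1) * (1 - (2 : ℝ) ^ (-γ))⁻¹)) *
          (1 - (2 : ℝ) ^ (-γ))⁻¹ := by
          gcongr
          · linarith
          · exact min_le_right _ _
      _ = ε / 4 := by field_simp
  -- The level `A` is large enough for the root to be live and for the stopped cells to have measure
  -- at most `(ε/4) μ(Q)`.
  obtain ⟨A, hBA, hA0, hA⟩ : ∃ A : ℝ, B ≤ A ∧ 0 < A ∧ 4 * B ≤ ε * A := by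
    refine ⟨4 * (B + 1) / ε, ?_, by positivity, ?_⟩
    · rw [le_div_iff₀ hε0]; nlinarith
    · rw [mul_div_cancel₀ _ hε0.ne']; linarith
  set D : ℝ := n + 1 with hD
  -- Chebyshev then gives measure at most `(ε/4) μ(Q)` to the points where the majorants are large.
  obtain ⟨Λ, hΛ, hΛC⟩ : ∃ Λ : ℝ, 1 ≤ Λ ∧
      (StoppedPair.energyC m α K Cμ D c₀ * ENNReal.ofReal (14 * A) +
        StoppedPair.massC m α K Cμ D c₀) * ENNReal.ofReal B ≤ ENNReal.ofReal (ε / 4 * Λ) := by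
    set E := (StoppedPair.energyC m α K Cμ D c₀ * ENNReal.ofReal (14 * A) +
        StoppedPair.massC m α K Cμ D c₀) * ENNReal.ofReal B with hE
    have hEtop : E ≠ ∞ := ENNReal.mul_ne_top (ENNReal.add_ne_top.2
      ⟨ENNReal.mul_ne_top (StoppedPair.energyC_ne_top hα) ENNReal.ofReal_ne_top,
        StoppedPair.massC_ne_top hα⟩) ENNReal.ofReal_ne_top
    refine ⟨max 1 (E.toReal * 4 / ε), le_max_left _ _, ?_⟩
    refine (ENNReal.ofReal_toReal hEtop).symm.le.trans (ENNReal.ofReal_le_ofReal ?_)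
    calc E.toReal = ε / 4 * (E.toReal * 4 / ε) := by field_simp
      _ ≤ _ := by gcongr; exact le_max_right _ _
  -- The weak type hypothesis at this height leaves a set of measure at most `(ε/4) μ(Q)` where `V_Q
  -- ν` is larger.
  obtain ⟨lam, hlam, hlamB⟩ : ∃ lam : ℝ, 0 < lam ∧ (B₁ : ℝ) * B₂ ≤ ε / 4 * lam ^ s := by
    have h0 : (0 : ℝ) < 4 * B₁ * B₂ / ε + 1 := by positivity
    refine ⟨(4 * B₁ * B₂ / ε + 1) ^ (1 / s), by positivity, ?_⟩
    rw [← Real.rpow_mul h0.le, one_div_mul_cancel hs.ne', Real.rpow_one]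
    have : ε / 4 * (4 * B₁ * B₂ / ε + 1) = B₁ * B₂ + ε / 4 := by field_simp
    linarith
  set R : ℝ := Cμ * (n + 1) ^ m with hR
  set CT : ℝ≥0∞ := ENNReal.ofReal (4 / ε) * StoppedPair.controlledC m α K Cμ D c₀ lam Λ +
    ENNReal.ofReal (K ^ 2 * R ^ 2 / (2 * m)) with hCT
  have hCTtop : CT ≠ ∞ := ENNReal.add_ne_top.2 ⟨ENNReal.mul_ne_top ENNReal.ofReal_ne_top
    (ENNReal.add_ne_top.2 ⟨ENNReal.mul_ne_top (by norm_num) (StoppedPair.energyC_ne_top hα),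
      ENNReal.mul_ne_top (by norm_num) ENNReal.ofReal_ne_top⟩), ENNReal.ofReal_ne_top⟩
  refine ⟨ε₀ / 2, NNReal.sqrt CT.toNNReal, by positivity, ?_⟩
  have hCsq : ((NNReal.sqrt CT.toNNReal : ℝ≥0) : ℝ≥0∞) ^ 2 = CT := by
    rw [← ENNReal.coe_pow, NNReal.sq_sqrt, ENNReal.coe_toNNReal hCTtop]
  intro k₁ μ Q ν U hk₁ hμ hsupp hνQ hνB hνabs hUm hνU hweak
  have hkm := hk₁.measurable_extendKernel
  have hk := hk₁.extendKernel
  rw [← squareTrunc_extendKernel] at hweak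
  simp_rw [← squareFun_extendKernel k₁]
  set k := extendKernel k₁ with hkdef
  have hQm := Q.measurableSet
  have hQtop : μ Q.toSet ≠ ∞ := ne_top_of_le_ne_top ENNReal.ofReal_ne_top (Q.measure_le hμ)
  set M : ℝ := μ.real Q.toSet with hMdef
  have hMμ : μ Q.toSet = ENNReal.ofReal M := (ENNReal.ofReal_toReal hQtop).symm
  have hM0 : 0 ≤ M := measureReal_nonneg
  -- If `μ(Q) = 0` the empty set will do.
  rcases hM0.eq_or_lt with hMz | hM
  · refine ⟨∅, MeasurableSet.empty, empty_subset _, ?_, fun f _ _ => ?_⟩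
    · rw [hMμ, ← hMz]; simp
    · simp
  have hfinμ : IsFiniteMeasure (μ.restrict Q.toSet) := ⟨by
    rw [Measure.restrict_apply_univ]; exact hQtop.lt_top⟩
  have hνuniv : ν.variation univ ≤ B₁ * ENNReal.ofReal M := by rw [← hMμ]; exact hνB
  have hfinν : IsFiniteMeasure ν.variation :=
    ⟨hνuniv.trans_lt (ENNReal.mul_lt_top ENNReal.coe_lt_top ENNReal.ofReal_lt_top)⟩
  obtain ⟨ρ, g, h, hρ, hgm, hgi, hg0, hhm, hhi, hgμ, hhν⟩ :=
    exists_common_density (μ.restrict Q.toSet) ν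
  let S : StoppedPair (EuclideanSpace ℝ (Fin n)) (Fin n → ℤ) :=
    { toCellTree := gridTree Q.side 0, ρ := ρ, finite_ρ := hρ, g := g, h := h, A := A,
      measurable_g := hgm, integrable_g := hgi, g_nonneg := hg0, measurable_h := hhm,
      integrable_h := hhi, A_nonneg := hA0.le }
  have hSμ : S.μ = μ.restrict Q.toSet := hgμ
  have hSτ : S.τ = ν.variation := by
    rw [← hhν]; exact (Measure.variation_withDensityᵥ hhi).symm
  have hνc : ν.variation Q.toSetᶜ = 0 :=
    measure_mono_null (compl_subset_compl.2 hsupp) Measure.measure_compl_support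
  have hSg : ∫ x, S.g x ∂S.ρ = M := by
    have h1 := S.μ_apply MeasurableSet.univ
    rw [hSμ, Measure.restrict_apply_univ, Measure.restrict_univ, hMμ] at h1
    exact ((ENNReal.ofReal_eq_ofReal_iff hM0 (integral_nonneg S.g_nonneg)).1 h1).symm
  have hSh : ∫ x, S.h x ∂S.ρ = (M : ℂ) := by
    have h1 : ν Q.toSetᶜ = 0 := by
      have := VectorMeasure.enorm_measure_le_variation ν Q.toSetᶜ
      rw [hνc] at this
      simpa using this
    have h2 : ∀ E, MeasurableSet E → ν E = ∫ x in E, S.h x ∂S.ρ := fun E hE => by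
      rw [← hhν]; exact withDensityᵥ_apply hhi hE
    rw [← integral_add_compl hQm hhi, ← h2 _ hQm, ← h2 _ hQm.compl, h1, hνQ, add_zero]
  have hShB : ∫ x, ‖S.h x‖ ∂S.ρ ≤ B * M := by
    have h1 : ENNReal.ofReal (∫ x, ‖S.h x‖ ∂S.ρ) = ν.variation univ := by
      rw [← hSτ, StoppedPair.τ, withDensity_apply _ MeasurableSet.univ, Measure.restrict_univ]
      exact ofReal_integral_norm_eq_lintegral_enorm hhi
    rw [← h1, ← ENNReal.ofReal_coe_nnreal, ← hB, ← ENNReal.ofReal_mul hB0] at hνuniv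
    exact (ENNReal.ofReal_le_ofReal_iff (by positivity)).1 hνuniv
  -- The bound `‖ν‖ ≤ B₁ μ(Q)` cancels the `B₁` in the denominators of the smallness hypotheses,
  -- which become `μ(Q)/32` and `μ(Q)/16`.
  have hvar : ∀ N : ℕ, 0 < N → ν.variation univ / (N * B₁) ≤ ENNReal.ofReal (M / N) := by
    intro N hN
    refine ENNReal.div_le_of_le_mul (hνuniv.trans (le_of_eq ?_))
    rw [← ENNReal.ofReal_coe_nnreal, ← hB, ← ENNReal.ofReal_natCast, ← ENNReal.ofReal_mul hB0,
      ← ENNReal.ofReal_mul (by positivity), ← ENNReal.ofReal_mul (by positivity)]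
    congr 1
    have : (N : ℝ) ≠ 0 := by positivity
    field_simp
  have habs : ∀ E, MeasurableSet E → S.μ E ≤ ENNReal.ofReal (ε * M) →
      S.τ E ≤ ENNReal.ofReal (M / 32) := by
    intro E hE hμE
    rw [hSμ, Measure.restrict_apply hE, ENNReal.ofReal_mul hε0.le, ← hMμ, hε,
      ENNReal.ofReal_coe_nnreal] at hμE
    have h1 := hνabs _ inter_subset_right (hE.inter hQm) hμE
    rw [hSτ, ← measure_inter_conull (s := E) hνc]
    exact h1.trans (by simpa using hvar 32 (by norm_num))
  have hU : S.τ U ≤ ENNReal.ofReal (M / 16) := by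
    rw [hSτ]; exact hνU.trans (by simpa using hvar 16 (by norm_num))
  set V : EuclideanSpace ℝ (Fin n) → ℝ≥0∞ := fun x =>
    ∫⁻ t in Ioc 0 Q.side, ‖∫ y, k t x y * S.h y ∂S.ρ‖ₑ ^ 2 / ENNReal.ofReal t with hV
  have hVm : Measurable V := Measurable.lintegral_prod_right'
    (ν := volume.restrict (Ioc 0 Q.side))
    (f := fun q : EuclideanSpace ℝ (Fin n) × ℝ =>
      ‖∫ y, k q.2 q.1 y * S.h y ∂S.ρ‖ₑ ^ 2 / ENNReal.ofReal q.2)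
    ((((measurable_theta hkm S.ρ S.measurable_h).comp measurable_swap).enorm.pow_const 2).div
      (ENNReal.measurable_ofReal.comp measurable_snd))
  have hVν : ∀ x, squareTrunc k Q ν x = V x ^ (1 / 2 : ℝ) := fun x => by
    rw [← hhν]; exact squareTrunc_withDensity hk hm hα hhm hhi Q x
  set E₀ : Set (EuclideanSpace ℝ (Fin n)) :=
    (Q.toSet \ U) ∩ {x | squareTrunc k Q ν x ≤ ENNReal.ofReal lam} with hE₀
  have hE₀m : MeasurableSet E₀ := by
    refine (hQm.diff hUm).inter (measurableSet_le ?_ measurable_const)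
    rw [funext hVν]
    exact hVm.pow_const _
  have hE₀V : ∀ x ∈ E₀, V x ≤ ENNReal.ofReal (lam ^ 2) := by
    intro x hx
    have h1 : squareTrunc k Q ν x ≤ ENNReal.ofReal lam := hx.2
    rw [hVν] at h1
    rw [← ennreal_rpow_half_sq (V x), ENNReal.ofReal_pow hlam.le]
    gcongr
  have hE₀μ : S.μ (E₀ᶜ \ U) ≤ ENNReal.ofReal (ε / 4 * M) := by
    rw [hSμ, Measure.restrict_apply (hE₀m.compl.diff hUm)]
    refine le_trans (measure_mono ?_)
      (measure_squareTrunc_gt_le hlam hM0 hweak hνuniv hlamB)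
    rintro x ⟨⟨h1, h2⟩, h3⟩
    refine ⟨⟨h3, h2⟩, ?_⟩
    by_contra h4
    exact h1 ⟨⟨h3, h2⟩, not_lt.1 h4⟩
  have hadm : ∀ w, (S.onGrid Q.side w).Admissible k m α K Cμ Q.side D c₀ := fun w =>
    { kernel := hk
      m_pos := hm
      α_pos := hα
      ℓ_pos := Q.side_pos
      one_le_D := by rw [hD]; linarith [(Nat.cast_nonneg n : (0 : ℝ) ≤ n)]
      diam := diamLE_gridTree Q.side_pos w
      order := fun x r hr => by
        change S.μ _ ≤ _
        rw [hSμ]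
        exact (Measure.restrict_apply_le _ _).trans (hμ x r hr)
      c₀_pos := hc₀
      c₀_le_one := hc₀1 }
  have hgood : ∀ j x, shiftMeasure n {w | (w, x) ∉ gridGood n Q.side γ c₀ j} ≤
      ENNReal.ofReal (ε / 4) := fun j x =>
    (shiftMeasure_not_good_le Q.side hγ0 hc₀.le j x).trans (ENNReal.ofReal_le_ofReal hc₀ε)
  set G := S.largeSet Q.side k γ c₀ Λ ε E₀ with hG
  have hGm : MeasurableSet G := StoppedPair.measurableSet_largeSet hkm γ c₀ Λ ε hE₀m
  have hGsub : G ⊆ Q.toSet \ U :=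
    (StoppedPair.largeSet_subset hε0 E₀).trans inter_subset_left
  refine ⟨G, hGm, hGsub, ?_, fun f hf hf0 => ?_⟩
  -- In every grid the controlled points have measure at least `ε μ(Q)`; averaging over the shift
  -- keeps half of it, whence `c = ε₀/2`.
  · have h1 := le_measure_of_le_measure_sections (shiftMeasure n) S.μ
      (StoppedPair.measurableSet_controlled (S := S) (ℓ := Q.side) hkm γ c₀ Λ hE₀m) hε0.le hM0
      (by rw [hSμ, Measure.restrict_apply_univ, hMμ])
      (fun w => StoppedPair.le_measure_controlled (hadm w) hkm hE₀m hUm hM hSg hSh hShB hε0 habs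
        hU hE₀μ hBA hA0 hA hΛ hΛC)
    have h2 : S.μ G ≤ μ G := by rw [hSμ]; exact Measure.restrict_apply_le _ _
    refine le_trans (le_of_eq ?_) (h1.trans h2)
    rw [hMμ, ENNReal.ofReal_mul (by positivity), ← ENNReal.ofReal_coe_nnreal, hε]
    congr 2
  · refine eLpNorm_indicator_squareFun_le hGm (hGsub.trans sdiff_subset) (fun f' hf'm hf'2 => ?_)
      hf hf0
    rw [hCsq, ← hSμ]
    rw [← hSμ] at hf'2
    refine StoppedPair.lintegral_largeSet_squareSq_le hadm hkm hE₀m hε0 (by positivity) hE₀V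
      hgood ?_ hf'm hf'2
    rw [hSμ, Measure.restrict_apply_univ]
    exact Q.measure_le hμ
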